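/- Let $0<m<1$, $\nu>0$, and let $h$ be a probability density on $\mathbb R$ with $h(-x)=h(x)$ for a.e. $x$. Let $C$ be the rooted branching cluster: the counting measure with one unit atom per individual of a Galton--Watson tree with Poisson$(m)$ offspring numbers, the root placed at $0$ and every other individual displaced from its parent by an independent amount with density $h$. Let $N=\sum_j\vartheta_{U_j}C_j$ be the stationary Poisson branching-cluster process, where $\{U_j\}$ is a homogeneous Poisson process of rate $\nu$ on $\mathbb R$, the $C_j$ are i.i.d. copies of $C$ independent of $\{U_j\}$, and $\vartheta_u\mu(A)=\mu(A-u)$. For $n\ge 2$, the reduced complete cumulant measure $\gamma_n^{\mathrm{red}}$ and the reduced factorial cumulant measure $\kappa_n^{\mathrm{red}}$ of order $n$ are the finite signed measures $M$ on $\mathbb R^{n-1}$ such that, for all bounded compactly supported Borel functions $f_0,\dots,f_{n-1}$, $$\int_{\mathbb R}\int_{\mathbb R^{n-1}} f_0(t)\prod_{r=1}^{n-1}f_r(t+\tau_r)\,M(d\tau)\,dt=\partial_{s_0}\cdots\partial_{s_{n-1}}\,\mathcal K\Big(\sum_j s_jf_j\Big)\Big|_{s=0},$$ where $\mathcal K(f)=\log\mathbb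 E\,e^{\int f\,dN}$ for $\gamma_n^{\mathrm{red}}$ and $\mathcal K(q)=\log\mathbb E\prod_{x\in N}(1+q(x))$ for $\kappa_n^{\mathrm{red}}$; it is part of the definition that the expectations are finite for $s$ near $0$ and that the derivatives exist. The Fourier--Stieltjes transform of $M$ is $\widehat M(\omega)=\int e^{-i\omega\cdot\tau}M(d\tau)$. Then: 1. $C\stackrel d=-C$, where $-C$ is the image of $C$ under $x\mapsto -x$. 2. The total progeny $C(\mathbb R)$ is a.s. finite and has the Borel law $\mathbb P(C(\mathbb R)=n)=e^{-mn}(mn)^{n-1}/n!$ for $n\ge1$; it has finite exponential moments in a neighbourhood of the origin, and $\mathbb E[C(\mathbb R)^3]<\infty$. 3. $N$ is reversible: $N$ has the same law as the reflected process $A\mapsto N(-A)$. 4. $\gamma_3^{\mathrm{red}}$, $\kappa_3^{\mathrm{red}}$ and $\kappa_2^{\mathrm{red}}$ exist, and $\widehat{\gamma_3^{\mathrm{red}}}(\omega)$ and $\widehat{\kappa_3^{\mathrm{red}}}(\omega)$ are real for all $\omega\in\mathbb R^2$. 5. If $\kappa_3^{\mathrm{red}}$ has a density $c_3\in L^1(\mathbb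 R^2)$, then $\int_{\mathbb R^2} c_3(\tau)e^{-i\omega\cdot\tau}\,d\tau$ is real for all $\omega\in\mathbb R^2$. 6. With $\lambda=\nu/(1-m)$, one has $\gamma_3^{\mathrm{red}}=\kappa_3^{\mathrm{red}}+\Delta$, where $\Delta$ is the sum of the images of $\kappa_2^{\mathrm{red}}$ under $\tau\mapsto(\tau,0)$, $\tau\mapsto(0,\tau)$, $\tau\mapsto(\tau,\tau)$ and of $\lambda\delta_{(0,0)}$; the measure $\Delta$ is singular with respect to Lebesgue measure and $\widehat\Delta(\omega)$ is real for all $\omega\in\mathbb R^2$. -/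

import Mathlib

open MeasureTheory ProbabilityTheory Filter Topology

namespace BranchingCluster

noncomputable section

/-! ### The rooted branching cluster

Individuals carry Ulam-Harris labels: `[]` is the root and `i :: v` is the `i`-th child of `v`.
`K v` is the number of children of `v`, and `D v` is the displacement of `v` from its parent. -/

/-- The individual with label `v` is born. -/
def IsBorn (K : List ℕ → ℕ) : List ℕ → Prop
  | [] => True
  | i :: v => IsBorn K v ∧ i < K v

/-- The position of the individual `v`; the root is at the origin. -/
def position (D : List ℕ → ℝ) : List ℕ → ℝ
  | [] => 0
  | i :: v => position D v + D (i :: v)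

open Classical in
/-- The cluster as a counting measure: one unit atom for every individual that is born,
the root included. -/
def cluster (K : List ℕ → ℕ) (D : List ℕ → ℝ) : Measure ℝ :=
  Measure.sum fun v : List ℕ => if IsBorn K v then Measure.dirac (position D v) else 0

/-! ### Point processes on the line -/

variable {Ω : Type*} [MeasurableSpace Ω]

/-- `η` is a Poisson point process with intensity measure `Λ`. -/
structure IsPoissonProcess {E : Type*} [MeasurableSpace E] (P : Measure Ω)
    (η : Ω → Measure E) (Λ : Measure E) : Prop where
  measurable : Measurable η
  law : ∀ A : Set E, MeasurableSet A → Λ A < ⊤ →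
    P.map (fun ω => η ω A) =
      (poissonMeasure (Λ A).toNNReal).map (fun n : ℕ => (n : ENNReal))
  indep : ∀ (n : ℕ) (A : Fin n → Set E), (∀ i, MeasurableSet (A i)) →
    Pairwise (fun i j => Disjoint (A i) (A j)) →
    iIndepFun (fun i ω => η ω (A i)) P

/-- The stochastic data of the stationary Poisson branching-cluster process: the immigrants `U j`
form a homogeneous Poisson process of rate `ν`; in the family tree of each immigrant the offspring
numbers are Poisson with mean `m` and the displacements have density `h` (so that the offspring of
an individual form a Poisson process with intensity `m h(x) dx` around it); everything is
independent. -/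
structure IsBranchingModel (P : Measure Ω) (m ν : ℝ) (h : ℝ → ℝ) (U : ℕ → Ω → ℝ)
    (K : ℕ → List ℕ → Ω → ℕ) (D : ℕ → List ℕ → Ω → ℝ) : Prop where
  measurable_U : ∀ j, Measurable (U j)
  measurable_K : ∀ j v, Measurable (K j v)
  measurable_D : ∀ j v, Measurable (D j v)
  immigrants : IsPoissonProcess P (fun ω => Measure.sum fun j => Measure.dirac (U j ω))
    (ENNReal.ofReal ν • (volume : Measure ℝ))
  law_marks : ∀ j v, P.map (fun ω => (K j v ω, D j v ω)) =
    (poissonMeasure m.toNNReal).prod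
      ((volume : Measure ℝ).withDensity fun x => ENNReal.ofReal (h x))
  indep_marks : iIndepFun (fun (p : ℕ × List ℕ) ω => (K p.1 p.2 ω, D p.1 p.2 ω)) P
  indep_immigrants : IndepFun (fun ω (j : ℕ) => U j ω)
    (fun ω (p : ℕ × List ℕ) => (K p.1 p.2 ω, D p.1 p.2 ω)) P

/-- The cluster `C_j` of the `j`-th immigrant, seen from that immigrant. -/
def rootedCluster (K : ℕ → List ℕ → Ω → ℕ) (D : ℕ → List ℕ → Ω → ℝ) (j : ℕ) (ω : Ω) :
    Measure ℝ :=
  cluster (fun v => K j v ω) (fun v => D j v ω)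

/-- The translate of `μ` by `u`, that is `A ↦ μ (A - u)`. -/
def translate (u : ℝ) (μ : Measure ℝ) : Measure ℝ := μ.map fun x => x + u

/-- The reflection of `μ`, that is `A ↦ μ (-A)`. -/
def reflect (μ : Measure ℝ) : Measure ℝ := μ.map fun x => -x

/-- The cluster process `N`, the superposition of the clusters `C_j` translated by `U_j`. -/
def process (U : ℕ → Ω → ℝ) (K : ℕ → List ℕ → Ω → ℕ) (D : ℕ → List ℕ → Ω → ℝ) (ω : Ω) :
    Measure ℝ :=
  Measure.sum fun j => translate (U j ω) (rootedCluster K D j ω)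

/-- `N` and its reflection have the same law, as random measures. -/
def IsReversible (P : Measure Ω) (N : Ω → Measure ℝ) : Prop :=
  IdentDistrib N (fun ω => reflect (N ω)) P P

/-! ### Cumulant measures -/

/-- Bounded compactly supported Borel functions. -/
structure IsTestFunction (f : ℝ → ℝ) : Prop where
  measurable : Measurable f
  bounded : ∃ B : ℝ, ∀ x, |f x| ≤ B
  compact : HasCompactSupport f

/-- `∏_{x ∈ μ} (1 + q x)`, the product over the atoms of the counting measure `μ`, with
multiplicity. -/
def atomProd (μ : Measure ℝ) (q : ℝ → ℝ) : ℝ := ∏ᶠ x : ℝ, (1 + q x) ^ (μ {x}).toReal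

/-- The factorial cumulant generating functional `log E ∏_{x ∈ N} (1 + q x)`. -/
def facCGF (P : Measure Ω) (N : Ω → Measure ℝ) (q : ℝ → ℝ) : ℝ :=
  Real.log (∫ ω, atomProd (N ω) q ∂P)

/-- The complete cumulant generating functional `log E exp (∫ f dN)`. -/
def compCGF (P : Measure Ω) (N : Ω → Measure ℝ) (f : ℝ → ℝ) : ℝ :=
  Real.log (∫ ω, Real.exp (∫ x, f x ∂(N ω)) ∂P)

/-- The iterated partial derivative `∂_{s_0} ⋯ ∂_{s_{n-1}} F` exists at the origin (each inner
derivative existing for the remaining variables near the origin) and equals `a`. -/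
def HasMixedPartial : (n : ℕ) → ((Fin n → ℝ) → ℝ) → ℝ → Prop
  | 0, F, a => F 0 = a
  | n + 1, F, a => ∃ G : (Fin n → ℝ) → ℝ,
      (∀ᶠ s in 𝓝 (0 : Fin n → ℝ),
        HasDerivAt (fun r : ℝ => F (Fin.snoc (α := fun _ => ℝ) s r)) (G s) 0) ∧
      HasMixedPartial n G a

/-- `∫∫ f_0(t) f_1(t + τ_1) ⋯ f_n(t + τ_n) M(dτ) dt`. -/
def reducedPairing {n : ℕ} (M : SignedMeasure (Fin n → ℝ)) (f : Fin (n + 1) → ℝ → ℝ) : ℝ :=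
  ∫ t : ℝ, ∫ᵛ τ, f 0 t * ∏ j : Fin n, f j.succ (t + τ j) ∂<•M

/-- `M` is the reduced complete cumulant measure of order `n + 1` of `N`: a finite signed measure
given by the mixed derivatives at the origin of the complete cumulant generating functional, which
is finite near the origin. -/
def IsReducedCompleteCumulant (P : Measure Ω) (N : Ω → Measure ℝ) {n : ℕ}
    (M : SignedMeasure (Fin n → ℝ)) : Prop :=
  ∀ f : Fin (n + 1) → ℝ → ℝ, (∀ j, IsTestFunction (f j)) →
    (∀ᶠ s in 𝓝 (0 : Fin (n + 1) → ℝ),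
      Integrable (fun ω => Real.exp (∫ x, ∑ j, s j * f j x ∂(N ω))) P) ∧
    HasMixedPartial (n + 1) (fun s => compCGF P N fun x => ∑ j, s j * f j x)
      (reducedPairing M f)

/-- `M` is the reduced factorial cumulant measure of order `n + 1` of `N`: a finite signed measure
given by the mixed derivatives at the origin of the factorial cumulant generating functional, which
is finite near the origin. -/
def IsReducedFactorialCumulant (P : Measure Ω) (N : Ω → Measure ℝ) {n : ℕ}
    (M : SignedMeasure (Fin n → ℝ)) : Prop :=
  ∀ f : Fin (n + 1) → ℝ → ℝ, (∀ j, IsTestFunction (f j)) →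
    (∀ᶠ s in 𝓝 (0 : Fin (n + 1) → ℝ),
      Integrable (fun ω => atomProd (N ω) fun x => ∑ j, s j * f j x) P) ∧
    HasMixedPartial (n + 1) (fun s => facCGF P N fun x => ∑ j, s j * f j x)
      (reducedPairing M f)

/-- `exp (-i ω·τ)`. -/
def wave {q : ℕ} (w τ : Fin q → ℝ) : ℂ :=
  Complex.exp (-(Complex.I * ((∑ j, w j * τ j : ℝ) : ℂ)))

/-- The Fourier-Stieltjes transform `∫ exp (-i ω·τ) M(dτ)`. -/
def fourierStieltjes {q : ℕ} (M : SignedMeasure (Fin q → ℝ)) (w : Fin q → ℝ) : ℂ :=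
  ∫ᵛ τ, wave w τ ∂<•M

/-- The diagonal part of the reduced complete third cumulant, in terms of the intensity `lam` and
of the reduced second factorial cumulant `κ₂`: the images of `κ₂` on the three pair diagonals
`τ_2 = 0`, `τ_1 = 0`, `τ_1 = τ_2`, and mass `lam` at the origin. -/
def diagonalPart (lam : ℝ) (κ₂ : SignedMeasure (Fin 1 → ℝ)) : SignedMeasure (Fin 2 → ℝ) :=
  κ₂.map (fun τ => ![τ 0, 0]) + κ₂.map (fun τ => ![0, τ 0]) + κ₂.map (fun τ => ![τ 0, τ 0])
    + lam • (Measure.dirac (0 : Fin 2 → ℝ)).toSignedMeasure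

end

end BranchingCluster

/-! Everything rests on one formula. For a Poisson process of immigrants with i.i.d. clusters, `log
E exp ∫ f dN = ν ∫ (E exp (∫ f dϑ_u C) - 1) du` for small bounded `f` supported in a bounded window.
A placed cluster is a function of a pair `p` made of the immigrant's place and the marks of its
tree, `shot f p` is the integral of `f` against it, and `placedLaw` is the intensity of such pairs,
so the right side is `∫ (exp (shot f) - 1)` (`integral_exp_superposition`). The formula holds for
simple functions by independence of Poisson counts on disjoint sets, extends by Fatou and dominated
convergence, and passes to marked points by integrating out the marks
(`IsMarked.lintegral_exp_tsum`).

Cumulants. Differentiating three times under the integral gives `∫ ∏ shot f_j`. Expanding the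
product over triples of individuals and using translation invariance of Lebesgue measure identifies
the complete third cumulant with `familyMeasure`: `ν` times the mean measure of relative positions
of triples within one cluster. The factorial functional is the same one evaluated at `log (1 + q)`,
whose derivatives at `0` are `1, -1, 2`; hence the factorial cumulants are family measures corrected
on the diagonals where members of a family coincide. The correction is `Δ`; it lives on three lines
of the plane, so it is singular, and the mass at the origin is `λ = ν E C(ℝ) = ν / (1 - m)`. Since a
finite signed measure is determined by its pairings (`eq_of_reducedPairing_eq`), statements about
arbitrary reduced cumulants reduce to these explicit ones.

Symmetry. Changing the sign of all displacements keeps the genealogy and the law of the marks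
(`map_negMarks`). It sends a cluster to its reflection and a family's relative positions to their
negatives, so all the measures above are even and their transforms are real. Reversibility follows
because exponential functionals near zero determine the law: by analytic continuation they give the
characteristic functions of the counts on bounded sets.

Total progeny. The exponential functionals of the first `g` generations obey `a ↦ exp θ * exp (m (a
- 1))`; as `m < 1`, this map has a fixed point above `1` for some `θ > 0`, which bounds all of them
and yields the exponential moments used throughout. The Borel law comes from the functional equation
`T = z G(T)` of the generating series: it determines the coefficients of all powers `T ^ k`
recursively, and the Borel-Tanner probabilities satisfy the same recursion. -/

namespace BranchingCluster
noncomputable section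
open scoped ENNReal

/-! ### Family trees -/

/-- A label is either the root or a label in the subtree of a child of the root. -/
def listSnocEquiv : Option (ℕ × List ℕ) ≃ List ℕ where
  toFun o := o.elim [] fun p => p.2 ++ [p.1]
  invFun l := if h : l = [] then none else some (l.getLast h, l.dropLast)
  left_inv o := by cases o <;> simp
  right_inv l := by
    by_cases h : l = []
    · simp [h]
    · simp [h, List.dropLast_append_getLast]

/-- Labels list the youngest generation first, so the child of the root from which an individual
descends is the last entry. Splitting there, and not at the head, isolates whole subtrees. -/
theorem tsum_list_snoc (F : List ℕ → ℝ≥0∞) :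
    ∑' l, F l = F [] + ∑' i, ∑' w, F (w ++ [i]) := by
  rw [← listSnocEquiv.tsum_eq, ← ENNReal.tsum_prod (f := fun i w => F (w ++ [i])),
    ENNReal.tsum_eq_add_tsum_ite none]
  congr 1
  rw [← (Option.some_injective _).tsum_eq]
  · simp [listSnocEquiv]
  · rintro (_ | p) h
    · simp at h
    · exact ⟨p, rfl⟩

/-- The offspring numbers in the subtree of the `i`-th child of the root. -/
def subtree (K : List ℕ → ℕ) (i : ℕ) : List ℕ → ℕ := fun w => K (w ++ [i])

theorem isBorn_append_singleton (K : List ℕ → ℕ) (w : List ℕ) (i : ℕ) :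
    IsBorn K (w ++ [i]) ↔ i < K [] ∧ IsBorn (subtree K i) w := by
  induction w with
  | nil => simp [IsBorn]
  | cons a w ih =>
    simp only [List.cons_append, IsBorn, ih, subtree]
    tauto

open Classical in
/-- The number of individuals of the family tree with offspring numbers `K`. -/
def progeny (K : List ℕ → ℕ) : ℝ≥0∞ := ∑' v, if IsBorn K v then 1 else 0

open Classical in
/-- The number of individuals in the first `g` generations. -/
def progenyBefore (g : ℕ) (K : List ℕ → ℕ) : ℝ≥0∞ :=
  ∑' v : List ℕ, if IsBorn K v ∧ v.length < g then 1 else 0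

theorem tsum_ite_lt (n : ℕ) (f : ℕ → ℝ≥0∞) :
    ∑' i, (if i < n then f i else 0) = ∑ i ∈ Finset.range n, f i := by
  rw [tsum_eq_sum (s := Finset.range n) (fun i hi => if_neg (by simpa using hi))]
  exact Finset.sum_congr rfl fun i hi => if_pos (by simpa using hi)

theorem progeny_eq_one_add (K : List ℕ → ℕ) :
    progeny K = 1 + ∑ i ∈ Finset.range (K []), progeny (subtree K i) := by
  classical
  rw [progeny, tsum_list_snoc, ← tsum_ite_lt]
  congr 1
  · simp [IsBorn]
  · refine tsum_congr fun i => ?_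
    simp only [isBorn_append_singleton, progeny]
    by_cases hi : i < K [] <;> simp [hi]

theorem progenyBefore_zero (K : List ℕ → ℕ) : progenyBefore 0 K = 0 := by
  simp [progenyBefore]

theorem progenyBefore_succ (g : ℕ) (K : List ℕ → ℕ) :
    progenyBefore (g + 1) K = 1 + ∑ i ∈ Finset.range (K []), progenyBefore g (subtree K i) := by
  classical
  rw [progenyBefore, tsum_list_snoc, ← tsum_ite_lt]
  congr 1
  · simp [IsBorn]
  · refine tsum_congr fun i => ?_
    simp only [isBorn_append_singleton, progenyBefore]
    by_cases hi : i < K [] <;> simp [hi]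

/-- The number of individuals in the first `g` generations, as a natural number. -/
def bornCount : ℕ → (List ℕ → ℕ) → ℕ
  | 0, _ => 0
  | g + 1, K => 1 + ∑ i ∈ Finset.range (K []), bornCount g (subtree K i)

theorem progenyBefore_eq_bornCount (g : ℕ) (K : List ℕ → ℕ) :
    progenyBefore g K = bornCount g K := by
  induction g generalizing K with
  | zero => simp [progenyBefore_zero, bornCount]
  | succ g ih => simp [progenyBefore_succ, bornCount, ih]

theorem bornCount_mono (K : List ℕ → ℕ) : Monotone fun g => bornCount g K := by
  classical
  intro g g' hg
  have : progenyBefore g K ≤ progenyBefore g' K := by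
    refine ENNReal.tsum_le_tsum fun v => ?_
    by_cases h : IsBorn K v ∧ v.length < g
    · rw [if_pos h, if_pos ⟨h.1, h.2.trans_le hg⟩]
    · rw [if_neg h]; exact zero_le
  simpa [progenyBefore_eq_bornCount] using this

/-- A finite set of labels has bounded length, so each finite partial sum of `progeny` is dominated
by the count of some first generations. -/
theorem progeny_eq_iSup_bornCount (K : List ℕ → ℕ) :
    progeny K = ⨆ g, (bornCount g K : ℝ≥0∞) := by
  classical
  refine le_antisymm ?_ (iSup_le fun g => ?_)
  · rw [progeny, ENNReal.tsum_eq_iSup_sum]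
    refine iSup_le fun s => ?_
    refine le_trans ?_ (le_iSup _ (s.sup List.length + 1))
    rw [← progenyBefore_eq_bornCount]
    refine le_trans (Finset.sum_le_sum fun v hv => ?_) (ENNReal.sum_le_tsum s)
    by_cases h : IsBorn K v
    · rw [if_pos h, if_pos ⟨h, Nat.lt_succ_of_le (Finset.le_sup (f := List.length) hv)⟩]
    · simp [h]
  · rw [← progenyBefore_eq_bornCount]
    refine ENNReal.tsum_le_tsum fun v => ?_
    by_cases h : IsBorn K v <;> by_cases h' : v.length < g <;> simp [h, h']

theorem finite_isBorn {K : List ℕ → ℕ} (h : progeny K ≠ ∞) : {v | IsBorn K v}.Finite := by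
  classical
  refine (ENNReal.finite_const_le_of_tsum_ne_top h one_ne_zero).subset fun v hv => ?_
  simp [show IsBorn K v from hv]

theorem measurableSet_isBorn (v : List ℕ) : MeasurableSet {K : List ℕ → ℕ | IsBorn K v} := by
  induction v with
  | nil => simp [IsBorn]
  | cons i v ih =>
    exact ih.inter (measurableSet_lt measurable_const (measurable_pi_apply v))

theorem measurable_progeny : Measurable progeny := by
  classical
  exact Measurable.tsum fun v => Measurable.ite (measurableSet_isBorn v)
    measurable_const measurable_const

theorem measurable_bornCount (g : ℕ) : Measurable (bornCount g) := by
  classical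
  -- The recursion for `bornCount` has a random number of terms; measurability is read off from the
  -- series `progenyBefore` instead.
  have : Measurable (progenyBefore g) :=
    Measurable.tsum fun v => Measurable.ite
      ((measurableSet_isBorn v).inter (MeasurableSet.const _)) measurable_const measurable_const
  have h2 : Measurable fun K => (progenyBefore g K).toNNReal := this.ennreal_toNNReal
  have h3 : bornCount g = fun K => ⌊(progenyBefore g K).toNNReal⌋₊ := by
    ext K; simp [progenyBefore_eq_bornCount]
  rw [h3]
  exact Nat.measurable_floor.comp h2

/-! ### Galton-Watson trees -/

theorem append_singleton_injective : Function.Injective fun p : ℕ × List ℕ => p.2 ++ [p.1] := by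
  rintro ⟨i, w⟩ ⟨j, w'⟩ h
  have := List.append_inj' h rfl
  simp_all

/-- The law of the offspring numbers of a Galton-Watson tree with offspring law `ξ`. -/
def treeLaw (ξ : Measure ℕ) : Measure (List ℕ → ℕ) := Measure.infinitePi fun _ => ξ

variable (ξ : Measure ℕ) [IsProbabilityMeasure ξ]

instance : IsProbabilityMeasure (treeLaw ξ) := by unfold treeLaw; infer_instance

theorem measurable_subtrees : Measurable fun (K : List ℕ → ℕ) (i : ℕ) => subtree K i := by
  unfold subtree; fun_prop

theorem map_subtrees : (treeLaw ξ).map (fun K i => subtree K i) =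
    Measure.infinitePi fun _ : ℕ => treeLaw ξ := by
  have h1 := Measure.map_infinitePi_infinitePi_of_inj (P := fun _ : List ℕ => ξ)
    append_singleton_injective
  have h2 := Measure.infinitePi_map_curry (fun (_ : ℕ) (_ : List ℕ) => ξ)
  rw [← h1, Measure.map_map (by fun_prop) (by fun_prop)] at h2
  exact h2

/-- The subtrees use only labels `w ++ [i]`, none of which is the root; independent coordinates over
disjoint index sets generate independent σ-algebras. -/
theorem indepFun_root_subtrees :
    IndepFun (fun K : List ℕ → ℕ => K []) (fun K i => subtree K i) (treeLaw ξ) := by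
  have hi : iIndepFun (fun (v : List ℕ) (K : List ℕ → ℕ) => K v) (treeLaw ξ) :=
    iIndepFun_infinitePi (X := fun _ x => x) (by fun_prop)
  have hS : Disjoint ({[]} : Set (List ℕ)) {[]}ᶜ := disjoint_compl_right
  have := indep_iSup_of_disjoint (fun v => (measurable_pi_apply v).comap_le) hi hS
  rw [IndepFun_iff_Indep]
  refine indep_of_indep_of_le_left (indep_of_indep_of_le_right this ?_) ?_
  · refine Measurable.comap_le (m₁ := _) ?_
    refine @measurable_pi_lambda _ _ _ (_) _ _ fun i => @measurable_pi_lambda _ _ _ (_) _ _ fun w => ?_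
    refine Measurable.mono (comap_measurable fun K : List ℕ → ℕ => K (w ++ [i])) ?_ le_rfl
    exact le_iSup₂_of_le (f := fun v (_ : v ∈ ({[]}ᶜ : Set (List ℕ))) =>
      MeasurableSpace.comap (fun K : List ℕ → ℕ => K v) inferInstance) (w ++ [i]) (by simp) le_rfl
  · simp

theorem map_root_subtrees : (treeLaw ξ).map (fun K => (K [], fun i => subtree K i)) =
    ξ.prod (Measure.infinitePi fun _ : ℕ => treeLaw ξ) := by
  rw [(indepFun_iff_map_prod_eq_prod_map_map (measurable_pi_apply _).aemeasurable
    measurable_subtrees.aemeasurable).1 (indepFun_root_subtrees ξ), map_subtrees]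
  congr 1
  exact Measure.infinitePi_map_eval (fun _ : List ℕ => ξ) []

/-- The branching property: conditionally on the number of children of the root, the subtrees are
i.i.d. copies of the tree. All three recursions below (exponential moments, law of the progeny, mean
progeny) come from it. -/
theorem lintegral_treeLaw_eq_tsum {F : ℕ → (ℕ → List ℕ → ℕ) → ℝ≥0∞} (hF : ∀ k, Measurable (F k)) :
    ∫⁻ K, F (K []) (fun i => subtree K i) ∂(treeLaw ξ) =
      ∑' k, ξ {k} * ∫⁻ L, F k L ∂(Measure.infinitePi fun _ : ℕ => treeLaw ξ) := by
  have hm : Measurable fun p : ℕ × (ℕ → List ℕ → ℕ) => F p.1 p.2 :=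
    measurable_from_prod_countable_right hF
  have h1 : ∫⁻ K, F (K []) (fun i => subtree K i) ∂(treeLaw ξ) =
      ∫⁻ p, F p.1 p.2 ∂((treeLaw ξ).map fun K => (K [], fun i => subtree K i)) := by
    rw [lintegral_map hm ((measurable_pi_apply _).prodMk measurable_subtrees)]
  rw [h1, map_root_subtrees, lintegral_prod _ hm.aemeasurable, lintegral_countable']
  exact tsum_congr fun k => mul_comm _ _

/-- The generating function iteration `φ_{g+1} = R · G(φ_g)`, with `G` the offspring generating
function. -/
theorem lintegral_pow_bornCount_succ (R : ℝ≥0∞) (g : ℕ) :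
    ∫⁻ K, R ^ bornCount (g + 1) K ∂(treeLaw ξ) =
      R * ∑' k, ξ {k} * (∫⁻ K, R ^ bornCount g K ∂(treeLaw ξ)) ^ k := by
  have hm : Measurable fun K => R ^ bornCount g K :=
    (measurable_from_nat (f := fun n : ℕ => R ^ n)).comp (measurable_bornCount g)
  have h1 : ∀ K, R ^ bornCount (g + 1) K =
      (fun k (L : ℕ → List ℕ → ℕ) => R * ∏ i ∈ Finset.range k, R ^ bornCount g (L i)) (K [])
        (fun i => subtree K i) := fun K => by
    simp [bornCount, pow_add, Finset.prod_pow_eq_pow_sum]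
  have hmi : ∀ i : ℕ, Measurable fun L : ℕ → List ℕ → ℕ => R ^ bornCount g (L i) :=
    fun i => hm.comp (measurable_pi_apply i)
  rw [lintegral_congr h1, lintegral_treeLaw_eq_tsum ξ
    (F := fun k (L : ℕ → List ℕ → ℕ) => R * ∏ i ∈ Finset.range k, R ^ bornCount g (L i)) (fun k => measurable_const.mul (Finset.measurable_prod _ fun i _ => hmi i))]
  rw [← ENNReal.tsum_mul_left]
  refine tsum_congr fun k => ?_
  rw [lintegral_const_mul _ (Finset.measurable_prod _ fun i _ => hmi i),
    lintegral_prod_eq_prod_lintegral_of_indepFun _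
      (fun (i : ℕ) (L : ℕ → List ℕ → ℕ) => R ^ bornCount g (L i))
      (iIndepFun_infinitePi (X := fun _ K => R ^ bornCount g K) fun _ => hm) hmi]
  have : ∀ i : ℕ, ∫⁻ L : ℕ → List ℕ → ℕ, R ^ bornCount g (L i)
      ∂(Measure.infinitePi fun _ : ℕ => treeLaw ξ) = ∫⁻ K, R ^ bornCount g K ∂(treeLaw ξ) := by
    intro i
    rw [← lintegral_map hm (measurable_pi_apply i), Measure.infinitePi_map_eval]
  simp_rw [this, Finset.prod_const, Finset.card_range]
  ring
end
end BranchingCluster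

/-! ### Exponential moments of the total progeny for Poisson offspring -/

namespace BranchingCluster
noncomputable section
open scoped ENNReal NNReal

theorem tsum_poissonMeasure_mul_pow (r : ℝ≥0) {x : ℝ} (hx : 0 ≤ x) :
    ∑' k : ℕ, poissonMeasure r {k} * ENNReal.ofReal x ^ k =
      ENNReal.ofReal (Real.exp (r * (x - 1))) := by
  have h : HasSum (fun k : ℕ => Real.exp (-r) * (r : ℝ) ^ k / k.factorial * x ^ k)
      (Real.exp (r * (x - 1))) := by
    have h0 := (NormedSpace.expSeries_div_hasSum_exp (r * x : ℝ)).mul_left (Real.exp (-r))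
    rw [← Real.exp_eq_exp_ℝ, ← Real.exp_add] at h0
    convert! h0 using 1
    · ext k; rw [mul_pow]; ring
    · congr 1; ring
  rw [← h.tsum_eq, ENNReal.ofReal_tsum_of_nonneg (fun k => by positivity) h.summable]
  refine tsum_congr fun k => ?_
  rw [poissonMeasure_singleton, ← ENNReal.ofReal_pow hx, ← ENNReal.ofReal_mul (by positivity)]

/-- The choice `θ = log (1 + δ) - r δ` makes `1 + δ` a fixed point of the increasing map `a ↦ exp θ
* exp (r (a - 1))`. The iteration starts at `1`, below the fixed point, and so never exceeds it.
With `δ = 1 - r` this `θ` is positive. -/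
theorem exists_forall_lintegral_exp_bornCount_le {r : ℝ≥0} (hr : r < 1) :
    ∃ θ : ℝ, 0 < θ ∧ ∃ C : ℝ≥0∞, C ≠ ∞ ∧ ∀ g,
      ∫⁻ K, ENNReal.ofReal (Real.exp θ) ^ bornCount g K ∂(treeLaw (poissonMeasure r)) ≤ C := by
  have hr' : (r : ℝ) < 1 := by exact_mod_cast hr
  set δ : ℝ := 1 - r with hδ
  have hδ0 : 0 < δ := by linarith
  have h1 : 2 * δ / (δ + 2) ≤ Real.log (1 + δ) := Real.le_log_one_add_of_nonneg hδ0.le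
  -- This is `r (δ + 2) < 2`, that is `(1 - r) (2 - r) > 0`.
  have h2 : r * δ < 2 * δ / (δ + 2) := by
    rw [lt_div_iff₀ (by linarith)]
    have : (r : ℝ) * (δ + 2) < 2 := by rw [hδ]; nlinarith [r.coe_nonneg]
    nlinarith
  refine ⟨Real.log (1 + δ) - r * δ, by linarith, ENNReal.ofReal (1 + δ), ENNReal.ofReal_ne_top,
    fun g => ?_⟩
  induction g with
  | zero =>
    simp only [bornCount, pow_zero, lintegral_const, measure_univ, mul_one]
    rw [← ENNReal.ofReal_one]
    exact ENNReal.ofReal_le_ofReal (by linarith)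
  | succ g ih =>
    rw [lintegral_pow_bornCount_succ]
    calc _ ≤ ENNReal.ofReal (Real.exp (Real.log (1 + δ) - r * δ)) *
          ∑' k : ℕ, poissonMeasure r {k} * ENNReal.ofReal (1 + δ) ^ k := by gcongr
      _ = ENNReal.ofReal (1 + δ) := by
        rw [tsum_poissonMeasure_mul_pow r (by linarith), ← ENNReal.ofReal_mul (Real.exp_pos _).le,
          ← Real.exp_add]
        have : Real.log (1 + δ) - r * δ + r * (1 + δ - 1) = Real.log (1 + δ) := by ring
        rw [this, Real.exp_log (by linarith)]

/-- A bounded monotone sequence of natural numbers attains its supremum. In particular a finite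
progeny is a natural number. -/
theorem exists_progeny_eq_bornCount {K : List ℕ → ℕ} (hK : progeny K ≠ ∞) :
    ∃ g, progeny K = bornCount g K := by
  obtain ⟨N, hN⟩ := ENNReal.exists_nat_gt hK
  have hle : ∀ g, bornCount g K ≤ N := fun g => by
    have := (le_iSup (fun g => (bornCount g K : ℝ≥0∞)) g).trans
      ((progeny_eq_iSup_bornCount K).symm.le.trans hN.le)
    exact_mod_cast this
  obtain ⟨g, hg⟩ := Nat.sSup_mem (s := Set.range fun g => bornCount g K) ⟨_, 0, rfl⟩
    ⟨N, by rintro _ ⟨g, rfl⟩; exact hle g⟩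
  refine ⟨g, ?_⟩
  rw [progeny_eq_iSup_bornCount]
  refine le_antisymm (iSup_le fun g' => ?_) (le_iSup (fun g => (bornCount g K : ℝ≥0∞)) g)
  have : bornCount g' K ≤ bornCount g K := by
    simp only [] at hg
    rw [hg]
    exact le_csSup ⟨N, by rintro _ ⟨g, rfl⟩; exact hle g⟩ ⟨g', rfl⟩
  exact_mod_cast this

theorem iSup_ofReal_exp_pow_eq_top {θ : ℝ} (hθ : 0 < θ) {K : List ℕ → ℕ} (hK : progeny K = ∞) :
    ⨆ g, ENNReal.ofReal (Real.exp θ) ^ bornCount g K = ∞ := by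
  rw [iSup_eq_top]
  intro b hb
  have h1 : Tendsto (fun n : ℕ => ENNReal.ofReal (Real.exp θ) ^ n) atTop (𝓝 ∞) :=
    ENNReal.tendsto_pow_atTop_nhds_top_iff.2 (by simpa using hθ)
  obtain ⟨n, hn⟩ := ((tendsto_order.1 h1).1 b hb).exists_forall_of_atTop
  rw [progeny_eq_iSup_bornCount, iSup_eq_top] at hK
  obtain ⟨g, hg⟩ := hK n (ENNReal.natCast_lt_top n)
  exact ⟨g, hn _ (by exact_mod_cast hg.le)⟩

theorem lintegral_iSup_exp_bornCount_ne_top {r : ℝ≥0} (hr : r < 1) :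
    ∃ θ : ℝ, 0 < θ ∧ ∫⁻ K, ⨆ g, ENNReal.ofReal (Real.exp θ) ^ bornCount g K
      ∂(treeLaw (poissonMeasure r)) ≠ ∞ := by
  obtain ⟨θ, hθ, C, hC, h⟩ := exists_forall_lintegral_exp_bornCount_le hr
  refine ⟨θ, hθ, ne_top_of_le_ne_top hC ?_⟩
  rw [lintegral_iSup]
  · exact iSup_le h
  · exact fun g => (measurable_from_nat (f := fun n : ℕ => ENNReal.ofReal (Real.exp θ) ^ n)).comp
      (measurable_bornCount g)
  · exact fun g g' hg K => pow_le_pow_right₀ (by simp [hθ.le]) (bornCount_mono K hg)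

/-- The supremum over generations is infinite on infinite trees, so its integrability yields almost
sure finiteness and the exponential moment together, without assuming the former. -/
theorem exists_integrable_exp_progeny {r : ℝ≥0} (hr : r < 1) :
    (∀ᵐ K ∂(treeLaw (poissonMeasure r)), progeny K < ∞) ∧
    ∃ θ : ℝ, 0 < θ ∧
      Integrable (fun K => Real.exp (θ * (progeny K).toReal)) (treeLaw (poissonMeasure r)) := by
  obtain ⟨θ, hθ, h⟩ := lintegral_iSup_exp_bornCount_ne_top hr
  have hm : Measurable fun K => ⨆ g, ENNReal.ofReal (Real.exp θ) ^ bornCount g K :=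
    Measurable.iSup fun g =>
      (measurable_from_nat (f := fun n : ℕ => ENNReal.ofReal (Real.exp θ) ^ n)).comp
      (measurable_bornCount g)
  have hfin : ∀ᵐ K ∂(treeLaw (poissonMeasure r)), progeny K < ∞ := by
    filter_upwards [ae_lt_top hm h] with K hK
    by_contra hc
    rw [not_lt_top_iff] at hc
    exact hK.ne (iSup_ofReal_exp_pow_eq_top hθ hc)
  refine ⟨hfin, θ, hθ, ?_, ?_⟩
  · exact (Real.measurable_exp.comp
      (measurable_const.mul measurable_progeny.ennreal_toReal)).aestronglyMeasurable
  · refine lt_of_le_of_lt (lintegral_mono_ae ?_) h.lt_top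
    filter_upwards [hfin] with K hK
    obtain ⟨g, hg⟩ := exists_progeny_eq_bornCount hK.ne
    refine le_trans (le_of_eq ?_) (le_iSup _ g)
    rw [hg, Real.enorm_of_nonneg (Real.exp_pos _).le, ← ENNReal.ofReal_pow (Real.exp_pos _).le,
      ← Real.exp_nat_mul]
    simp [mul_comm]
end
end BranchingCluster

/-! ### The Borel law of the total progeny -/

namespace BranchingCluster
noncomputable section
open scoped ENNReal NNReal

theorem exists_sum_progeny_eq_natCast (L : ℕ → List ℕ → ℕ) (s : Finset ℕ)
    (h : ∑ i ∈ s, progeny (L i) ≠ ∞) : ∃ n : ℕ, ∑ i ∈ s, progeny (L i) = n := by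
  have : ∀ i ∈ s, ∃ n : ℕ, progeny (L i) = n := fun i hi => by
    obtain ⟨g, hg⟩ := exists_progeny_eq_bornCount (ENNReal.sum_ne_top.1 h i hi)
    exact ⟨_, hg⟩
  choose! f hf using this
  exact ⟨∑ i ∈ s, f i, by rw [Finset.sum_congr rfl hf]; push_cast; rfl⟩

section
variable (ξ : Measure ℕ)

/-- The probability generating function of the total progeny, as a formal power series. -/
def progenySeries : PowerSeries ℝ≥0∞ :=
  PowerSeries.mk fun n => treeLaw ξ {K | progeny K = n}

/-- Sums of independent integers correspond to products of generating series. Induction on `k`,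
splitting the event by the sizes of the first `k` trees together and of the last one. -/
theorem measure_sum_progeny_eq [IsProbabilityMeasure ξ] (k n : ℕ) :
    (Measure.infinitePi fun _ : ℕ => treeLaw ξ)
      {L | ∑ i ∈ Finset.range k, progeny (L i) = n} =
      PowerSeries.coeff n (progenySeries ξ ^ k) := by
  set Q := Measure.infinitePi fun _ : ℕ => treeLaw ξ with hQ
  have hm : ∀ i : ℕ, Measurable fun L : ℕ → List ℕ → ℕ => progeny (L i) :=
    fun i => measurable_progeny.comp (measurable_pi_apply i)
  induction k generalizing n with
  | zero =>
    rw [pow_zero, PowerSeries.coeff_one]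
    rcases eq_or_ne n 0 with rfl | hn
    · simp
    · have : {L : ℕ → List ℕ → ℕ | ∑ i ∈ Finset.range 0, progeny (L i) = n} = ∅ := by
        ext L; simpa [eq_comm] using hn
      rw [this, if_neg hn, measure_empty]
  | succ k ih =>
    have hi : IndepFun (fun L : ℕ → List ℕ → ℕ => ∑ i ∈ Finset.range k, progeny (L i))
        (fun L => progeny (L k)) Q := by
      have h0 : iIndepFun (fun (i : ℕ) (L : ℕ → List ℕ → ℕ) => progeny (L i)) Q :=
        iIndepFun_infinitePi (X := fun _ K => progeny K) fun _ => measurable_progeny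
      convert! h0.indepFun_finsetSum_of_notMem hm (s := Finset.range k) (i := k) (by simp) using 1
      ext L; simp
    have hset : {L : ℕ → List ℕ → ℕ | ∑ i ∈ Finset.range (k + 1), progeny (L i) = n} =
        ⋃ p ∈ Finset.HasAntidiagonal.antidiagonal n,
          {L : ℕ → List ℕ → ℕ | ∑ i ∈ Finset.range k, progeny (L i) = (p.1 : ℕ)} ∩
            {L | progeny (L k) = (p.2 : ℕ)} := by
      ext L
      simp only [Set.mem_ofPred_eq, Finset.sum_range_succ, Finset.HasAntidiagonal.mem_antidiagonal,
        Set.mem_iUnion, Set.mem_inter_iff, exists_prop, Prod.exists]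
      constructor
      · intro h
        have h1 : ∑ i ∈ Finset.range k, progeny (L i) ≠ ∞ := fun h' => by simp [h'] at h
        have h2 : progeny (L k) ≠ ∞ := fun h' => by simp [h'] at h
        obtain ⟨a, ha⟩ := exists_sum_progeny_eq_natCast L _ h1
        obtain ⟨g, hg⟩ := exists_progeny_eq_bornCount h2
        refine ⟨a, bornCount g (L k), ?_, ha, hg⟩
        rw [ha, hg] at h
        exact_mod_cast h
      · rintro ⟨a, b, hab, ha, hb⟩
        rw [ha, hb, ← hab]; push_cast; rfl
    have hmeas : ∀ c : ℝ≥0∞, MeasurableSet {L : ℕ → List ℕ → ℕ |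
        ∑ i ∈ Finset.range k, progeny (L i) = c} := fun c =>
      (Finset.measurable_sum _ fun i _ => hm i) (measurableSet_singleton c)
    rw [hset, measure_biUnion_finset, pow_succ, PowerSeries.coeff_mul]
    · refine Finset.sum_congr rfl fun p _ => ?_
      have := hi.measure_inter_preimage_eq_mul {(p.1 : ℝ≥0∞)} {(p.2 : ℝ≥0∞)}
        (measurableSet_singleton _) (measurableSet_singleton _)
      rw [← ih, progenySeries, PowerSeries.coeff_mk]
      refine this.trans ?_
      congr 1
      rw [← Measure.infinitePi_map_eval (fun _ : ℕ => treeLaw ξ) k,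
        Measure.map_apply (measurable_pi_apply k)
          (measurable_progeny (measurableSet_singleton (p.2 : ℝ≥0∞)))]
      rfl
    · rintro ⟨a, b⟩ _ ⟨a', b'⟩ _ hne
      refine Set.disjoint_left.2 ?_
      rintro L ⟨h1, h2⟩ ⟨h3, h4⟩
      simp only [Set.mem_ofPred_eq] at h1 h2 h3 h4
      rw [h1] at h3; rw [h2] at h4
      exact hne (by ext <;> simp_all)
    · exact fun p _ => (hmeas _).inter ((hm k) (measurableSet_singleton _))

theorem coeff_zero_progenySeries : PowerSeries.coeff 0 (progenySeries ξ) = 0 := by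
  rw [progenySeries, PowerSeries.coeff_mk]
  have : {K : List ℕ → ℕ | progeny K = (0 : ℕ)} = ∅ := by
    ext K; rw [Set.mem_ofPred_eq, progeny_eq_one_add]; simp
  rw [this, measure_empty]

/-- The functional equation `T = z G(T)` read coefficientwise: the tree has `n + 1` individuals
exactly when the subtrees of the root's children have `n` together. -/
theorem coeff_succ_progenySeries [IsProbabilityMeasure ξ] (n : ℕ) : PowerSeries.coeff (n + 1) (progenySeries ξ) =
    ∑' j, ξ {j} * PowerSeries.coeff n (progenySeries ξ ^ j) := by
  have hS : ∀ k, MeasurableSet {L : ℕ → List ℕ → ℕ |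
      ∑ i ∈ Finset.range k, progeny (L i) = n} := fun k =>
    (Finset.measurable_sum _ fun i _ => measurable_progeny.comp (measurable_pi_apply i))
      (measurableSet_singleton _)
  simp_rw [← measure_sum_progeny_eq]
  rw [progenySeries, PowerSeries.coeff_mk]
  have h := lintegral_treeLaw_eq_tsum ξ (F := fun k => Set.indicator {L : ℕ → List ℕ → ℕ |
      ∑ i ∈ Finset.range k, progeny (L i) = n} 1) fun k => measurable_one.indicator (hS k)
  simp_rw [lintegral_indicator_one (hS _)] at h
  have h2 := lintegral_indicator_one (μ := treeLaw ξ)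
    (measurable_progeny (measurableSet_singleton ((n + 1 : ℕ) : ℝ≥0∞)))
  rw [← h]
  refine h2.symm.trans ?_
  refine lintegral_congr fun K => ?_
  have : (K ∈ progeny ⁻¹' {((n + 1 : ℕ) : ℝ≥0∞)}) ↔ (fun i => subtree K i) ∈
      {L : ℕ → List ℕ → ℕ | ∑ i ∈ Finset.range (K []), progeny (L i) = n} := by
    simp only [Set.mem_preimage, Set.mem_singleton_iff, Set.mem_ofPred_eq]
    rw [progeny_eq_one_add, Nat.cast_succ, add_comm (n : ℝ≥0∞)]
    exact ENNReal.add_right_inj ENNReal.one_ne_top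
  by_cases hK : K ∈ progeny ⁻¹' {((n + 1 : ℕ) : ℝ≥0∞)}
  · rw [Set.indicator_of_mem hK, Set.indicator_of_mem (this.1 hK)]; rfl
  · rw [Set.indicator_of_notMem hK, Set.indicator_of_notMem (fun h => hK (this.2 h))]

/-- The functional equation multiplied by `T ^ k`; the boundary term of the Cauchy product vanishes
because `T` has no constant coefficient. As `n` drops by one while all powers are allowed, this
recursion determines every coefficient. -/
theorem coeff_succ_progenySeries_pow_succ [IsProbabilityMeasure ξ] (k n : ℕ) :
    PowerSeries.coeff (n + 1) (progenySeries ξ ^ (k + 1)) =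
      ∑' j, ξ {j} * PowerSeries.coeff n (progenySeries ξ ^ (k + j)) := by
  rw [pow_succ, PowerSeries.coeff_mul, Finset.Nat.sum_antidiagonal_succ',
    coeff_zero_progenySeries, mul_zero]
  simp_rw [pow_add, PowerSeries.coeff_mul, coeff_succ_progenySeries, ← ENNReal.tsum_mul_left,
    Finset.mul_sum]
  rw [Summable.tsum_finsetSum fun _ _ => ENNReal.summable, zero_add]
  exact Finset.sum_congr rfl fun p _ => tsum_congr fun j => by ring

end

/-- The binomial theorem after absorbing the weight: `j` times `N choose j` is `N` times `N - 1
choose j - 1`. -/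
theorem sum_mul_choose_mul_pow (N : ℕ) (y : ℝ) :
    ∑ j ∈ Finset.range (N + 1), (j : ℝ) * N.choose j * y ^ (N - j) = N * (1 + y) ^ (N - 1) := by
  rcases N with _ | N
  · simp
  rw [Finset.sum_range_succ', add_comm 1 y, add_tsub_cancel_right, add_comm y 1, add_pow,
    Finset.mul_sum]
  simp only [Nat.cast_zero, zero_mul, add_zero]
  refine Finset.sum_congr rfl fun j _ => ?_
  have := Nat.add_one_mul_choose_eq N j
  have h2 : ((N : ℝ) + 1) * N.choose j = (N + 1).choose (j + 1) * (j + 1) := by exact_mod_cast this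
  rw [Nat.add_sub_add_right]
  push_cast
  rw [one_pow]
  linear_combination (-y ^ (N - j)) * h2

/-- The law at `n` of the total progeny of `k` Galton-Watson trees with Poisson offspring. -/
def borelTanner (r : ℝ) (k n : ℕ) : ℝ :=
  if n = 0 then if k = 0 then 1 else 0
  else if k ≤ n then k / n * (Real.exp (-(r * n)) * (r * n) ^ (n - k) / (n - k).factorial) else 0

theorem borelTanner_nonneg {r : ℝ} (hr : 0 ≤ r) (k n : ℕ) : 0 ≤ borelTanner r k n := by
  unfold borelTanner; split_ifs <;> positivity

/-- With `n = k + N` and `y = n`, every term carries the weight `(k + j) * N.choose j * y ^ (N -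
j)`, so the sum splits into a plain and a weighted binomial sum. -/
theorem sum_poisson_mul_borelTanner (r : ℝ) {k n : ℕ} (hkn : k ≤ n) :
    ∑ j ∈ Finset.range (n - k + 1),
      Real.exp (-r) * r ^ j / j.factorial * borelTanner r (k + j) n =
      borelTanner r (k + 1) (n + 1) := by
  rcases Nat.eq_zero_or_pos n with rfl | hn
  · obtain rfl : k = 0 := by omega
    simp [borelTanner]
  obtain ⟨N, rfl⟩ := Nat.exists_eq_add_of_le hkn
  have hn' : ((k + N : ℕ) : ℝ) ≠ 0 := by positivity
  have hkN : k + N - k = N := by omega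
  have hkN' : k + N + 1 - (k + 1) = N := by omega
  set y : ℝ := ((k + N : ℕ) : ℝ) with hy
  have hterm : ∀ j ∈ Finset.range (N + 1),
      Real.exp (-r) * r ^ j / j.factorial * borelTanner r (k + j) (k + N) =
      Real.exp (-(r * (y + 1))) * r ^ N / (N.factorial * y) *
        (k * (N.choose j * y ^ (N - j)) + j * N.choose j * y ^ (N - j)) := by
    intro j hj
    have hj' : j ≤ N := by simpa [Nat.lt_succ_iff] using hj
    rw [borelTanner, if_neg hn.ne', if_pos (by omega), ← hy]
    have h1 : k + N - (k + j) = N - j := by omega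
    have h2 : (N.choose j : ℝ) = N.factorial / (j.factorial * (N - j).factorial) :=
      Nat.cast_choose ℝ hj'
    have h3 : Real.exp (-(r * (y + 1))) = Real.exp (-r) * Real.exp (-(r * y)) := by
      rw [← Real.exp_add]; congr 1; ring
    have h4 : r ^ N = r ^ j * r ^ (N - j) := by rw [← pow_add]; congr 1; omega
    rw [h1, h2, h3, h4, mul_pow]
    have := Nat.factorial_ne_zero N
    have := Nat.factorial_ne_zero j
    have := Nat.factorial_ne_zero (N - j)
    push_cast
    field_simp
  have hb : ∑ j ∈ Finset.range (N + 1), (N.choose j : ℝ) * y ^ (N - j) = (1 + y) ^ N := by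
    rw [add_pow]; exact Finset.sum_congr rfl fun j _ => by rw [one_pow]; ring
  rw [hkN, Finset.sum_congr rfl hterm, ← Finset.mul_sum, Finset.sum_add_distrib, ← Finset.mul_sum,
    hb, sum_mul_choose_mul_pow, borelTanner, if_neg (by omega), if_pos (by omega), hkN', mul_pow]
  have hy1 : ((k + N + 1 : ℕ) : ℝ) = y + 1 := by rw [hy]; push_cast; ring
  have hy1' : y + 1 ≠ 0 := by positivity
  rw [hy1]
  have hN := Nat.factorial_ne_zero N
  -- The point is `k (1 + y) + N = (k + 1) y`, which holds because `y = k + N`.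
  have key : k * (1 + y) ^ N + N * (1 + y) ^ (N - 1) = (k + 1) * y * (y + 1) ^ N / (y + 1) := by
    rcases N with _ | N
    · simp [hy]; field_simp
    · rw [add_tsub_cancel_right, eq_div_iff hy1', pow_succ, add_comm 1 y, hy]
      push_cast
      ring
  rw [key]
  push_cast
  field_simp

/-- Verification in place of Lagrange inversion: both sides obey the same recursion in `n`, and the
induction treats all powers `k` at once. -/
theorem coeff_progenySeries_pow (r : ℝ≥0) (k n : ℕ) :
    PowerSeries.coeff n (progenySeries (poissonMeasure r) ^ k) =
      ENNReal.ofReal (borelTanner r k n) := by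
  induction n generalizing k with
  | zero =>
    rcases k with _ | k
    · simp [borelTanner]
    · rw [PowerSeries.coeff_zero_eq_constantCoeff_apply, map_pow,
        ← PowerSeries.coeff_zero_eq_constantCoeff_apply, coeff_zero_progenySeries]
      simp [borelTanner]
  | succ n ih =>
    rcases k with _ | k
    · simp [borelTanner, PowerSeries.coeff_one]
    · rw [coeff_succ_progenySeries_pow_succ]
      simp_rw [ih, poissonMeasure_singleton]
      by_cases hkn : k ≤ n
      · rw [tsum_eq_sum (s := Finset.range (n - k + 1)), ← sum_poisson_mul_borelTanner _ hkn,
          ENNReal.ofReal_sum_of_nonneg (f := fun j => Real.exp (-r) * (r : ℝ) ^ j / j.factorial *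
            borelTanner r (k + j) n) fun j _ =>
            mul_nonneg (by positivity) (borelTanner_nonneg r.2 _ _)]
        · exact Finset.sum_congr rfl fun j _ => (ENNReal.ofReal_mul (by positivity)).symm
        · intro j hj
          have : n < k + j := by simp at hj; omega
          rw [borelTanner]
          split_ifs <;> first | omega | simp
      · rw [borelTanner, if_neg (by omega), if_neg (by omega), ENNReal.ofReal_zero,
          ENNReal.tsum_eq_zero]
        intro j
        rw [borelTanner]
        split_ifs <;> first | omega | simp

/-- The total progeny of a Galton-Watson tree with Poisson offspring has the Borel law. -/
theorem measure_progeny_eq (r : ℝ≥0) {n : ℕ} (hn : 1 ≤ n) :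
    treeLaw (poissonMeasure r) {K | progeny K = n} =
      ENNReal.ofReal (Real.exp (-(r * n)) * (r * n) ^ (n - 1) / n.factorial) := by
  have h := coeff_progenySeries_pow r 1 n
  rw [pow_one, progenySeries, PowerSeries.coeff_mk] at h
  rw [h, borelTanner, if_neg (by omega), if_pos hn]
  congr 1
  obtain ⟨k, rfl⟩ := Nat.exists_eq_add_of_le' hn
  rw [add_tsub_cancel_right, Nat.factorial_succ]
  push_cast
  field_simp
end
end BranchingCluster

namespace BranchingCluster
noncomputable section
open scoped ENNReal NNReal

/-! ### Exponential functionals of Poisson processes -/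

/-- The bound `|g n| ≤ |h|` holds pointwise, so the same approximants are dominated with respect to
the intensity and to every realisation of the point process. -/
theorem exists_simpleFunc_tendsto {E : Type*} [MeasurableSpace E] {h : E → ℝ} (hh : Measurable h) :
    ∃ g : ℕ → SimpleFunc E ℝ, (∀ n x, |g n x| ≤ |h x|) ∧ (∀ n x, 0 ≤ h x → 0 ≤ g n x) ∧
      ∀ x, Tendsto (fun n => g n x) atTop (𝓝 (h x)) := by
  have key : ∀ f : E → ℝ, Measurable f → ∃ g : ℕ → SimpleFunc E ℝ,
      (∀ n x, 0 ≤ g n x ∧ g n x ≤ max (f x) 0) ∧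
      ∀ x, Tendsto (fun n => g n x) atTop (𝓝 (max (f x) 0)) := by
    intro f hf
    have hf' : Measurable fun x => ENNReal.ofReal (f x) := hf.ennreal_ofReal
    refine ⟨fun n => (SimpleFunc.eapprox (fun x => ENNReal.ofReal (f x)) n).map ENNReal.toReal,
      fun n x => ⟨ENNReal.toReal_nonneg, ?_⟩, fun x => ?_⟩
    · rw [← ENNReal.toReal_ofReal']
      refine ENNReal.toReal_mono ENNReal.ofReal_ne_top ?_
      rw [← SimpleFunc.iSup_eapprox_apply hf' x]
      exact le_iSup (fun n => SimpleFunc.eapprox (fun x => ENNReal.ofReal (f x)) n x) n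
    · rw [← ENNReal.toReal_ofReal']
      exact (ENNReal.tendsto_toReal ENNReal.ofReal_ne_top).comp (SimpleFunc.tendsto_eapprox hf' x)
  obtain ⟨g₁, h₁, t₁⟩ := key h hh
  obtain ⟨g₂, h₂, t₂⟩ := key (fun x => -h x) hh.neg
  refine ⟨fun n => g₁ n - g₂ n, fun n x => ?_, fun n x hx => ?_, fun x => ?_⟩
  · obtain ⟨a1, a2⟩ := h₁ n x
    obtain ⟨b1, b2⟩ := h₂ n x
    rw [SimpleFunc.sub_apply, abs_le]
    rcases le_total 0 (h x) with hx | hx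
    · rw [max_eq_left hx] at a2
      rw [max_eq_right (by linarith)] at b2
      rw [abs_of_nonneg hx]
      constructor <;> linarith
    · rw [max_eq_right hx] at a2
      rw [max_eq_left (by linarith)] at b2
      rw [abs_of_nonpos hx]
      constructor <;> linarith
  · obtain ⟨b1, b2⟩ := h₂ n x
    rw [max_eq_right (by linarith)] at b2
    have := (h₁ n x).1
    rw [SimpleFunc.sub_apply]
    linarith
  · have := (t₁ x).sub (t₂ x)
    have e : max (h x) 0 - max (-h x) 0 = h x := by
      rcases le_total 0 (h x) with hx | hx
      · rw [max_eq_left hx, max_eq_right (by linarith), sub_zero]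
      · rw [max_eq_right hx, max_eq_left (by linarith)]; ring
    rw [e] at this
    exact this

variable {Ω : Type*} [MeasurableSpace Ω] {E : Type*} [MeasurableSpace E] {P : Measure Ω}
  {η : Ω → Measure E} {Λ : Measure E}

theorem IsPoissonProcess.measurable_apply (hη : IsPoissonProcess P η Λ) {A : Set E}
    (hA : MeasurableSet A) : Measurable fun ω => η ω A :=
  (Measure.measurable_coe hA).comp hη.measurable

theorem IsPoissonProcess.lintegral_exp_mul (hη : IsPoissonProcess P η Λ) {A : Set E}
    (hA : MeasurableSet A) (hΛ : Λ A < ∞) (t : ℝ) :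
    ∫⁻ ω, ENNReal.ofReal (Real.exp ((η ω).real A * t)) ∂P =
      ENNReal.ofReal (Real.exp (Λ.real A * (Real.exp t - 1))) := by
  have hm : Measurable fun x : ℝ≥0∞ => ENNReal.ofReal (Real.exp (x.toReal * t)) := by fun_prop
  have h1 : ∫⁻ ω, ENNReal.ofReal (Real.exp ((η ω).real A * t)) ∂P =
      ∫⁻ x, ENNReal.ofReal (Real.exp (x.toReal * t)) ∂(P.map fun ω => η ω A) := by
    rw [lintegral_map hm (hη.measurable_apply hA)]; rfl
  rw [h1, hη.law A hA hΛ, lintegral_map hm (by fun_prop), lintegral_countable']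
  have h2 := tsum_poissonMeasure_mul_pow (Λ A).toNNReal (Real.exp_pos t).le
  rw [measureReal_def, ENNReal.toReal, ← h2]
  refine tsum_congr fun k => ?_
  rw [mul_comm, ← ENNReal.ofReal_pow (Real.exp_pos t).le, ← Real.exp_nat_mul]
  simp

theorem IsPoissonProcess.ae_lt_top (hη : IsPoissonProcess P η Λ) {A : Set E}
    (hA : MeasurableSet A) (hΛ : Λ A < ∞) : ∀ᵐ ω ∂P, η ω A < ∞ := by
  have h1 : ∀ᵐ x ∂(P.map fun ω => η ω A), x < ∞ := by
    rw [hη.law A hA hΛ, ae_map_iff (by fun_prop) measurableSet_Iio]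
    exact ae_of_all _ fun n => ENNReal.natCast_lt_top n
  exact ae_of_ae_map (hη.measurable_apply hA).aemeasurable h1

theorem IsPoissonProcess.ae_integrable_simpleFunc (hη : IsPoissonProcess P η Λ)
    (g : SimpleFunc E ℝ) (hg : Integrable g Λ) : ∀ᵐ ω ∂P, Integrable g (η ω) := by
  simp_rw [SimpleFunc.integrable_iff] at hg ⊢
  have : ∀ y ∈ g.range, y ≠ 0 → ∀ᵐ ω ∂P, η ω (g ⁻¹' {y}) < ∞ := fun y _ hy =>
    hη.ae_lt_top (g.measurableSet_fiber y) (hg y hy)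
  have h2 : ∀ᵐ ω ∂P, ∀ y ∈ g.range, y ≠ 0 → η ω (g ⁻¹' {y}) < ∞ := by
    rw [Filter.eventually_all_finset]
    intro y hy
    by_cases h0 : y = 0
    · simp [h0]
    · filter_upwards [this y hy h0] with ω hω _ using hω
  filter_upwards [h2] with ω hω y hy
  by_cases hr : y ∈ g.range
  · exact hω y hr hy
  · rw [(SimpleFunc.preimage_eq_empty_iff g y).2 (by simpa using hr), measure_empty]
    exact ENNReal.zero_lt_top

theorem IsPoissonProcess.aemeasurable_integral_simpleFunc (hη : IsPoissonProcess P η Λ)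
    (g : SimpleFunc E ℝ) (hg : Integrable g Λ) : AEMeasurable (fun ω => ∫ x, g x ∂(η ω)) P := by
  refine ⟨fun ω => ∑ y ∈ g.range, (η ω).real (g ⁻¹' {y}) • y, ?_, ?_⟩
  · exact Finset.measurable_sum _ fun y _ =>
      ((hη.measurable_apply (g.measurableSet_fiber y)).ennreal_toReal).smul_const y
  · filter_upwards [hη.ae_integrable_simpleFunc g hg] with ω hω
    rw [← SimpleFunc.integral_eq_integral _ hω, SimpleFunc.integral_eq]

/-- The fibres of `g` are disjoint, so their counts are independent; the exponential factorises over
the values of `g` into Poisson generating functions. -/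
theorem IsPoissonProcess.lintegral_exp_simpleFunc [IsProbabilityMeasure P]
    (hη : IsPoissonProcess P η Λ) (g : SimpleFunc E ℝ) (hg : Integrable g Λ) :
    ∫⁻ ω, ENNReal.ofReal (Real.exp (∫ x, g x ∂(η ω))) ∂P =
      ENNReal.ofReal (Real.exp (∫ x, (Real.exp (g x) - 1) ∂Λ)) := by
  have hg' := SimpleFunc.integrable_iff.1 hg
  have h1 : ∫⁻ ω, ENNReal.ofReal (Real.exp (∫ x, g x ∂(η ω))) ∂P =
      ∫⁻ ω, ∏ i : Fin g.range.card, ENNReal.ofReal (Real.exp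
        ((η ω).real (g ⁻¹' {(g.range.equivFin.symm i : ℝ)}) * (g.range.equivFin.symm i : ℝ))) ∂P := by
    refine lintegral_congr_ae ?_
    filter_upwards [hη.ae_integrable_simpleFunc g hg] with ω hω
    rw [← SimpleFunc.integral_eq_integral _ hω, SimpleFunc.integral_eq, Real.exp_sum,
      ENNReal.ofReal_prod_of_nonneg fun _ _ => (Real.exp_pos _).le]
    rw [← Finset.prod_coe_sort, ← g.range.equivFin.symm.prod_comp]
    rfl
  have hind := hη.indep g.range.card (fun i => g ⁻¹' {(g.range.equivFin.symm i : ℝ)})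
    (fun i => g.measurableSet_fiber _) (fun i j hij => by
      refine Disjoint.preimage _ (Set.disjoint_singleton.2 fun h => hij ?_)
      exact g.range.equivFin.symm.injective (Subtype.ext h))
  have hind2 := hind.comp (fun i x => ENNReal.ofReal (Real.exp
    (x.toReal * (g.range.equivFin.symm i : ℝ)))) (fun i => by fun_prop)
  rw [h1]
  refine (lintegral_prod_eq_prod_lintegral_of_indepFun Finset.univ _ hind2 fun i => ?_).trans ?_
  · have := hη.measurable_apply (g.measurableSet_fiber (g.range.equivFin.symm i : ℝ))
    simp only [Function.comp_def]
    fun_prop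
  have h3 : ∀ y ∈ g.range, ∫⁻ ω, ENNReal.ofReal (Real.exp ((η ω).real (g ⁻¹' {y}) * y)) ∂P =
      ENNReal.ofReal (Real.exp (Λ.real (g ⁻¹' {y}) * (Real.exp y - 1))) := by
    intro y _
    -- The fibre over `0` may have infinite intensity; its factor is `1` on both sides.
    by_cases hy : y = 0
    · simp [hy]
    · exact hη.lintegral_exp_mul (g.measurableSet_fiber y) (hg' y hy) y
  have h4 : ∏ i : Fin g.range.card, ∫⁻ ω, ENNReal.ofReal (Real.exp
        ((η ω).real (g ⁻¹' {(g.range.equivFin.symm i : ℝ)}) * (g.range.equivFin.symm i : ℝ))) ∂P =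
      ∏ y ∈ g.range, ∫⁻ ω, ENNReal.ofReal (Real.exp ((η ω).real (g ⁻¹' {y}) * y)) ∂P := by
    exact (g.range.equivFin.symm.prod_comp fun y : g.range =>
      ∫⁻ ω, ENNReal.ofReal (Real.exp ((η ω).real (g ⁻¹' {(y : ℝ)}) * y)) ∂P).trans
      (Finset.prod_coe_sort g.range fun y =>
        ∫⁻ ω, ENNReal.ofReal (Real.exp ((η ω).real (g ⁻¹' {y}) * y)) ∂P)
  refine h4.trans ?_
  rw [Finset.prod_congr rfl h3, ← ENNReal.ofReal_prod_of_nonneg fun _ _ => (Real.exp_pos _).le,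
    ← Real.exp_sum]
  have h5 : Integrable (g.map fun y => Real.exp y - 1) Λ := by
    rw [SimpleFunc.integrable_iff_finMeasSupp] at hg ⊢
    exact hg.map (by simp)
  have h6 := SimpleFunc.integral_eq_integral _ h5
  rw [SimpleFunc.map_integral _ _ hg (by simp)] at h6
  simp only [SimpleFunc.map_apply, smul_eq_mul] at h6
  rw [h6]

/-- The simple functions below `|h|` satisfy a uniform exponential bound. -/
theorem integral_exp_sub_one_le {h g : E → ℝ} (hh : Integrable (fun x => Real.exp |h x| - 1) Λ)
    (hg : ∀ x, |g x| ≤ |h x|) :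
    ∫ x, (Real.exp (g x) - 1) ∂Λ ≤ ∫ x, (Real.exp |h x| - 1) ∂Λ := by
  by_cases hi : Integrable (fun x => Real.exp (g x) - 1) Λ
  · refine integral_mono hi hh fun x => ?_
    have := Real.exp_le_exp.2 ((le_abs_self _).trans (hg x))
    simp only
    linarith
  · rw [integral_undef hi]
    exact integral_nonneg fun x => by
      have := Real.add_one_le_exp |h x|
      have := abs_nonneg (h x)
      simp only [Pi.zero_apply]
      linarith

/-- The lower bound needs `1 - exp (-y) ≤ exp y - 1`, which is `1 ≤ cosh y`. -/
theorem abs_exp_sub_one_le_of_abs_le {x y : ℝ} (h : |x| ≤ y) : |Real.exp x - 1| ≤ Real.exp y - 1 := by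
  have h1 := abs_le.1 h
  have h2 : Real.exp x ≤ Real.exp y := Real.exp_le_exp.2 h1.2
  have h3 : Real.exp (-y) ≤ Real.exp x := Real.exp_le_exp.2 h1.1
  have h4 : 2 ≤ Real.exp y + Real.exp (-y) := by
    have := Real.one_le_cosh y
    rw [Real.cosh_eq] at this
    linarith
  rw [abs_le]
  constructor <;> linarith

theorem integrable_of_integrable_exp_abs_sub_one {h g : E → ℝ}
    (hh : Integrable (fun x => Real.exp |h x| - 1) Λ) (hgm : AEStronglyMeasurable g Λ)
    (hg : ∀ x, |g x| ≤ |h x|) : Integrable g Λ := by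
  refine hh.mono' hgm (ae_of_all _ fun x => ?_)
  have := Real.add_one_le_exp |h x|
  have := hg x
  rw [Real.norm_eq_abs]
  linarith

/-- The means of the integrals of the approximants of `|h|` are bounded through `x ≤ exp x` and the
formula for simple functions; Fatou, applied under both integrals, makes the mean of `∫ |h| dη`
finite. -/
theorem IsPoissonProcess.ae_integrable [IsProbabilityMeasure P] (hη : IsPoissonProcess P η Λ)
    {h : E → ℝ} (hm : Measurable h) (hh : Integrable (fun x => Real.exp |h x| - 1) Λ) :
    ∀ᵐ ω ∂P, Integrable h (η ω) := by
  obtain ⟨g, hg1, hg2, hg3⟩ := exists_simpleFunc_tendsto (h := fun x => |h x|) (by fun_prop)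
  simp only [abs_abs, abs_nonneg, forall_const] at hg1 hg2
  have hgi : ∀ n, Integrable (g n) Λ := fun n =>
    integrable_of_integrable_exp_abs_sub_one hh (g n).aestronglyMeasurable (hg1 n)
  set C := ENNReal.ofReal (Real.exp (∫ x, (Real.exp |h x| - 1) ∂Λ))
  have hmG : ∀ n, Measurable fun ω => ∫⁻ x, ENNReal.ofReal (g n x) ∂(η ω) := fun n =>
    (Measure.measurable_lintegral (g n).measurable.ennreal_ofReal).comp hη.measurable
  have hC : ∀ n, ∫⁻ ω, ∫⁻ x, ENNReal.ofReal (g n x) ∂(η ω) ∂P ≤ C := fun n =>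
    calc _ ≤ ∫⁻ ω, ENNReal.ofReal (Real.exp (∫ x, g n x ∂(η ω))) ∂P := by
          refine lintegral_mono_ae ?_
          filter_upwards [hη.ae_integrable_simpleFunc _ (hgi n)] with ω hω
          rw [← ofReal_integral_eq_lintegral_ofReal hω (ae_of_all _ (hg2 n))]
          exact ENNReal.ofReal_le_ofReal ((lt_add_one _).le.trans (Real.add_one_le_exp _))
      _ ≤ C := by
          rw [hη.lintegral_exp_simpleFunc _ (hgi n)]
          exact ENNReal.ofReal_le_ofReal (Real.exp_le_exp.2 (integral_exp_sub_one_le hh (hg1 n)))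
  have hlim : ∫⁻ ω, ∫⁻ x, ENNReal.ofReal |h x| ∂(η ω) ∂P ≤ C := by
    calc _ ≤ ∫⁻ ω, liminf (fun n => ∫⁻ x, ENNReal.ofReal (g n x) ∂(η ω)) atTop ∂P := by
          refine lintegral_mono fun ω => ?_
          refine le_trans (le_of_eq ?_) (lintegral_liminf_le fun n =>
            (g n).measurable.ennreal_ofReal)
          refine lintegral_congr fun x => ?_
          exact ((ENNReal.continuous_ofReal.tendsto _).comp (hg3 x)).liminf_eq.symm
      _ ≤ liminf (fun n => ∫⁻ ω, ∫⁻ x, ENNReal.ofReal (g n x) ∂(η ω) ∂P) atTop :=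
          lintegral_liminf_le hmG
      _ ≤ C := by
          refine liminf_le_of_frequently_le' ?_
          exact (Eventually.of_forall hC).frequently
  have hfin := MeasureTheory.ae_lt_top
    ((Measure.measurable_lintegral (hm.abs).ennreal_ofReal).comp hη.measurable)
    (ne_top_of_le_ne_top ENNReal.ofReal_ne_top hlim)
  filter_upwards [hfin] with ω hω
  refine ⟨hm.aestronglyMeasurable, ?_⟩
  rw [hasFiniteIntegral_iff_norm]
  exact hω

/-- Only an inequality, from Fatou; it supplies the dominating function with which the exact formula
is then obtained by dominated convergence. -/
theorem IsPoissonProcess.lintegral_exp_abs_le [IsProbabilityMeasure P]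
    (hη : IsPoissonProcess P η Λ)
    {h : E → ℝ} (hm : Measurable h) (hh : Integrable (fun x => Real.exp |h x| - 1) Λ) :
    ∫⁻ ω, ENNReal.ofReal (Real.exp (∫ x, |h x| ∂(η ω))) ∂P ≤
      ENNReal.ofReal (Real.exp (∫ x, (Real.exp |h x| - 1) ∂Λ)) := by
  obtain ⟨g, hg1, -, hg3⟩ := exists_simpleFunc_tendsto (h := fun x => |h x|) (by fun_prop)
  simp only [abs_abs] at hg1
  have hgi : ∀ n, Integrable (g n) Λ := fun n =>
    integrable_of_integrable_exp_abs_sub_one hh (g n).aestronglyMeasurable (hg1 n)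
  calc _ ≤ ∫⁻ ω, liminf (fun n => ENNReal.ofReal (Real.exp (∫ x, g n x ∂(η ω)))) atTop ∂P := by
        refine lintegral_mono_ae ?_
        filter_upwards [hη.ae_integrable hm hh] with ω hω
        refine le_of_eq (Tendsto.liminf_eq ?_).symm
        refine ((ENNReal.continuous_ofReal.comp Real.continuous_exp).tendsto _).comp ?_
        exact tendsto_integral_of_dominated_convergence _ (fun n => (g n).aestronglyMeasurable)
          hω.abs (fun n => ae_of_all _ (hg1 n)) (ae_of_all _ hg3)
    _ ≤ liminf (fun n => ∫⁻ ω, ENNReal.ofReal (Real.exp (∫ x, g n x ∂(η ω))) ∂P) atTop :=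
        lintegral_liminf_le' fun n =>
          ((hη.aemeasurable_integral_simpleFunc (g n) (hgi n)).exp).ennreal_ofReal
    _ ≤ _ := by
        refine liminf_le_of_frequently_le' (Eventually.of_forall fun n => ?_).frequently
        rw [hη.lintegral_exp_simpleFunc _ (hgi n)]
        exact ENNReal.ofReal_le_ofReal (Real.exp_le_exp.2 (integral_exp_sub_one_le hh (hg1 n)))

/-- The exponential functional of a Poisson process. -/
theorem IsPoissonProcess.lintegral_exp_integral [IsProbabilityMeasure P]
    (hη : IsPoissonProcess P η Λ)
    {h : E → ℝ} (hm : Measurable h) (hh : Integrable (fun x => Real.exp |h x| - 1) Λ) :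
    ∫⁻ ω, ENNReal.ofReal (Real.exp (∫ x, h x ∂(η ω))) ∂P =
      ENNReal.ofReal (Real.exp (∫ x, (Real.exp (h x) - 1) ∂Λ)) := by
  obtain ⟨g, hg1, -, hg3⟩ := exists_simpleFunc_tendsto hm
  have hgi : ∀ n, Integrable (g n) Λ := fun n =>
    integrable_of_integrable_exp_abs_sub_one hh (g n).aestronglyMeasurable (hg1 n)
  have hcont : Continuous fun x => ENNReal.ofReal (Real.exp x) :=
    ENNReal.continuous_ofReal.comp Real.continuous_exp
  have h1 : Tendsto (fun n => ∫⁻ ω, ENNReal.ofReal (Real.exp (∫ x, g n x ∂(η ω))) ∂P) atTop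
      (𝓝 (∫⁻ ω, ENNReal.ofReal (Real.exp (∫ x, h x ∂(η ω))) ∂P)) := by
    refine tendsto_lintegral_of_dominated_convergence'
      (fun ω => ENNReal.ofReal (Real.exp (∫ x, |h x| ∂(η ω)))) (fun n =>
        ((hη.aemeasurable_integral_simpleFunc (g n) (hgi n)).exp).ennreal_ofReal) (fun n => ?_)
      (ne_top_of_le_ne_top ENNReal.ofReal_ne_top (hη.lintegral_exp_abs_le hm hh)) ?_
    · filter_upwards [hη.ae_integrable hm hh, hη.ae_integrable_simpleFunc _ (hgi n)] with ω hω h2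
      refine ENNReal.ofReal_le_ofReal (Real.exp_le_exp.2 ?_)
      exact integral_mono h2 hω.abs fun x => (le_abs_self _).trans (hg1 n x)
    · filter_upwards [hη.ae_integrable hm hh] with ω hω
      refine (hcont.tendsto _).comp ?_
      exact tendsto_integral_of_dominated_convergence _ (fun n => (g n).aestronglyMeasurable)
        hω.abs (fun n => ae_of_all _ (hg1 n)) (ae_of_all _ hg3)
  have h2 : Tendsto (fun n => ENNReal.ofReal (Real.exp (∫ x, (Real.exp (g n x) - 1) ∂Λ))) atTop
      (𝓝 (ENNReal.ofReal (Real.exp (∫ x, (Real.exp (h x) - 1) ∂Λ)))) := by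
    refine (hcont.tendsto _).comp ?_
    refine tendsto_integral_of_dominated_convergence _ (fun n => ?_) hh (fun n => ?_) ?_
    · exact ((g n).measurable.exp.sub_const 1).aestronglyMeasurable
    · exact ae_of_all _ fun x => abs_exp_sub_one_le_of_abs_le (hg1 n x)
    · exact ae_of_all _ fun x => ((Real.continuous_exp.tendsto _).comp (hg3 x)).sub_const 1
  simp_rw [fun n => hη.lintegral_exp_simpleFunc (g n) (hgi n)] at h1
  exact tendsto_nhds_unique h1 h2
end
end BranchingCluster

namespace BranchingCluster
noncomputable section
open scoped ENNReal NNReal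

/-! ### Exponential functionals of marked Poisson processes -/

section
variable {Ω : Type*} [MeasurableSpace Ω] {E M : Type*} [MeasurableSpace E] [MeasurableSpace M]
  {P : Measure Ω} [IsProbabilityMeasure P]
  {U : ℕ → Ω → E} {e : ℕ → Ω → M} {Λ : Measure E} {Q : Measure M} [IsProbabilityMeasure Q]

/-- The points `U j` carry independent marks `e j` with law `Q`. -/
structure IsMarked (P : Measure Ω) (U : ℕ → Ω → E) (e : ℕ → Ω → M) (Q : Measure M) : Prop where
  measurable_points : ∀ j, Measurable (U j)
  measurable_marks : ∀ j, Measurable (e j)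
  law_marks : P.map (fun ω j => e j ω) = Measure.infinitePi fun _ : ℕ => Q
  indep : IndepFun (fun ω j => U j ω) (fun ω j => e j ω) P

omit [IsProbabilityMeasure P] in
theorem IsMarked.map_marks (hM : IsMarked P U e Q) (j : ℕ) : P.map (e j) = Q := by
  rw [← Measure.infinitePi_map_eval (fun _ : ℕ => Q) j, ← hM.law_marks,
    Measure.map_map (measurable_pi_apply j) (measurable_pi_lambda _ hM.measurable_marks)]
  rfl

/-- For fixed points the marks are i.i.d., so Fubini on the joint law integrates them out factor by
factor. -/
theorem IsMarked.lintegral_prod_range (hM : IsMarked P U e Q) {G : E × M → ℝ≥0∞}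
    (hG : Measurable G) (n : ℕ) :
    ∫⁻ ω, ∏ j ∈ Finset.range n, G (U j ω, e j ω) ∂P =
      ∫⁻ ω, ∏ j ∈ Finset.range n, ∫⁻ x, G (U j ω, x) ∂Q ∂P := by
  have hmU : Measurable fun ω j => U j ω := measurable_pi_lambda _ hM.measurable_points
  have hme : Measurable fun ω j => e j ω := measurable_pi_lambda _ hM.measurable_marks
  have hmap := (indepFun_iff_map_prod_eq_prod_map_map hmU.aemeasurable hme.aemeasurable).1 hM.indep
  rw [hM.law_marks] at hmap
  have hF : ∀ j : ℕ, Measurable fun p : (ℕ → E) × (ℕ → M) => G (p.1 j, p.2 j) := fun j =>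
    hG.comp (((measurable_pi_apply j).comp measurable_fst).prodMk
      ((measurable_pi_apply j).comp measurable_snd))
  have hF' : Measurable fun p : (ℕ → E) × (ℕ → M) =>
      ∏ j ∈ Finset.range n, G (p.1 j, p.2 j) := Finset.measurable_prod _ fun j _ => hF j
  have h1 : ∫⁻ ω, ∏ j ∈ Finset.range n, G (U j ω, e j ω) ∂P =
      ∫⁻ p, ∏ j ∈ Finset.range n, G (p.1 j, p.2 j)
        ∂(P.map fun ω => ((fun j => U j ω), fun j => e j ω)) := by
    rw [lintegral_map hF' (hmU.prodMk hme)]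
  rw [h1, hmap, MeasureTheory.lintegral_prod _ hF'.aemeasurable, lintegral_map ?_ hmU]
  · refine lintegral_congr fun ω => ?_
    have hGj : ∀ j, Measurable fun x => G (U j ω, x) := fun j => hG.comp measurable_prodMk_left
    rw [lintegral_prod_eq_prod_lintegral_of_indepFun _ (fun (j : ℕ) (m : ℕ → M) => G (U j ω, m j))
      (iIndepFun_infinitePi (X := fun j x => G (U j ω, x)) hGj)
      fun j => (hGj j).comp (measurable_pi_apply j)]
    refine Finset.prod_congr rfl fun j _ => ?_
    have := lintegral_map (μ := Measure.infinitePi fun _ : ℕ => Q) (hGj j) (measurable_pi_apply j)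
    rw [Measure.infinitePi_map_eval (fun _ : ℕ => Q) j] at this
    exact this.symm
  · exact hF'.lintegral_prod_right'

theorem one_le_integral_exp_abs {f : M → ℝ} (hf : Integrable (fun x => Real.exp |f x|) Q) :
    1 ≤ ∫ x, Real.exp |f x| ∂Q := by
  have : ∫ _ : M, (1 : ℝ) ∂Q ≤ ∫ x, Real.exp |f x| ∂Q :=
    integral_mono (integrable_const _) hf fun x => Real.one_le_exp (abs_nonneg _)
  simpa using this

omit [IsProbabilityMeasure Q] in
theorem integrable_exp_of_abs {f : M → ℝ} (hm : Measurable f)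
    (hf : Integrable (fun x => Real.exp |f x|) Q) : Integrable (fun x => Real.exp (f x)) Q :=
  hf.mono' hm.exp.aestronglyMeasurable (ae_of_all _ fun x => by
    rw [Real.norm_eq_abs, abs_of_pos (Real.exp_pos _)]
    exact Real.exp_le_exp.2 (le_abs_self _))

theorem integral_exp_pos {f : M → ℝ} (hm : Measurable f)
    (hf : Integrable (fun x => Real.exp |f x|) Q) : 0 < ∫ x, Real.exp (f x) ∂Q :=
  MeasureTheory.integral_exp_pos (integrable_exp_of_abs hm hf)

theorem abs_log_integral_exp_le {f : M → ℝ} (hm : Measurable f)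
    (hf : Integrable (fun x => Real.exp |f x|) Q) :
    |Real.log (∫ x, Real.exp (f x) ∂Q)| ≤ Real.log (∫ x, Real.exp |f x| ∂Q) := by
  set B := ∫ x, Real.exp |f x| ∂Q with hB
  have hB1 : 1 ≤ B := one_le_integral_exp_abs hf
  have hi := integrable_exp_of_abs hm hf
  have h1 : ∫ x, Real.exp (f x) ∂Q ≤ B :=
    integral_mono hi hf fun x => Real.exp_le_exp.2 (le_abs_self _)
  have h2 : B⁻¹ ≤ ∫ x, Real.exp (f x) ∂Q := by
    -- Jensen for the convex function `1 / t`, by hand: its tangent at `t = B` lies below it,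
    -- evaluated at `t = exp |f x|`. Integrating the tangent gives `B⁻¹`.
    have h3 : ∫ x, (2 * B⁻¹ - B⁻¹ ^ 2 * Real.exp |f x|) ∂Q ≤ ∫ x, Real.exp (f x) ∂Q := by
      refine integral_mono ((integrable_const _).sub (hf.const_mul _)) hi fun x => ?_
      have e1 : Real.exp (-|f x|) ≤ Real.exp (f x) := Real.exp_le_exp.2 (neg_abs_le _)
      have e2 : Real.exp (-|f x|) * Real.exp |f x| = 1 := by rw [← Real.exp_add]; simp
      have e3 := Real.exp_pos (-|f x|)
      have : 2 * B⁻¹ - B⁻¹ ^ 2 * Real.exp |f x| =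
          Real.exp (-|f x|) - Real.exp (-|f x|) * (1 - B⁻¹ * Real.exp |f x|) ^ 2 := by
        linear_combination -(2 * B⁻¹ - B⁻¹ ^ 2 * Real.exp |f x|) * e2
      simp only
      rw [this]
      nlinarith [mul_nonneg e3.le (sq_nonneg (1 - B⁻¹ * Real.exp |f x|))]
    rw [integral_sub (integrable_const _) (hf.const_mul _), integral_const_mul (B⁻¹ ^ 2), ← hB] at h3
    refine le_trans (le_of_eq ?_) h3
    have : B ≠ 0 := by positivity
    simp
    field_simp
    norm_num
  have hpos := integral_exp_pos hm hf
  rw [abs_le]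
  refine ⟨?_, Real.log_le_log hpos h1⟩
  rw [← Real.log_inv]
  exact Real.log_le_log (by positivity) h2

variable {φ : E × M → ℝ}

theorem lintegral_ofReal_exp (hφ : Measurable φ)
    (hi : ∀ u, Integrable (fun x => Real.exp |φ (u, x)|) Q) (u : E) :
    ∫⁻ x, ENNReal.ofReal (Real.exp (φ (u, x))) ∂Q =
      ENNReal.ofReal (Real.exp (Real.log (∫ x, Real.exp (φ (u, x)) ∂Q))) := by
  have hm : Measurable fun x => φ (u, x) := hφ.comp measurable_prodMk_left
  rw [Real.exp_log (integral_exp_pos hm (hi u)),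
    ofReal_integral_eq_lintegral_ofReal (integrable_exp_of_abs hm (hi u))
      (ae_of_all _ fun _ => (Real.exp_pos _).le)]

/-- Marked sums are traded for sums of `log ∫ exp (φ (u, x)) dQ`, a function of the points alone, to
which the unmarked Poisson formula applies. -/
theorem IsMarked.lintegral_exp_sum_range (hM : IsMarked P U e Q) (hφ : Measurable φ)
    (hi : ∀ u, Integrable (fun x => Real.exp |φ (u, x)|) Q) (n : ℕ) :
    ∫⁻ ω, ENNReal.ofReal (Real.exp (∑ j ∈ Finset.range n, φ (U j ω, e j ω))) ∂P =
      ∫⁻ ω, ENNReal.ofReal (Real.exp (∑ j ∈ Finset.range n,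
        Real.log (∫ x, Real.exp (φ (U j ω, x)) ∂Q))) ∂P := by
  have h := hM.lintegral_prod_range (G := fun p => ENNReal.ofReal (Real.exp (φ p)))
    hφ.exp.ennreal_ofReal n
  simp_rw [lintegral_ofReal_exp hφ hi, ← ENNReal.ofReal_prod_of_nonneg fun _ _ =>
    (Real.exp_pos _).le, ← Real.exp_sum] at h
  exact h

theorem measurable_log_integral_exp (hφ : Measurable φ) :
    Measurable fun u => Real.log (∫ x, Real.exp (φ (u, x)) ∂Q) :=
  Real.measurable_log.comp (hφ.exp.stronglyMeasurable.integral_prod_right'.measurable)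

theorem integrable_exp_log_sub_one (hφ : Measurable φ)
    (hi : ∀ u, Integrable (fun x => Real.exp |φ (u, x)|) Q)
    (hΛ : Integrable (fun u => (∫ x, Real.exp |φ (u, x)| ∂Q) - 1) Λ) :
    Integrable (fun u => Real.exp |Real.log (∫ x, Real.exp (φ (u, x)) ∂Q)| - 1) Λ := by
  refine hΛ.mono' (((measurable_log_integral_exp hφ).abs.exp.sub_const 1).aestronglyMeasurable)
    (ae_of_all _ fun u => ?_)
  have hm : Measurable fun x => φ (u, x) := hφ.comp measurable_prodMk_left
  have h1 := abs_log_integral_exp_le hm (hi u)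
  rw [Real.norm_eq_abs, abs_of_nonneg (sub_nonneg.2 (Real.one_le_exp (abs_nonneg _)))]
  have := Real.exp_le_exp.2 h1
  rw [Real.exp_log (by linarith [one_le_integral_exp_abs (hi u)])] at this
  simpa using this

theorem hasSum_of_integrable_sum_dirac {x : ℕ → E} {h : E → ℝ} (hm : Measurable h)
    (hi : Integrable h (Measure.sum fun j => Measure.dirac (x j))) :
    HasSum (fun j => h (x j)) (∫ y, h y ∂(Measure.sum fun j => Measure.dirac (x j))) := by
  have := hasSum_integral_measure hi
  simpa only [integral_dirac' _ _ hm.stronglyMeasurable] using this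

variable (hη : IsPoissonProcess P (fun ω => Measure.sum fun j => Measure.dirac (U j ω)) Λ)
include hη

/-- With absolute values all partial sums increase and their exponential means stay below the
unmarked functional; monotone convergence gives summability and a dominating function for the signed
case. -/
theorem IsMarked.lintegral_exp_tsum_abs (hM : IsMarked P U e Q) (hφ : Measurable φ)
    (hi : ∀ u, Integrable (fun x => Real.exp |φ (u, x)|) Q)
    (hΛ : Integrable (fun u => (∫ x, Real.exp |φ (u, x)| ∂Q) - 1) Λ) :
    (∀ᵐ ω ∂P, Summable fun j => |φ (U j ω, e j ω)|) ∧
    ∫⁻ ω, ENNReal.ofReal (Real.exp (∑' j, |φ (U j ω, e j ω)|)) ∂P ≠ ∞ := by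
  set H : E → ℝ := fun u => Real.log (∫ x, Real.exp |φ (u, x)| ∂Q) with hH
  have hHm : Measurable H := measurable_log_integral_exp hφ.abs
  have hH0 : ∀ u, 0 ≤ H u := fun u => Real.log_nonneg (one_le_integral_exp_abs (hi u))
  have hHi : Integrable (fun u => Real.exp |H u| - 1) Λ :=
    integrable_exp_log_sub_one hφ.abs (by simpa using hi) (by simpa using hΛ)
  have hsum := hη.ae_integrable hHm hHi
  have hC := hη.lintegral_exp_integral hHm hHi
  set C := ENNReal.ofReal (Real.exp (∫ x, (Real.exp (H x) - 1) ∂Λ)) with hCdef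
  have hms : ∀ n, Measurable fun ω => ∑ j ∈ Finset.range n, |φ (U j ω, e j ω)| := fun n =>
    Finset.measurable_sum _ fun j _ =>
      (hφ.comp ((hM.measurable_points j).prodMk (hM.measurable_marks j))).abs
  have hn : ∀ n, ∫⁻ ω, ENNReal.ofReal (Real.exp
      (∑ j ∈ Finset.range n, |φ (U j ω, e j ω)|)) ∂P ≤ C := fun n => by
    rw [hM.lintegral_exp_sum_range hφ.abs (by simpa using hi), ← hC]
    refine lintegral_mono_ae ?_
    filter_upwards [hsum] with ω hω
    have := hasSum_of_integrable_sum_dirac hHm hω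
    exact ENNReal.ofReal_le_ofReal (Real.exp_le_exp.2
      (sum_le_hasSum _ (fun j _ => hH0 _) this))
  have hsup : ∫⁻ ω, ⨆ n, ENNReal.ofReal (Real.exp
      (∑ j ∈ Finset.range n, |φ (U j ω, e j ω)|)) ∂P ≤ C := by
    rw [lintegral_iSup (fun n => (hms n).exp.ennreal_ofReal)]
    · exact iSup_le hn
    · exact fun n n' hnn ω => ENNReal.ofReal_le_ofReal (Real.exp_le_exp.2
        (Finset.sum_le_sum_of_subset_of_nonneg (Finset.range_mono hnn) fun _ _ _ => abs_nonneg _))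
  have hCtop : C ≠ ∞ := ENNReal.ofReal_ne_top
  have hS : ∀ᵐ ω ∂P, Summable fun j => |φ (U j ω, e j ω)| := by
    filter_upwards [MeasureTheory.ae_lt_top (Measurable.iSup fun n => (hms n).exp.ennreal_ofReal)
      (ne_top_of_le_ne_top hCtop hsup)] with ω hω
    refine summable_of_sum_range_le (c := (⨆ n, ENNReal.ofReal (Real.exp
      (∑ j ∈ Finset.range n, |φ (U j ω, e j ω)|))).toReal) (fun _ => abs_nonneg _) fun n => ?_
    have h1 := le_iSup (fun n => ENNReal.ofReal (Real.exp
      (∑ j ∈ Finset.range n, |φ (U j ω, e j ω)|))) n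
    have h2 := (ENNReal.ofReal_le_iff_le_toReal hω.ne).1 h1
    have := Real.add_one_le_exp (∑ j ∈ Finset.range n, |φ (U j ω, e j ω)|)
    linarith
  refine ⟨hS, ne_top_of_le_ne_top hCtop (le_trans (lintegral_mono_ae ?_) hsup)⟩
  filter_upwards [hS] with ω hω
  have ht : Tendsto (fun n => ENNReal.ofReal (Real.exp
      (∑ j ∈ Finset.range n, |φ (U j ω, e j ω)|))) atTop
      (𝓝 (ENNReal.ofReal (Real.exp (∑' j, |φ (U j ω, e j ω)|)))) :=
    ((ENNReal.continuous_ofReal.comp Real.continuous_exp).tendsto _).comp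
      hω.hasSum.tendsto_sum_nat
  exact le_of_tendsto' ht fun n => le_iSup (fun n => ENNReal.ofReal (Real.exp
      (∑ j ∈ Finset.range n, |φ (U j ω, e j ω)|))) n

/-- The exponential functional of a marked Poisson process. -/
theorem IsMarked.lintegral_exp_tsum (hM : IsMarked P U e Q) (hφ : Measurable φ)
    (hi : ∀ u, Integrable (fun x => Real.exp |φ (u, x)|) Q)
    (hΛ : Integrable (fun u => (∫ x, Real.exp |φ (u, x)| ∂Q) - 1) Λ) :
    ∫⁻ ω, ENNReal.ofReal (Real.exp (∑' j, φ (U j ω, e j ω))) ∂P =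
      ENNReal.ofReal (Real.exp (∫ u, ((∫ x, Real.exp (φ (u, x)) ∂Q) - 1) ∂Λ)) := by
  obtain ⟨hS, hfin⟩ := hM.lintegral_exp_tsum_abs hη hφ hi hΛ
  set H : E → ℝ := fun u => Real.log (∫ x, Real.exp |φ (u, x)| ∂Q) with hH
  set h : E → ℝ := fun u => Real.log (∫ x, Real.exp (φ (u, x)) ∂Q) with hh
  have hHm : Measurable H := measurable_log_integral_exp hφ.abs
  have hhm : Measurable h := measurable_log_integral_exp hφ
  have hH0 : ∀ u, 0 ≤ H u := fun u => Real.log_nonneg (one_le_integral_exp_abs (hi u))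
  have hhH : ∀ u, |h u| ≤ H u := fun u =>
    abs_log_integral_exp_le (hφ.comp measurable_prodMk_left) (hi u)
  have hHi : Integrable (fun u => Real.exp |H u| - 1) Λ :=
    integrable_exp_log_sub_one hφ.abs (by simpa using hi) (by simpa using hΛ)
  have hhi : Integrable (fun u => Real.exp |h u| - 1) Λ := integrable_exp_log_sub_one hφ hi hΛ
  have hcont : Continuous fun x => ENNReal.ofReal (Real.exp x) :=
    ENNReal.continuous_ofReal.comp Real.continuous_exp
  have hmφ : ∀ j, Measurable fun ω => φ (U j ω, e j ω) := fun j =>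
      (hφ.comp ((hM.measurable_points j).prodMk (hM.measurable_marks j)))
  have h1 : Tendsto (fun n => ∫⁻ ω, ENNReal.ofReal (Real.exp
      (∑ j ∈ Finset.range n, φ (U j ω, e j ω))) ∂P) atTop
      (𝓝 (∫⁻ ω, ENNReal.ofReal (Real.exp (∑' j, φ (U j ω, e j ω))) ∂P)) := by
    refine tendsto_lintegral_of_dominated_convergence
      (fun ω => ENNReal.ofReal (Real.exp (∑' j, |φ (U j ω, e j ω)|)))
      (fun n => (Finset.measurable_sum _ fun j _ => hmφ j).exp.ennreal_ofReal) (fun n => ?_)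
      hfin ?_
    · filter_upwards [hS] with ω hω
      refine ENNReal.ofReal_le_ofReal (Real.exp_le_exp.2 ?_)
      exact (Finset.sum_le_sum fun j _ => le_abs_self _).trans
        (hω.sum_le_tsum _ fun _ _ => abs_nonneg _)
    · filter_upwards [hS] with ω hω
      exact (hcont.tendsto _).comp hω.of_abs.hasSum.tendsto_sum_nat
  have h2 : Tendsto (fun n => ∫⁻ ω, ENNReal.ofReal (Real.exp
      (∑ j ∈ Finset.range n, h (U j ω))) ∂P) atTop
      (𝓝 (∫⁻ ω, ENNReal.ofReal (Real.exp
        (∫ x, h x ∂(Measure.sum fun j => Measure.dirac (U j ω)))) ∂P)) := by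
    refine tendsto_lintegral_of_dominated_convergence
      (fun ω => ENNReal.ofReal (Real.exp
        (∫ x, H x ∂(Measure.sum fun j => Measure.dirac (U j ω)))))
      (fun n => (Finset.measurable_sum _ fun j _ =>
        hhm.comp (hM.measurable_points j)).exp.ennreal_ofReal) (fun n => ?_) ?_ ?_
    · filter_upwards [hη.ae_integrable hHm hHi] with ω hω
      refine ENNReal.ofReal_le_ofReal (Real.exp_le_exp.2 ?_)
      exact (Finset.sum_le_sum fun j _ => (le_abs_self _).trans (hhH _)).trans
        (sum_le_hasSum _ (fun j _ => hH0 _) (hasSum_of_integrable_sum_dirac hHm hω))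
    · rw [hη.lintegral_exp_integral hHm hHi]
      exact ENNReal.ofReal_ne_top
    · filter_upwards [hη.ae_integrable hhm hhi] with ω hω
      exact (hcont.tendsto _).comp
        (hasSum_of_integrable_sum_dirac hhm hω).tendsto_sum_nat
  simp_rw [hM.lintegral_exp_sum_range hφ hi] at h1
  rw [tendsto_nhds_unique h1 h2, hη.lintegral_exp_integral hhm hhi]
  congr 3
  ext u
  have hm : Measurable fun x => φ (u, x) := hφ.comp measurable_prodMk_left
  rw [hh]
  simp only
  rw [Real.exp_log (integral_exp_pos hm (hi u))]

end
end
end BranchingCluster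

namespace BranchingCluster
noncomputable section
open scoped ENNReal NNReal

/-! ### Clusters as functions of the marks -/

/-- Offspring numbers and displacements of the individuals of a family tree. -/
abbrev Marks := List ℕ → ℕ × ℝ

/-- The law of the marks: offspring numbers are Poisson with mean `r`, displacements have
law `d`, and everything is independent. -/
def marksLaw (r : ℝ≥0) (d : Measure ℝ) : Measure Marks :=
  Measure.infinitePi fun _ => (poissonMeasure r).prod d

instance (r : ℝ≥0) (d : Measure ℝ) [IsProbabilityMeasure d] :
    IsProbabilityMeasure (marksLaw r d) := by unfold marksLaw; infer_instance

/-- The cluster with given marks. -/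
def clusterOf (e : Marks) : Measure ℝ := cluster (fun v => (e v).1) (fun v => (e v).2)

/-- The number of individuals of the cluster with given marks. -/
def size (e : Marks) : ℝ≥0∞ := clusterOf e Set.univ

theorem size_eq_progeny (e : Marks) : size e = progeny fun v => (e v).1 := by
  classical
  rw [size, clusterOf, cluster, Measure.sum_apply _ MeasurableSet.univ, progeny]
  refine tsum_congr fun v => ?_
  by_cases h : IsBorn (fun v => (e v).1) v <;> simp [h]

theorem measurable_offspring : Measurable fun (e : Marks) v => (e v).1 := by fun_prop

theorem measurable_size : Measurable size := by
  rw [funext size_eq_progeny]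
  exact measurable_progeny.comp measurable_offspring

theorem map_offspring_marksLaw (r : ℝ≥0) (d : Measure ℝ) [IsProbabilityMeasure d] :
    (marksLaw r d).map (fun e v => (e v).1) = treeLaw (poissonMeasure r) := by
  rw [marksLaw, Measure.infinitePi_map_pi _ (f := fun _ => Prod.fst) fun _ => measurable_fst]
  simp [treeLaw]

theorem measurable_position (v : List ℕ) :
    Measurable fun e : Marks => position (fun v => (e v).2) v := by
  induction v with
  | nil => exact measurable_const
  | cons i v ih => exact ih.add (measurable_pi_apply (i :: v)).snd

theorem measurableSet_isBorn_marks (v : List ℕ) :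
    MeasurableSet {e : Marks | IsBorn (fun v => (e v).1) v} :=
  measurable_offspring (measurableSet_isBorn v)

/-- The cluster with given marks of an immigrant at a given place. -/
def placed (p : ℝ × Marks) : Measure ℝ := translate p.1 (clusterOf p.2)

theorem placed_univ (p : ℝ × Marks) : placed p Set.univ = size p.2 := by
  rw [placed, translate, Measure.map_apply (by fun_prop) MeasurableSet.univ]; rfl

open Classical in
/-- The placed clusters form a kernel. -/
def placedKernel : Kernel (ℝ × Marks) ℝ :=
  Kernel.sum fun v : List ℕ => Kernel.piecewise
    (s := {p : ℝ × Marks | IsBorn (fun v => (p.2 v).1) v})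
    (measurable_snd (measurableSet_isBorn_marks v))
    (Kernel.deterministic (fun p : ℝ × Marks => position (fun v => (p.2 v).2) v + p.1)
      (((measurable_position v).comp measurable_snd).add measurable_fst)) 0

theorem placedKernel_apply (p : ℝ × Marks) : placedKernel p = placed p := by
  classical
  rw [placedKernel, Kernel.sum_apply, placed, translate, clusterOf, cluster,
    Measure.map_sum (by fun_prop)]
  congr 1
  ext1 v
  rw [Kernel.piecewise_apply]
  by_cases h : IsBorn (fun v => (p.2 v).1) v
  · simp only [Set.mem_ofPred_eq, h, if_true]
    rw [Kernel.deterministic_apply, Measure.map_dirac' (by fun_prop)]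
  · simp [h]

theorem measurable_placed : Measurable placed := by
  rw [show placed = placedKernel from funext fun p => (placedKernel_apply p).symm]
  exact placedKernel.measurable

theorem measurable_clusterOf : Measurable clusterOf := by
  have : clusterOf = fun e => placed (0, e) := by
    ext1 e; simp [placed, translate]
  rw [this]
  exact measurable_placed.comp measurable_prodMk_left

/-- The integral of `f` with respect to a placed cluster. -/
def shot (f : ℝ → ℝ) (p : ℝ × Marks) : ℝ := ∫ x, f x ∂(placed p)

theorem measurable_shot {f : ℝ → ℝ} (hf : Measurable f) : Measurable (shot f) := by
  have : shot f = fun p => ∫ x, f x ∂(placedKernel p) := by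
    ext p; rw [shot, placedKernel_apply]
  rw [this]
  exact (StronglyMeasurable.integral_kernel hf.stronglyMeasurable).measurable

theorem exists_finset_placed_eq {e : Marks} (he : size e ≠ ∞) :
    ∃ s : Finset (List ℕ), (∀ v, v ∈ s ↔ IsBorn (fun v => (e v).1) v) ∧ ∀ u, placed (u, e) =
      ∑ v ∈ s, Measure.dirac (position (fun v => (e v).2) v + u) := by
  classical
  rw [size_eq_progeny] at he
  refine ⟨(finite_isBorn he).toFinset, fun v => by simp, fun u => ?_⟩
  rw [placed, translate, clusterOf, cluster, Measure.map_sum (by fun_prop), ← Measure.sum_coe_finset]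
  ext A hA
  rw [Measure.sum_apply _ hA, Measure.sum_apply _ hA]
  refine Eq.trans ?_ (tsum_subtype ((finite_isBorn he).toFinset : Set (List ℕ))
    fun v => Measure.dirac (position (fun v => (e v).2) v + u) A).symm
  refine tsum_congr fun v => ?_
  by_cases h : IsBorn (fun v => (e v).1) v
  · simp only [h, if_true]
    rw [Set.indicator_of_mem (by simpa using h), Measure.map_dirac' (by fun_prop)]
  · rw [Set.indicator_of_notMem (by simpa using h)]
    simp [h]

theorem isFiniteMeasure_placed {p : ℝ × Marks} (hp : size p.2 ≠ ∞) : IsFiniteMeasure (placed p) :=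
  ⟨by rw [placed_univ]; exact hp.lt_top⟩

/-- The number of points of a placed cluster in `[-R, R]`. -/
def window (R : ℝ) (p : ℝ × Marks) : ℝ := (placed p).real (Set.Icc (-R) R)

theorem measurable_window (R : ℝ) : Measurable (window R) :=
  ((Measure.measurable_coe measurableSet_Icc).comp measurable_placed).ennreal_toReal

theorem window_nonneg (R : ℝ) (p : ℝ × Marks) : 0 ≤ window R p := measureReal_nonneg

theorem window_le_size {R : ℝ} {p : ℝ × Marks} (hp : size p.2 ≠ ∞) :
    window R p ≤ (size p.2).toReal := by
  rw [window, measureReal_def, ← placed_univ]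
  exact ENNReal.toReal_mono (by rwa [placed_univ]) (measure_mono (Set.subset_univ _))

theorem abs_shot_le {f : ℝ → ℝ} {B R : ℝ}
    (hf : ∀ x, |f x| ≤ (Set.Icc (-R) R).indicator (fun _ => B) x)
    {p : ℝ × Marks} (hp : size p.2 ≠ ∞) : |shot f p| ≤ B * window R p := by
  have := isFiniteMeasure_placed hp
  have hi : Integrable ((Set.Icc (-R) R).indicator fun _ => B) (placed p) :=
    (integrable_const B).indicator measurableSet_Icc
  calc |shot f p| ≤ ∫ x, (Set.Icc (-R) R).indicator (fun _ => B) x ∂(placed p) :=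
        norm_integral_le_of_norm_le (f := f) hi (ae_of_all _ hf)
    _ = B * window R p := by
        rw [integral_indicator_const _ measurableSet_Icc, smul_eq_mul, mul_comm]; rfl

/-- By Tonelli and translation invariance, every individual contributes the length of `A`, whatever
its position. -/
theorem lintegral_placed_apply {e : Marks} (he : size e ≠ ∞) {A : Set ℝ} (hA : MeasurableSet A) :
    ∫⁻ u, placed (u, e) A = volume A * size e := by
  have : IsFiniteMeasure (clusterOf e) := ⟨he.lt_top⟩
  have h1 : ∀ u, placed (u, e) A = ∫⁻ x, A.indicator 1 (x + u) ∂(clusterOf e) := fun u => by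
    rw [placed, translate, ← lintegral_indicator_one hA, lintegral_map (by
      exact measurable_one.indicator hA) (by fun_prop)]
  simp_rw [h1]
  rw [lintegral_lintegral_swap]
  · have h2 : ∀ x : ℝ, ∫⁻ u, A.indicator 1 (x + u) = volume A := fun x => by
      rw [lintegral_add_left_eq_self (fun y => A.indicator (1 : ℝ → ℝ≥0∞) y) x,
        lintegral_indicator_one hA]
    simp_rw [h2, lintegral_const]
    rfl
  · exact ((measurable_one.indicator hA).comp (measurable_snd.add measurable_fst)).aemeasurable

/-- The marks reflected at the origin. -/
def negMarks (e : Marks) : Marks := fun v => ((e v).1, -(e v).2)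

theorem measurable_negMarks : Measurable negMarks := by unfold negMarks; fun_prop

theorem position_neg (D : List ℕ → ℝ) (v : List ℕ) :
    position (fun v => -D v) v = -position D v := by
  induction v with
  | nil => simp [position]
  | cons i v ih => simp [position, ih]; ring

theorem clusterOf_negMarks (e : Marks) : clusterOf (negMarks e) = reflect (clusterOf e) := by
  classical
  rw [reflect, clusterOf, clusterOf, cluster, cluster, Measure.map_sum (by fun_prop)]
  congr 1
  ext1 v
  by_cases h : IsBorn (fun v => (e v).1) v
  · simp only [negMarks, h, if_true, position_neg]
    rw [Measure.map_dirac' (by fun_prop)]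
  · simp [negMarks, h]

/-- The evenness of `d` acts on each coordinate of the product separately. This invariance is the
only source of symmetry: of the cluster, of the process and of the family measures. -/
theorem map_negMarks (r : ℝ≥0) {d : Measure ℝ} [IsProbabilityMeasure d]
    (hd : d.map (fun x => -x) = d) : (marksLaw r d).map negMarks = marksLaw r d := by
  have h := Measure.infinitePi_map_pi (fun _ : List ℕ => (poissonMeasure r).prod d)
    (f := fun _ p => (p.1, -p.2)) fun _ => by fun_prop
  refine h.trans ?_
  have : ((poissonMeasure r).prod d).map (fun p => (p.1, -p.2)) = (poissonMeasure r).prod d := by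
    have h := Measure.map_prod_map (poissonMeasure r) d measurable_id
      (measurable_neg : Measurable fun x : ℝ => -x)
    rw [hd, Measure.map_id] at h
    exact h.symm
  simp_rw [this]
  rfl

theorem placed_neg (u : ℝ) (e : Marks) : placed (-u, negMarks e) = reflect (placed (u, e)) := by
  simp only [placed, translate, reflect, clusterOf_negMarks]
  rw [Measure.map_map (by fun_prop) (by fun_prop), Measure.map_map (by fun_prop) (by fun_prop)]
  congr 1
  ext x
  simp [add_comm]

theorem shot_comp_neg {f : ℝ → ℝ} (hf : Measurable f) (u : ℝ) (e : Marks) :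
    shot (fun x => f (-x)) (u, e) = shot f (-u, negMarks e) := by
  rw [shot, shot, placed_neg, reflect, integral_map (by fun_prop) hf.aestronglyMeasurable]

/-! ### Exponential moments -/

theorem ae_size_lt_top {r : ℝ≥0} (hr : r < 1) (d : Measure ℝ) [IsProbabilityMeasure d] :
    ∀ᵐ e ∂(marksLaw r d), size e < ∞ := by
  simp_rw [size_eq_progeny]
  have := (exists_integrable_exp_progeny hr).1
  rw [← map_offspring_marksLaw r d] at this
  exact ae_of_ae_map measurable_offspring.aemeasurable this

theorem exists_integrable_exp_size {r : ℝ≥0} (hr : r < 1) (d : Measure ℝ)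
    [IsProbabilityMeasure d] : ∃ θ : ℝ, 0 < θ ∧
      Integrable (fun e => Real.exp (θ * (size e).toReal)) (marksLaw r d) := by
  obtain ⟨-, θ, hθ, h⟩ := exists_integrable_exp_progeny hr
  refine ⟨θ, hθ, ?_⟩
  rw [← map_offspring_marksLaw r d] at h
  simp_rw [size_eq_progeny]
  exact h.comp_measurable measurable_offspring

theorem measure_size_eq (r : ℝ≥0) (d : Measure ℝ) [IsProbabilityMeasure d] {n : ℕ} (hn : 1 ≤ n) :
    marksLaw r d {e | size e = n} =
      ENNReal.ofReal (Real.exp (-(r * n)) * (r * n) ^ (n - 1) / n.factorial) := by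
  have h := Measure.map_apply (μ := marksLaw r d) measurable_offspring
    (measurable_progeny (measurableSet_singleton (n : ℝ≥0∞)))
  rw [map_offspring_marksLaw] at h
  rw [← measure_progeny_eq r hn]
  simp_rw [size_eq_progeny]
  exact h.symm

theorem pow_le_mul_exp {θ : ℝ} (hθ : 0 < θ) (k : ℕ) {x : ℝ} (hx : 0 ≤ x) :
    x ^ k ≤ k.factorial / θ ^ k * Real.exp (θ * x) := by
  have h := Real.pow_div_factorial_le_exp (θ * x) (by positivity) k
  have h2 : (0 : ℝ) < k.factorial := by positivity
  rw [div_le_iff₀ h2, mul_pow] at h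
  rw [div_mul_eq_mul_div, le_div_iff₀ (by positivity)]
  linarith
end
end BranchingCluster

namespace BranchingCluster
noncomputable section
open scoped ENNReal NNReal

/-! ### The cluster process -/

/-- The intensity measure of the immigrants together with the marks of their clusters. -/
def placedLaw (c : ℝ≥0∞) (r : ℝ≥0) (d : Measure ℝ) : Measure (ℝ × Marks) :=
  (c • volume).prod (marksLaw r d)

/-- A bounded function with support in `[-R, R]`. -/
def IsWindowed (R B : ℝ) (f : ℝ → ℝ) : Prop :=
  ∀ x, |f x| ≤ (Set.Icc (-R) R).indicator (fun _ => B) x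

theorem IsWindowed.abs_le {R B : ℝ} {f : ℝ → ℝ} (hB : 0 ≤ B) (hf : IsWindowed R B f) (x : ℝ) :
    |f x| ≤ B :=
  (hf x).trans (Set.indicator_le_self' (fun _ _ => hB) x)

theorem IsWindowed.eq_zero {R B : ℝ} {f : ℝ → ℝ} (hf : IsWindowed R B f) {x : ℝ}
    (hx : x ∉ Set.Icc (-R) R) : f x = 0 := by
  have := hf x
  rw [Set.indicator_of_notMem hx] at this
  exact abs_eq_zero.1 (le_antisymm this (abs_nonneg _))

section
variable {c : ℝ≥0∞} {r : ℝ≥0} {d : Measure ℝ} [IsProbabilityMeasure d]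

omit [IsProbabilityMeasure d] in
theorem ae_placedLaw {p : Marks → Prop} (h : ∀ᵐ e ∂(marksLaw r d), p e) :
    ∀ᵐ q ∂(placedLaw c r d), p q.2 :=
  Measure.quasiMeasurePreserving_snd.ae h

omit [IsProbabilityMeasure d] in
-- The gap `θ - δ` in the exponent absorbs any power of the size.
theorem integrable_pow_mul_exp {θ : ℝ}
    (hexp : Integrable (fun e => Real.exp (θ * (size e).toReal)) (marksLaw r d)) (k : ℕ) {δ : ℝ}
    (hδ : δ < θ) :
    Integrable (fun e => (size e).toReal ^ k * Real.exp (δ * (size e).toReal)) (marksLaw r d) := by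
  have hm := measurable_size.ennreal_toReal
  refine (hexp.const_mul (k.factorial / (θ - δ) ^ k)).mono'
    ((hm.pow_const k).mul (hm.const_mul δ).exp).aestronglyMeasurable (ae_of_all _ fun e => ?_)
  have h0 : 0 ≤ (size e).toReal := ENNReal.toReal_nonneg
  have h1 := pow_le_mul_exp (sub_pos.2 hδ) k h0
  rw [Real.norm_eq_abs, abs_of_nonneg (by positivity)]
  calc _ ≤ k.factorial / (θ - δ) ^ k * Real.exp ((θ - δ) * (size e).toReal) *
        Real.exp (δ * (size e).toReal) := by gcongr
    _ = _ := by rw [mul_assoc, ← Real.exp_add]; congr 2; ring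

/-- Integrating over the immigrant's place first turns `window R` into the length of the window
times the size. One factor `window R` therefore pays for the infinite range of places, and only a
moment of the size remains. -/
theorem integrable_window_mul (hc : c ≠ ∞) (hfin : ∀ᵐ e ∂(marksLaw r d), size e < ∞)
    {g : Marks → ℝ} (hg : Measurable g) (hg0 : ∀ e, 0 ≤ g e)
    (hgi : Integrable (fun e => (size e).toReal * g e) (marksLaw r d)) (R : ℝ) :
    Integrable (fun p => window R p * g p.2) (placedLaw c r d) := by
  have hm : Measurable fun p : ℝ × Marks => window R p * g p.2 :=
    (measurable_window R).mul (hg.comp measurable_snd)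
  refine ⟨hm.aestronglyMeasurable, ?_⟩
  rw [hasFiniteIntegral_iff_ofReal (ae_of_all _ fun p => mul_nonneg (window_nonneg R p) (hg0 _)),
    placedLaw, lintegral_prod_symm _ hm.ennreal_ofReal.aemeasurable]
  have h1 : ∀ᵐ e ∂(marksLaw r d), ∫⁻ u, ENNReal.ofReal (window R (u, e) * g e) ∂(c • volume) =
      c * volume (Set.Icc (-R) R) * ENNReal.ofReal ((size e).toReal * g e) := by
    filter_upwards [hfin] with e he
    have h2 : ∀ u, ENNReal.ofReal (window R (u, e) * g e) =
        ENNReal.ofReal (g e) * placed (u, e) (Set.Icc (-R) R) := fun u => by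
      have := isFiniteMeasure_placed (p := (u, e)) he.ne
      rw [mul_comm, ENNReal.ofReal_mul (hg0 e), window, ofReal_measureReal]
    simp_rw [h2]
    rw [lintegral_const_mul', lintegral_smul_measure, lintegral_placed_apply he.ne measurableSet_Icc,
      mul_comm (size e).toReal, ENNReal.ofReal_mul (hg0 e), ENNReal.ofReal_toReal he.ne, smul_eq_mul]
    · ring
    · exact ENNReal.ofReal_ne_top
  rw [lintegral_congr_ae h1, lintegral_const_mul']
  · refine ENNReal.mul_lt_top (ENNReal.mul_lt_top hc.lt_top measure_Icc_lt_top) ?_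
    have := hgi.2
    rwa [hasFiniteIntegral_iff_ofReal (ae_of_all _ fun e =>
      mul_nonneg ENNReal.toReal_nonneg (hg0 _))] at this
  · exact (ENNReal.mul_lt_top hc.lt_top measure_Icc_lt_top).ne

theorem integrable_window_mul_exp (hc : c ≠ ∞) {θ : ℝ}
    (hexp : Integrable (fun e => Real.exp (θ * (size e).toReal)) (marksLaw r d))
    (hfin : ∀ᵐ e ∂(marksLaw r d), size e < ∞) (R : ℝ) (k : ℕ) {δ : ℝ} (hδ : δ < θ) :
    Integrable (fun p => window R p * ((size p.2).toReal ^ k * Real.exp (δ * (size p.2).toReal)))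
      (placedLaw c r d) := by
  have hm := measurable_size.ennreal_toReal
  refine integrable_window_mul hc hfin (g := fun e => (size e).toReal ^ k *
    Real.exp (δ * (size e).toReal)) ((hm.pow_const k).mul (hm.const_mul δ).exp)
    (fun e => by positivity) ?_ R
  convert! integrable_pow_mul_exp hexp (k + 1) hδ using 2
  ring

theorem exp_sub_one_le_mul_exp (x : ℝ) : Real.exp x - 1 ≤ x * Real.exp x := by
  have h1 := Real.add_one_le_exp (-x)
  have h2 : Real.exp (-x) * Real.exp x = 1 := by rw [← Real.exp_add]; simp
  nlinarith [Real.exp_pos x]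

variable {f : ℝ → ℝ} {B R θ : ℝ}

theorem IsWindowed.abs_shot_le_size (hf : IsWindowed R B f) (hB : 0 ≤ B) {p : ℝ × Marks}
    (hp : size p.2 ≠ ∞) : |shot f p| ≤ B * (size p.2).toReal :=
  (abs_shot_le hf hp).trans (mul_le_mul_of_nonneg_left (window_le_size hp) hB)

theorem measurable_shot_mk (hfm : Measurable f) (u : ℝ) : Measurable fun e => shot f (u, e) :=
  (measurable_shot hfm).comp measurable_prodMk_left

omit [IsProbabilityMeasure d] in
theorem integrable_exp_abs_shot
    (hexp : Integrable (fun e => Real.exp (θ * (size e).toReal)) (marksLaw r d))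
    (hfin : ∀ᵐ e ∂(marksLaw r d), size e < ∞) (hfm : Measurable f) (hf : IsWindowed R B f)
    (hB : 0 ≤ B) (hBθ : B < θ) (u : ℝ) :
    Integrable (fun e => Real.exp |shot f (u, e)|) (marksLaw r d) := by
  refine hexp.mono' (measurable_shot_mk hfm u).abs.exp.aestronglyMeasurable ?_
  filter_upwards [hfin] with e he
  rw [Real.norm_eq_abs, abs_of_pos (Real.exp_pos _)]
  have h1 : |shot f (u, e)| ≤ B * (size e).toReal := hf.abs_shot_le_size hB (p := (u, e)) he.ne
  have h2 : B * (size e).toReal ≤ θ * (size e).toReal :=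
    mul_le_mul_of_nonneg_right hBθ.le ENNReal.toReal_nonneg
  exact Real.exp_le_exp.2 (h1.trans h2)

/-- Bounding `exp x - 1` by `x * exp x` keeps one factor `window R`, as integrability over all
places demands; the exponential is controlled by the size. -/
theorem integrable_exp_abs_shot_sub_one (hc : c ≠ ∞)
    (hexp : Integrable (fun e => Real.exp (θ * (size e).toReal)) (marksLaw r d))
    (hfin : ∀ᵐ e ∂(marksLaw r d), size e < ∞) (hfm : Measurable f) (hf : IsWindowed R B f)
    (hB : 0 ≤ B) (hBθ : B < θ) :
    Integrable (fun p => Real.exp |shot f p| - 1) (placedLaw c r d) := by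
  refine ((integrable_window_mul_exp hc hexp hfin R 0 hBθ).const_mul B).mono'
    ((measurable_shot hfm).abs.exp.sub_const 1).aestronglyMeasurable ?_
  filter_upwards [ae_placedLaw (c := c) hfin] with p hp
  rw [Real.norm_eq_abs, abs_of_nonneg (sub_nonneg.2 (Real.one_le_exp (abs_nonneg _)))]
  refine (exp_sub_one_le_mul_exp _).trans ?_
  have h1 := hf.abs_shot_le_size hB hp.ne
  have h2 := abs_shot_le hf hp.ne
  rw [pow_zero, one_mul, ← mul_assoc]
  exact mul_le_mul h2 (Real.exp_le_exp.2 h1) (Real.exp_pos _).le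
    (mul_nonneg hB (window_nonneg R p))

variable {Ω : Type*} [MeasurableSpace Ω] {P : Measure Ω} [IsProbabilityMeasure P]
  {U : ℕ → Ω → ℝ} {e : ℕ → Ω → Marks}

/-- The superposition of the placed clusters. -/
def superposition (U : ℕ → Ω → ℝ) (e : ℕ → Ω → Marks) (ω : Ω) : Measure ℝ :=
  Measure.sum fun j => placed (U j ω, e j ω)

theorem integrable_of_isWindowed {μ : Measure ℝ} (hμ : μ (Set.Icc (-R) R) < ∞)
    (hfm : Measurable f) (hf : IsWindowed R B f) : Integrable f μ := by
  have h1 : Integrable ((Set.Icc (-R) R).indicator fun _ => B) μ :=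
    (integrable_indicator_iff measurableSet_Icc).2 (integrableOn_const hμ.ne)
  exact h1.mono' hfm.aestronglyMeasurable (ae_of_all _ hf)

omit [MeasurableSpace Ω] in
theorem hasSum_shot {ω : Ω} (hω : superposition U e ω (Set.Icc (-R) R) < ∞)
    (hfm : Measurable f) (hf : IsWindowed R B f) :
    HasSum (fun j => shot f (U j ω, e j ω)) (∫ x, f x ∂(superposition U e ω)) :=
  hasSum_integral_measure (integrable_of_isWindowed hω hfm hf)

omit [IsProbabilityMeasure P] in
theorem IsMarked.ae_size_lt_top {E : Type*} [MeasurableSpace E] {U : ℕ → Ω → E}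
    (hM : IsMarked P U e (marksLaw r d))
    (hfin : ∀ᵐ e ∂(marksLaw r d), size e < ∞) : ∀ᵐ ω ∂P, ∀ j, size (e j ω) < ∞ := by
  rw [ae_all_iff]
  intro j
  rw [← hM.map_marks j] at hfin
  exact ae_of_ae_map (hM.measurable_marks j).aemeasurable hfin

variable (hη : IsPoissonProcess P (fun ω => Measure.sum fun j => Measure.dirac (U j ω))
  (c • (volume : Measure ℝ)))
  (hM : IsMarked P U e (marksLaw r d)) (hc : c ≠ ∞)
  (hexp : Integrable (fun e => Real.exp (θ * (size e).toReal)) (marksLaw r d))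
  (hfin : ∀ᵐ e ∂(marksLaw r d), size e < ∞)
include hexp hfin hc

theorem integrable_integral_exp_sub_one (hfm : Measurable f) (hf : IsWindowed R B f)
    (hB : 0 ≤ B) (hBθ : B < θ) :
    Integrable (fun u => (∫ x, Real.exp |shot f (u, x)| ∂(marksLaw r d)) - 1)
      (c • (volume : Measure ℝ)) := by
  have h := (integrable_exp_abs_shot_sub_one hc hexp hfin hfm hf hB hBθ).integral_prod_left
  refine h.congr (ae_of_all _ fun u => ?_)
  simp only
  rw [integral_sub (integrable_exp_abs_shot hexp hfin hfm hf hB hBθ u) (integrable_const _)]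
  simp

include hη hM

theorem ae_superposition_Icc_lt_top (hθ : 0 < θ) (R : ℝ) :
    ∀ᵐ ω ∂P, superposition U e ω (Set.Icc (-R) R) < ∞ := by
  -- Any positive height below `θ` serves: summability of the shots of a multiple of the indicator
  -- is finiteness of the count.
  set f : ℝ → ℝ := (Set.Icc (-R) R).indicator fun _ => θ / 2 with hf
  have hfm : Measurable f := measurable_const.indicator measurableSet_Icc
  have hf0 : ∀ x, 0 ≤ f x := Set.indicator_nonneg fun _ _ => by positivity
  have hfw : IsWindowed R (θ / 2) f := fun x => by rw [abs_of_nonneg (hf0 x)]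
  have hB : 0 ≤ θ / 2 := by positivity
  have hBθ : θ / 2 < θ := by linarith
  have h1 := (hM.lintegral_exp_tsum_abs hη (measurable_shot hfm)
    (integrable_exp_abs_shot hexp hfin hfm hfw hB hBθ)
    (integrable_integral_exp_sub_one hc hexp hfin hfm hfw hB hBθ)).1
  filter_upwards [h1, hM.ae_size_lt_top hfin] with ω hω hs
  have h2 : ∀ j, |shot f (U j ω, e j ω)| = θ / 2 * window R (U j ω, e j ω) := fun j => by
    rw [shot, hf, integral_indicator_const _ measurableSet_Icc, smul_eq_mul, mul_comm, window,
      abs_of_nonneg (mul_nonneg hB measureReal_nonneg)]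
  simp_rw [h2] at hω
  have h3 := (summable_mul_left_iff (by positivity : θ / 2 ≠ 0)).1 hω
  rw [superposition, Measure.sum_apply _ measurableSet_Icc]
  have h4 : ∀ j, placed (U j ω, e j ω) (Set.Icc (-R) R) =
      ENNReal.ofReal (window R (U j ω, e j ω)) := fun j => by
    have := isFiniteMeasure_placed (p := (U j ω, e j ω)) (hs j).ne
    rw [window, ofReal_measureReal]
  simp_rw [h4]
  rw [← ENNReal.ofReal_tsum_of_nonneg (fun j => window_nonneg R _) h3]
  exact ENNReal.ofReal_lt_top

theorem aemeasurable_integral_superposition (hθ : 0 < θ) (hfm : Measurable f)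
    (hf : IsWindowed R B f) : AEMeasurable (fun ω => ∫ x, f x ∂(superposition U e ω)) P := by
  refine aemeasurable_of_tendsto_metrizable_ae atTop
    (f := fun n ω => ∑ j ∈ Finset.range n, shot f (U j ω, e j ω)) (fun n => ?_) ?_
  · exact (Finset.measurable_sum _ fun j _ => (measurable_shot hfm).comp
      ((hM.measurable_points j).prodMk (hM.measurable_marks j))).aemeasurable
  · filter_upwards [ae_superposition_Icc_lt_top hη hM hc hexp hfin hθ R] with ω hω
    exact (hasSum_shot hω hfm hf).tendsto_sum_nat

/-- The exponential functional of the cluster process. -/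
theorem integral_exp_superposition (hθ : 0 < θ) (hfm : Measurable f) (hf : IsWindowed R B f)
    (hB : 0 ≤ B) (hBθ : B < θ) :
    Integrable (fun ω => Real.exp (∫ x, f x ∂(superposition U e ω))) P ∧
    ∫ ω, Real.exp (∫ x, f x ∂(superposition U e ω)) ∂P =
      Real.exp (∫ p, (Real.exp (shot f p) - 1) ∂(placedLaw c r d)) := by
  have hi := integrable_exp_abs_shot hexp hfin hfm hf hB hBθ
  have h1 := hM.lintegral_exp_tsum hη (measurable_shot hfm) hi
    (integrable_integral_exp_sub_one hc hexp hfin hfm hf hB hBθ)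
  have h2 : ∫⁻ ω, ENNReal.ofReal (Real.exp (∫ x, f x ∂(superposition U e ω))) ∂P =
      ∫⁻ ω, ENNReal.ofReal (Real.exp (∑' j, shot f (U j ω, e j ω))) ∂P := by
    refine lintegral_congr_ae ?_
    filter_upwards [ae_superposition_Icc_lt_top hη hM hc hexp hfin hθ R] with ω hω
    rw [(hasSum_shot hω hfm hf).tsum_eq]
  have hint : Integrable (fun p => Real.exp (shot f p) - 1) (placedLaw c r d) :=
    (integrable_exp_abs_shot_sub_one hc hexp hfin hfm hf hB hBθ).mono'
      ((measurable_shot hfm).exp.sub_const 1).aestronglyMeasurable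
      (ae_of_all _ fun p => abs_exp_sub_one_le_of_abs_le le_rfl)
  have h3 : ∫ u, ((∫ x, Real.exp (shot f (u, x)) ∂(marksLaw r d)) - 1)
      ∂(c • (volume : Measure ℝ)) = ∫ p, (Real.exp (shot f p) - 1) ∂(placedLaw c r d) := by
    rw [placedLaw, integral_prod _ hint]
    refine integral_congr_ae (ae_of_all _ fun u => ?_)
    simp only
    rw [integral_sub (integrable_exp_of_abs (measurable_shot_mk hfm u) (hi u)) (integrable_const _)]
    simp
  rw [h3, ← h2] at h1
  have hae := (aemeasurable_integral_superposition hη hM hc hexp hfin hθ hfm hf).exp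
  have hI : Integrable (fun ω => Real.exp (∫ x, f x ∂(superposition U e ω))) P := by
    refine ⟨hae.aestronglyMeasurable, ?_⟩
    rw [hasFiniteIntegral_iff_ofReal (ae_of_all _ fun _ => (Real.exp_pos _).le), h1]
    exact ENNReal.ofReal_lt_top
  refine ⟨hI, ?_⟩
  rw [integral_eq_lintegral_of_nonneg_ae (ae_of_all _ fun _ => (Real.exp_pos _).le)
    hae.aestronglyMeasurable, h1, ENNReal.toReal_ofReal (Real.exp_pos _).le]

end
end
end BranchingCluster

namespace BranchingCluster
noncomputable section
open scoped ENNReal NNReal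

/-! ### Laws of random measures -/

section
variable {Ω : Type*} [MeasurableSpace Ω] {P : Measure Ω} [IsProbabilityMeasure P]

omit [IsProbabilityMeasure P] in
theorem mem_interior_integrableExpSet {X : Ω → ℝ} {ε : ℝ}
    (hX : ∀ t, |t| < ε → Integrable (fun ω => Real.exp (t * X ω)) P) {t : ℝ} (ht : |t| < ε) :
    t ∈ interior (integrableExpSet X P) := by
  refine mem_interior.2 ⟨{s | |s| < ε}, fun s hs => hX s hs,
    isOpen_lt continuous_abs continuous_const, ht⟩

omit [IsProbabilityMeasure P] in
/-- Moment generating functions that agree near the origin determine the characteristic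
function. -/
theorem integral_cexp_eq_of_mgf_eq {X Y : Ω → ℝ} {ε : ℝ} (hε : 0 < ε)
    (hX : ∀ t, |t| < ε → Integrable (fun ω => Real.exp (t * X ω)) P)
    (hY : ∀ t, |t| < ε → Integrable (fun ω => Real.exp (t * Y ω)) P)
    (hXY : ∀ t, |t| < ε → mgf X P t = mgf Y P t) :
    ∫ ω, Complex.exp (Complex.I * X ω) ∂P = ∫ ω, Complex.exp (Complex.I * Y ω) ∂P := by
  have h0 : |(0 : ℝ)| < ε := by simpa using hε
  set S : Set ℂ := {z | z.re ∈ Set.Ioo (-ε) ε} with hS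
  have hSX : AnalyticOnNhd ℂ (complexMGF X P) S := fun z hz =>
    analyticOnNhd_complexMGF z (mem_interior_integrableExpSet hX (abs_lt.2 hz))
  have hSY : AnalyticOnNhd ℂ (complexMGF Y P) S := fun z hz =>
    analyticOnNhd_complexMGF z (mem_interior_integrableExpSet hY (abs_lt.2 hz))
  have hconv : IsPreconnected S :=
    ((convex_Ioo (-ε) ε).linear_preimage Complex.reLm).isPreconnected
  -- Agreement at real points accumulating at `0` propagates, by the identity theorem, over the
  -- strip `|Re z| < ε`, which contains `I`.
  have hfreq : ∃ᶠ z in 𝓝[≠] ((0 : ℝ) : ℂ), complexMGF X P z = complexMGF Y P z := by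
    have h_real : ∃ᶠ (x : ℝ) in 𝓝[≠] 0, complexMGF X P x = complexMGF Y P x := by
      refine Eventually.frequently ?_
      filter_upwards [nhdsWithin_le_nhds ((isOpen_lt continuous_abs continuous_const).mem_nhds h0)]
        with x hx
      rw [complexMGF_ofReal, complexMGF_ofReal, hXY x hx]
    rw [frequently_iff_seq_forall] at h_real ⊢
    obtain ⟨xs, hx_tendsto, hx_eq⟩ := h_real
    refine ⟨fun n => xs n, ?_, hx_eq⟩
    rw [tendsto_nhdsWithin_iff] at hx_tendsto ⊢
    exact ⟨(Complex.continuous_ofReal.tendsto _).comp hx_tendsto.1, by simpa using hx_tendsto.2⟩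
  have h := hSX.eqOn_of_preconnected_of_frequently_eq hSY hconv (z₀ := ((0 : ℝ) : ℂ))
    (by simpa [hS] using hε) hfreq
  exact h (show Complex.I ∈ S by simpa [hS] using hε)

/-- The bounded Borel sets. -/
abbrev BoundedBorel : Type := {A : Set ℝ // MeasurableSet A ∧ ∃ R : ℝ, A ⊆ Set.Icc (-R) R}

/-- Evaluation at any Borel set is the supremum of the evaluations at its bounded truncations, so
bounded sets generate the whole σ-algebra on measures. Only there are the counts almost surely
finite. -/
theorem comap_eval_boundedBorel :
    (MeasurableSpace.pi : MeasurableSpace (BoundedBorel → ℝ≥0∞)).comap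
      (fun (μ : Measure ℝ) (A : BoundedBorel) => μ A.1) =
      (inferInstance : MeasurableSpace (Measure ℝ)) := by
  refine le_antisymm ?_ ?_
  · exact Measurable.comap_le (measurable_pi_lambda _ fun A => Measure.measurable_coe A.2.1)
  · refine iSup₂_le fun s hs => ?_
    refine Measurable.comap_le (m₁ := _) ?_
    have h1 : (fun μ : Measure ℝ => μ s) = fun μ => ⨆ n : ℕ, μ (s ∩ Set.Icc (-n) n) := by
      ext μ
      rw [← Monotone.measure_iUnion]
      · congr 1
        rw [← Set.inter_iUnion, Set.iUnion_eq_univ_iff.2, Set.inter_univ]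
        intro x
        obtain ⟨n, hn⟩ := exists_nat_ge |x|
        exact ⟨n, abs_le.1 hn⟩
      · intro n m hnm
        have : (n : ℝ) ≤ m := by exact_mod_cast hnm
        exact Set.inter_subset_inter_right _ (Set.Icc_subset_Icc (by linarith) this)
    rw [h1]
    refine Measurable.iSup (mδ := _) fun n => ?_
    have h2 := comap_measurable (m := (MeasurableSpace.pi : MeasurableSpace (BoundedBorel → ℝ≥0∞)))
      (fun (μ : Measure ℝ) (A : BoundedBorel) => μ A.1)
    exact (measurable_pi_apply (⟨s ∩ Set.Icc (-n) n, hs.inter measurableSet_Icc, n,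
      Set.inter_subset_right⟩ : BoundedBorel)).comp h2

theorem ext_of_map_eval_boundedBorel {P₁ P₂ : Measure (Measure ℝ)}
    (h : P₁.map (fun μ (A : BoundedBorel) => μ A.1) = P₂.map fun μ (A : BoundedBorel) => μ A.1) :
    P₁ = P₂ := by
  have hm : Measurable fun (μ : Measure ℝ) (A : BoundedBorel) => μ A.1 :=
    measurable_pi_lambda _ fun A => Measure.measurable_coe A.2.1
  ext S hS
  have hS' : MeasurableSet[(MeasurableSpace.pi : MeasurableSpace (BoundedBorel → ℝ≥0∞)).comap
      (fun (μ : Measure ℝ) (A : BoundedBorel) => μ A.1)] S := by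
    rw [comap_eval_boundedBorel]; exact hS
  obtain ⟨B, hB, rfl⟩ := hS'
  rw [← Measure.map_apply hm hB, ← Measure.map_apply hm hB, h]

theorem exists_finset_bound (I : Finset BoundedBorel) :
    ∃ R : ℝ, ∀ A ∈ I, A.1 ⊆ Set.Icc (-R) R := by
  choose R hR using fun A : BoundedBorel => A.2.2
  refine ⟨∑ A ∈ I, |R A|, fun A hA => (hR A).trans ?_⟩
  have h1 : R A ≤ ∑ A ∈ I, |R A| :=
    (le_abs_self _).trans (Finset.single_le_sum (f := fun A => |R A|) (fun _ _ => abs_nonneg _) hA)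
  exact Set.Icc_subset_Icc (by linarith) h1

/-- Random measures, finite on bounded sets, with the same exponential functionals near zero have
the same law. -/
theorem map_eq_of_exp_integral_eq {N N' : Ω → Measure ℝ} (hN : Measurable N) (hN' : Measurable N')
    (hfin : ∀ R : ℝ, ∀ᵐ ω ∂P, N ω (Set.Icc (-R) R) < ∞)
    (hfin' : ∀ R : ℝ, ∀ᵐ ω ∂P, N' ω (Set.Icc (-R) R) < ∞) {θ : ℝ} (hθ : 0 < θ)
    (h : ∀ (f : ℝ → ℝ) (R B : ℝ), Measurable f → IsWindowed R B f → 0 ≤ B → B < θ →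
      Integrable (fun ω => Real.exp (∫ x, f x ∂(N ω))) P ∧
      Integrable (fun ω => Real.exp (∫ x, f x ∂(N' ω))) P ∧
      ∫ ω, Real.exp (∫ x, f x ∂(N ω)) ∂P = ∫ ω, Real.exp (∫ x, f x ∂(N' ω)) ∂P) :
    P.map N = P.map N' := by
  have hev : Measurable fun (μ : Measure ℝ) (A : BoundedBorel) => μ A.1 :=
    measurable_pi_lambda _ fun A => Measure.measurable_coe A.2.1
  refine ext_of_map_eval_boundedBorel ?_
  rw [Measure.map_map hev hN, Measure.map_map hev hN']
  refine (map_eq_iff_forall_finset_map_restrict_eq (X := fun (A : BoundedBorel) ω => N ω A.1)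
    (Y := fun (A : BoundedBorel) ω => N' ω A.1) (hev.comp hN).aemeasurable
    (hev.comp hN').aemeasurable).2 fun I => ?_
  obtain ⟨R, hR⟩ := exists_finset_bound I
  have hreal : P.map (fun ω (A : I) => (N ω).real A.1.1) =
      P.map (fun ω (A : I) => (N' ω).real A.1.1) := by
    have hm : ∀ {N : Ω → Measure ℝ}, Measurable N →
        Measurable fun ω (A : I) => (N ω).real A.1.1 := fun hN =>
      measurable_pi_lambda _ fun A =>
        ((Measure.measurable_coe A.1.2.1).comp hN).ennreal_toReal
    have : IsProbabilityMeasure (P.map (fun ω (A : I) => (N ω).real A.1.1)) :=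
      Measure.isProbabilityMeasure_map (hm hN).aemeasurable
    have : IsProbabilityMeasure (P.map (fun ω (A : I) => (N' ω).real A.1.1)) :=
      Measure.isProbabilityMeasure_map (hm hN').aemeasurable
    refine Measure.ext_of_charFunDual (funext fun L => ?_)
    classical
    -- A linear functional of the vector of counts is the integral of a step function, so the
    -- characteristic function of the counts is an exponential functional at an imaginary argument.
    set f : ℝ → ℝ := fun x => ∑ A : I, A.1.1.indicator (fun _ => L (Pi.single A 1)) x with hf
    set B : ℝ := ∑ A : I, |L (Pi.single A 1)| with hB
    have hB0 : 0 ≤ B := Finset.sum_nonneg fun _ _ => abs_nonneg _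
    have hfm : Measurable f :=
      Finset.measurable_sum _ fun A _ => measurable_const.indicator A.1.2.1
    have hfw : IsWindowed R B f := fun x => by
      by_cases hx : x ∈ Set.Icc (-R) R
      · rw [Set.indicator_of_mem hx]
        refine (Finset.abs_sum_le_sum_abs _ _).trans (Finset.sum_le_sum fun A _ => ?_)
        by_cases hA : x ∈ A.1.1 <;> simp [hA]
      · rw [Set.indicator_of_notMem hx, hf]
        simp only
        rw [Finset.sum_eq_zero, abs_zero]
        exact fun A _ => Set.indicator_of_notMem (fun h => hx (hR _ A.2 h)) _
    have hL : ∀ {N : Ω → Measure ℝ}, (∀ᵐ ω ∂P, N ω (Set.Icc (-R) R) < ∞) →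
        ∀ᵐ ω ∂P, L (fun A : I => (N ω).real A.1.1) = ∫ x, f x ∂(N ω) := by
      intro N hN
      filter_upwards [hN] with ω hω
      rw [hf, integral_finsetSum]
      · have hsum := LinearMap.pi_apply_eq_sum_univ (L : (I → ℝ) →ₗ[ℝ] ℝ)
          (fun A : I => (N ω).real A.1.1)
        refine hsum.trans ?_
        refine Finset.sum_congr rfl fun A _ => ?_
        rw [integral_indicator_const _ A.1.2.1]
        have hs : (Pi.single A 1 : I → ℝ) = fun j => if A = j then 1 else 0 := by
          funext i
          simp [Pi.single_apply, eq_comm]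
        rw [hs]
        rfl
      · intro A _
        exact (integrable_indicator_iff A.1.2.1).2 (integrableOn_const
          ((measure_mono (hR _ A.2)).trans_lt hω).ne)
    have hchar : ∀ {N : Ω → Measure ℝ}, Measurable N → (∀ᵐ ω ∂P, N ω (Set.Icc (-R) R) < ∞) →
        charFunDual (P.map (fun ω (A : I) => (N ω).real A.1.1)) L =
          ∫ ω, Complex.exp (Complex.I * (∫ x, f x ∂(N ω) : ℝ)) ∂P := by
      intro N hNm hN
      rw [charFunDual_apply, integral_map (hm hNm).aemeasurable (by fun_prop)]
      refine integral_congr_ae ?_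
      filter_upwards [hL hN] with ω hω
      rw [hω, mul_comm]
    rw [hchar hN (hfin R), hchar hN' (hfin' R)]
    have hε : 0 < θ / (B + 1) := by positivity
    have key : ∀ t, |t| < θ / (B + 1) →
        Integrable (fun ω => Real.exp (t * ∫ x, f x ∂(N ω))) P ∧
        Integrable (fun ω => Real.exp (t * ∫ x, f x ∂(N' ω))) P ∧
        ∫ ω, Real.exp (t * ∫ x, f x ∂(N ω)) ∂P = ∫ ω, Real.exp (t * ∫ x, f x ∂(N' ω)) ∂P := by
      intro t ht
      simp_rw [← integral_const_mul]
      refine h (fun x => t * f x) R (|t| * B) (hfm.const_mul t) (fun x => ?_)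
        (mul_nonneg (abs_nonneg _) hB0) ?_
      · rw [abs_mul]
        have := mul_le_mul_of_nonneg_left (hfw x) (abs_nonneg t)
        refine this.trans (le_of_eq ?_)
        by_cases hx : x ∈ Set.Icc (-R) R <;> simp only [hx, Set.indicator_of_mem,
          Set.indicator_of_notMem, not_false_eq_true, mul_zero]
      · rw [lt_div_iff₀ (by positivity)] at ht
        nlinarith [abs_nonneg t]
    exact integral_cexp_eq_of_mgf_eq hε (fun t ht => (key t ht).1) (fun t ht => (key t ht).2.1)
      fun t ht => (key t ht).2.2
  -- Almost surely the counts are finite, so their extended values are recovered from the real ones.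
  have hof : ∀ {N : Ω → Measure ℝ}, Measurable N → (∀ᵐ ω ∂P, N ω (Set.Icc (-R) R) < ∞) →
      P.map (fun ω => I.restrict (fun A : BoundedBorel => N ω A.1)) =
        (P.map (fun ω (A : I) => (N ω).real A.1.1)).map
          (fun y A => ENNReal.ofReal (y A)) := by
    intro N hNm hN
    have hm1 : Measurable fun ω (A : I) => (N ω).real A.1.1 :=
      measurable_pi_lambda _ fun A =>
        ((Measure.measurable_coe A.1.2.1).comp hNm).ennreal_toReal
    have hm2 : Measurable fun (y : I → ℝ) (A : I) => ENNReal.ofReal (y A) :=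
      measurable_pi_lambda _ fun A => (measurable_pi_apply A).ennreal_ofReal
    rw [Measure.map_map hm2 hm1]
    refine Measure.map_congr ?_
    filter_upwards [hN] with ω hω
    ext A
    simp only [Finset.restrict, Function.comp_apply]
    rw [ofReal_measureReal ((measure_mono (hR _ A.2)).trans_lt hω).ne]
  rw [hof hN (hfin R), hof hN' (hfin' R), hreal]

end

/-! ### Reversibility of the cluster process -/

section
variable {Ω : Type*} [MeasurableSpace Ω] {P : Measure Ω} [IsProbabilityMeasure P]
  {U : ℕ → Ω → ℝ} {e : ℕ → Ω → Marks} {c : ℝ≥0∞} {r : ℝ≥0} {d : Measure ℝ}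
  [IsProbabilityMeasure d] {θ : ℝ}

/-- The reflection of a placed cluster at the origin. -/
theorem map_reflect_placedLaw (hd : d.map (fun x => -x) = d) :
    (placedLaw c r d).map (fun p => (-p.1, negMarks p.2)) = placedLaw c r d := by
  have h := Measure.map_prod_map (c • (volume : Measure ℝ)) (marksLaw r d)
    (measurable_neg : Measurable fun x : ℝ => -x) measurable_negMarks
  rw [map_negMarks r hd, Measure.map_smul, Measure.map_neg_eq_self] at h
  exact h.symm

theorem integral_comp_reflect_placedLaw (hd : d.map (fun x => -x) = d) {G : ℝ × Marks → ℝ}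
    (hG : Measurable G) :
    ∫ p, G (-p.1, negMarks p.2) ∂(placedLaw c r d) = ∫ p, G p ∂(placedLaw c r d) := by
  have hm : Measurable fun p : ℝ × Marks => (-p.1, negMarks p.2) :=
    measurable_fst.neg.prodMk (measurable_negMarks.comp measurable_snd)
  conv_rhs => rw [← map_reflect_placedLaw hd]
  rw [integral_map hm.aemeasurable hG.aestronglyMeasurable]

theorem measurable_superposition (hU : ∀ j, Measurable (U j)) (he : ∀ j, Measurable (e j)) :
    Measurable (superposition U e) := by
  refine Measure.measurable_of_measurable_coe _ fun s hs => ?_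
  simp_rw [superposition, Measure.sum_apply _ hs]
  exact Measurable.tsum fun j => (Measure.measurable_coe hs).comp
    (measurable_placed.comp ((hU j).prodMk (he j)))

theorem measurable_reflect : Measurable reflect := Measure.measurable_map _ measurable_neg

/-- The exponential functional of the reflected process at `f` is that of the process at `x ↦ f
(-x)`. Both are integrals against `placedLaw`, which is invariant under reflecting the place and the
marks together. -/
theorem isReversible_superposition
    (hη : IsPoissonProcess P (fun ω => Measure.sum fun j => Measure.dirac (U j ω))
      (c • (volume : Measure ℝ)))
    (hM : IsMarked P U e (marksLaw r d)) (hc : c ≠ ∞)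
    (hexp : Integrable (fun e => Real.exp (θ * (size e).toReal)) (marksLaw r d))
    (hfin : ∀ᵐ e ∂(marksLaw r d), size e < ∞) (hθ : 0 < θ) (hd : d.map (fun x => -x) = d) :
    IsReversible P (superposition U e) := by
  have hm := measurable_superposition hM.measurable_points hM.measurable_marks
  have hm' : Measurable fun ω => reflect (superposition U e ω) := measurable_reflect.comp hm
  refine ⟨hm.aemeasurable, hm'.aemeasurable, ?_⟩
  have hf := ae_superposition_Icc_lt_top hη hM hc hexp hfin hθ
  refine map_eq_of_exp_integral_eq hm hm' hf (fun R => ?_) hθ fun f R B hfm hfw hB hBθ => ?_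
  · filter_upwards [hf R] with ω hω
    rw [reflect, Measure.map_apply measurable_neg measurableSet_Icc]
    simpa using hω
  · have h1 := integral_exp_superposition hη hM hc hexp hfin hθ hfm hfw hB hBθ
    have hfw' : IsWindowed R B fun x => f (-x) := fun x => by
      refine (hfw (-x)).trans (le_of_eq ?_)
      have : (-x ∈ Set.Icc (-R) R) ↔ x ∈ Set.Icc (-R) R := by
        simp only [Set.mem_Icc]; constructor <;> rintro ⟨h1, h2⟩ <;> constructor <;> linarith
      by_cases hx : x ∈ Set.Icc (-R) R
      · rw [Set.indicator_of_mem hx, Set.indicator_of_mem (this.2 hx)]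
      · rw [Set.indicator_of_notMem hx, Set.indicator_of_notMem fun h => hx (this.1 h)]
    have h2 := integral_exp_superposition hη hM hc hexp hfin hθ (hfm.comp measurable_neg) hfw'
      hB hBθ
    have h3 : ∀ ω, ∫ x, f x ∂(reflect (superposition U e ω)) =
        ∫ x, f (-x) ∂(superposition U e ω) := fun ω => by
      rw [reflect, integral_map (by fun_prop) hfm.aestronglyMeasurable]
    simp_rw [h3]
    refine ⟨h1.1, h2.1, ?_⟩
    rw [h1.2]
    refine Eq.trans ?_ h2.2.symm
    congr 1
    rw [← integral_comp_reflect_placedLaw hd ((measurable_shot hfm).exp.sub_const 1)]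
    refine integral_congr_ae (ae_of_all _ fun p => ?_)
    have := shot_comp_neg hfm p.1 p.2
    simp only [Function.comp_def]
    rw [← this]

end
end
end BranchingCluster

namespace BranchingCluster
noncomputable section
open scoped ENNReal NNReal

/-! ### Uniqueness of mixed derivatives -/

theorem snoc_zero_zero (n : ℕ) : Fin.snoc (α := fun _ => ℝ) (0 : Fin n → ℝ) 0 = 0 := by
  ext i
  refine Fin.lastCases ?_ (fun j => ?_) i <;> simp

theorem tendsto_snoc_zero (n : ℕ) :
    Tendsto (fun p : (Fin n → ℝ) × ℝ => Fin.snoc (α := fun _ => ℝ) p.1 p.2) (𝓝 0 ×ˢ 𝓝 0)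
      (𝓝 (0 : Fin (n + 1) → ℝ)) := by
  have h : Continuous fun p : (Fin n → ℝ) × ℝ => Fin.snoc (α := fun _ => ℝ) p.1 p.2 := by
    refine continuous_pi fun i => ?_
    refine Fin.lastCases ?_ (fun j => ?_) i
    · simpa using continuous_snd
    · simpa [Function.comp_def] using (continuous_apply j).comp (continuous_fst (Y := ℝ))
  have := h.tendsto (0, 0)
  rwa [nhds_prod_eq, snoc_zero_zero] at this

theorem eventually_snoc {n : ℕ} {p : (Fin (n + 1) → ℝ) → Prop} (h : ∀ᶠ s in 𝓝 0, p s) :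
    ∀ᶠ s in 𝓝 (0 : Fin n → ℝ), ∀ᶠ r in 𝓝 (0 : ℝ), p (Fin.snoc (α := fun _ => ℝ) s r) :=
  ((tendsto_snoc_zero n).eventually h).curry

/-- The inner derivatives are prescribed only near the origin, so functions have to be compared as
germs. This serves uniqueness and allows the generating functionals to be replaced by their
formulas. -/
theorem HasMixedPartial.congr {n : ℕ} {F F' : (Fin n → ℝ) → ℝ} {a : ℝ}
    (h : HasMixedPartial n F a) (hF : F =ᶠ[𝓝 0] F') : HasMixedPartial n F' a := by
  cases n with
  | zero => exact hF.self_of_nhds.symm.trans h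
  | succ n =>
    obtain ⟨G, hG, hGa⟩ := h
    refine ⟨G, ?_, hGa⟩
    filter_upwards [hG, eventually_snoc hF] with s hs hs'
    exact hs.congr_of_eventuallyEq (hs'.mono fun r hr => hr.symm)

theorem HasMixedPartial.unique {n : ℕ} {F : (Fin n → ℝ) → ℝ} {a b : ℝ}
    (ha : HasMixedPartial n F a) (hb : HasMixedPartial n F b) : a = b := by
  induction n with
  | zero => exact ha.symm.trans hb
  | succ n ih =>
    obtain ⟨G, hG, hGa⟩ := ha
    obtain ⟨G', hG', hGb⟩ := hb
    refine ih hGa (hGb.congr ?_)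
    filter_upwards [hG, hG'] with s hs hs'
    exact hs'.unique hs

/-! ### Reduced measures are determined by their pairings -/

theorem IsTestFunction.exists_isWindowed {f : ℝ → ℝ} (hf : IsTestFunction f) :
    ∃ R B : ℝ, 0 ≤ B ∧ IsWindowed R B f := by
  obtain ⟨B, hB⟩ := hf.bounded
  obtain ⟨R, hR⟩ := hf.compact.isBounded.subset_closedBall 0
  refine ⟨R, B, (abs_nonneg _).trans (hB 0), fun x => ?_⟩
  by_cases hx : x ∈ Set.Icc (-R) R
  · rw [Set.indicator_of_mem hx]
    exact hB x
  · rw [Set.indicator_of_notMem hx, image_eq_zero_of_notMem_tsupport (f := f), abs_zero]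
    intro h
    have := hR h
    rw [Real.closedBall_eq_Icc] at this
    exact hx (by simpa using this)

theorem isTestFunction_indicator {A : Set ℝ} (hA : MeasurableSet A) {R : ℝ}
    (hR : A ⊆ Set.Icc (-R) R) : IsTestFunction (A.indicator 1) where
  measurable := measurable_one.indicator hA
  bounded := ⟨1, fun x => by by_cases h : x ∈ A <;> simp [h]⟩
  compact := HasCompactSupport.intro (isCompact_Icc (a := -R) (b := R)) fun x hx =>
    Set.indicator_of_notMem (fun h => hx (hR h)) _

/-- `∏ f_j` evaluated at the points `t`, `t + τ_1`, …, `t + τ_n`. -/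
def shiftedProd {n : ℕ} (f : Fin (n + 1) → ℝ → ℝ) (p : ℝ × (Fin n → ℝ)) : ℝ :=
  f 0 p.1 * ∏ j : Fin n, f j.succ (p.1 + p.2 j)

section
variable {n : ℕ} {f : Fin (n + 1) → ℝ → ℝ} (hf : ∀ j, IsTestFunction (f j))
include hf

theorem measurable_shiftedProd : Measurable (shiftedProd f) := by
  refine ((hf 0).measurable.comp measurable_fst).mul (Finset.measurable_prod _ fun j _ => ?_)
  exact (hf j.succ).measurable.comp
    (measurable_fst.add ((measurable_pi_apply j).comp measurable_snd))

theorem integrable_shiftedProd (μ : Measure (Fin n → ℝ)) [IsFiniteMeasure μ] :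
    Integrable (shiftedProd f) ((volume : Measure ℝ).prod μ) := by
  obtain ⟨R, B, hB, hw⟩ := (hf 0).exists_isWindowed
  choose B' hB' using fun j => (hf j).bounded
  have h1 : Integrable (fun p : ℝ × (Fin n → ℝ) =>
      (Set.Icc (-R) R).indicator (fun _ => B) p.1 * ∏ j : Fin n, B' j.succ)
      ((volume : Measure ℝ).prod μ) := by
    refine Integrable.mul_prod (f := (Set.Icc (-R) R).indicator (fun _ => B))
      (g := fun _ => ∏ j : Fin n, B' j.succ) ?_ (integrable_const _)
    exact (integrable_indicator_iff measurableSet_Icc).2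
      (integrableOn_const measure_Icc_lt_top.ne)
  refine h1.mono' (measurable_shiftedProd hf).aestronglyMeasurable (ae_of_all _ fun p => ?_)
  rw [shiftedProd, norm_mul, Real.norm_eq_abs, norm_prod]
  exact mul_le_mul (hw _) (Finset.prod_le_prod (fun _ _ => norm_nonneg _) fun j _ => hB' _ _)
    (Finset.prod_nonneg fun _ _ => norm_nonneg _) ((abs_nonneg _).trans (hw _))

theorem integrable_shiftedProd_mk (μ : Measure (Fin n → ℝ)) [IsFiniteMeasure μ] (t : ℝ) :
    Integrable (fun τ => shiftedProd f (t, τ)) μ := by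
  choose B' hB' using fun j => (hf j).bounded
  have hm : Measurable fun τ => shiftedProd f (t, τ) :=
    (measurable_shiftedProd hf).comp measurable_prodMk_left
  refine (integrable_const (B' 0 * ∏ j : Fin n, B' j.succ)).mono' hm.aestronglyMeasurable
    (ae_of_all _ fun τ => ?_)
  rw [shiftedProd, norm_mul, Real.norm_eq_abs, norm_prod]
  exact mul_le_mul (hB' _ _) (Finset.prod_le_prod (fun _ _ => norm_nonneg _) fun j _ => hB' _ _)
    (Finset.prod_nonneg fun _ _ => norm_nonneg _) ((abs_nonneg _).trans (hB' 0 0))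

theorem reducedPairing_toSignedMeasure_sub (μ μ' : Measure (Fin n → ℝ)) [IsFiniteMeasure μ]
    [IsFiniteMeasure μ'] :
    reducedPairing (μ.toSignedMeasure - μ'.toSignedMeasure) f =
      ∫ p, shiftedProd f p ∂((volume : Measure ℝ).prod μ) -
        ∫ p, shiftedProd f p ∂((volume : Measure ℝ).prod μ') := by
  have h1 : ∀ t, ∫ᵛ τ, f 0 t * ∏ j : Fin n, f j.succ (t + τ j)
      ∂<•(μ.toSignedMeasure - μ'.toSignedMeasure) =
      ∫ τ, shiftedProd f (t, τ) ∂μ - ∫ τ, shiftedProd f (t, τ) ∂μ' := fun t => by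
    rw [VectorMeasure.integral_sub_vectorMeasure, VectorMeasure.integral_toSignedMeasure,
      VectorMeasure.integral_toSignedMeasure]
    · rfl
    · rw [VectorMeasure.Integrable, Measure.variation_toSignedMeasure]
      exact integrable_shiftedProd_mk hf μ t
    · rw [VectorMeasure.Integrable, Measure.variation_toSignedMeasure]
      exact integrable_shiftedProd_mk hf μ' t
  rw [reducedPairing]
  simp_rw [h1]
  rw [integral_sub (integrable_shiftedProd hf μ).integral_prod_left
    (integrable_shiftedProd hf μ').integral_prod_left, integral_prod _ (integrable_shiftedProd hf μ),
    integral_prod _ (integrable_shiftedProd hf μ')]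

end

theorem shiftedProd_indicator {n : ℕ} (A : Fin (n + 1) → Set ℝ) (p : ℝ × (Fin n → ℝ)) :
    shiftedProd (fun j => (A j).indicator 1) p =
      {p : ℝ × (Fin n → ℝ) | p.1 ∈ A 0 ∧ ∀ j : Fin n, p.1 + p.2 j ∈ A j.succ}.indicator 1 p := by
  classical
  set E := {p : ℝ × (Fin n → ℝ) | p.1 ∈ A 0 ∧ ∀ j : Fin n, p.1 + p.2 j ∈ A j.succ} with hE
  rw [shiftedProd]
  by_cases h0 : p.1 ∈ A 0
  · by_cases h : ∀ j : Fin n, p.1 + p.2 j ∈ A j.succ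
    · have hp : p ∈ E := ⟨h0, h⟩
      rw [Set.indicator_of_mem hp]
      simp [h0, h]
    · have hp : p ∉ E := fun h' => h h'.2
      rw [Set.indicator_of_notMem hp]
      push Not at h
      obtain ⟨j, hj⟩ := h
      rw [Finset.prod_eq_zero (Finset.mem_univ j) (Set.indicator_of_notMem hj _), mul_zero]
  · have hp : p ∉ E := fun h' => h0 h'.1
    rw [Set.indicator_of_notMem hp, Set.indicator_of_notMem h0, zero_mul]

theorem ext_of_pi {n : ℕ} {μ μ' : Measure (Fin n → ℝ)} [IsFiniteMeasure μ] [IsFiniteMeasure μ']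
    (h : ∀ A : Fin n → Set ℝ, (∀ j, MeasurableSet (A j)) →
      μ (Set.univ.pi A) = μ' (Set.univ.pi A)) : μ = μ' := by
  refine ext_of_generate_finite _ generateFrom_pi.symm isPiSystem_pi ?_ ?_
  · rintro _ ⟨A, hA, rfl⟩
    exact h A fun j => hA j (Set.mem_univ j)
  · have := h (fun _ => Set.univ) fun _ => MeasurableSet.univ
    rwa [Set.pi_univ] at this

theorem ext_of_pi_bounded {n : ℕ} {μ μ' : Measure (Fin n → ℝ)} [IsFiniteMeasure μ]
    [IsFiniteMeasure μ']
    (h : ∀ (A : Fin n → Set ℝ) (R : ℝ), (∀ j, MeasurableSet (A j)) →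
      (∀ j, A j ⊆ Set.Icc (-R) R) → μ (Set.univ.pi A) = μ' (Set.univ.pi A)) : μ = μ' := by
  refine ext_of_pi fun A hA => ?_
  have hU : Set.univ.pi A = ⋃ k : ℕ, Set.univ.pi fun j => A j ∩ Set.Icc (-(k : ℝ)) k := by
    ext x
    simp only [Set.mem_pi, Set.mem_univ, true_imp_iff, Set.mem_iUnion, Set.mem_inter_iff]
    refine ⟨fun hx => ?_, fun ⟨k, hk⟩ j => (hk j).1⟩
    obtain ⟨k, hk⟩ := exists_nat_ge (∑ j, |x j|)
    refine ⟨k, fun j => ⟨hx j, abs_le.1 (le_trans ?_ hk)⟩⟩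
    exact Finset.single_le_sum (f := fun j => |x j|) (fun _ _ => abs_nonneg _) (Finset.mem_univ j)
  have hmono : Monotone fun k : ℕ => Set.univ.pi fun j => A j ∩ Set.Icc (-(k : ℝ)) k := by
    intro k l hkl
    have : (k : ℝ) ≤ l := by exact_mod_cast hkl
    exact Set.pi_mono fun j _ => Set.inter_subset_inter_right _
      (Set.Icc_subset_Icc (by linarith) this)
  rw [hU, hmono.measure_iUnion, hmono.measure_iUnion]
  congr 1
  ext1 k
  exact h _ k (fun j => (hA j).inter measurableSet_Icc) fun j => Set.inter_subset_right

/-- The shear `(t, τ) ↦ (t, t + τ)` turns pairings of indicators into values on rectangles with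
bounded sides, which determine a finite measure. Undoing the shear and forgetting `t` returns `μ`.
-/
theorem eq_of_integral_shiftedProd_eq {n : ℕ} {μ μ' : Measure (Fin n → ℝ)} [IsFiniteMeasure μ]
    [IsFiniteMeasure μ']
    (h : ∀ f : Fin (n + 1) → ℝ → ℝ, (∀ j, IsTestFunction (f j)) →
      ∫ p, shiftedProd f p ∂((volume : Measure ℝ).prod μ) =
        ∫ p, shiftedProd f p ∂((volume : Measure ℝ).prod μ')) : μ = μ' := by
  -- Restricting `t` to an interval of length one makes the product finite, with `μ` itself as
  -- second marginal.
  set I : Measure ℝ := (volume : Measure ℝ).restrict (Set.Icc 0 1) with hI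
  have hprob : IsProbabilityMeasure I := ⟨by simp [hI]⟩
  have hS : Measurable fun p : ℝ × (Fin n → ℝ) => (p.1, fun j => p.1 + p.2 j) := by fun_prop
  have hD : Measurable fun p : ℝ × (Fin n → ℝ) => fun j => p.2 j - p.1 := by fun_prop
  have key : (I.prod μ).map (fun p => (p.1, fun j => p.1 + p.2 j)) =
      (I.prod μ').map (fun p => (p.1, fun j => p.1 + p.2 j)) := by
    refine Measure.ext_prod fun {s t} hs ht => ?_
    have hc : ∀ (ρ : Measure (ℝ × (Fin n → ℝ))) {t : Set (Fin n → ℝ)}, MeasurableSet t →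
        ρ (s ×ˢ t) = ((ρ.restrict (s ×ˢ Set.univ)).map Prod.snd) t := fun ρ t ht => by
      rw [Measure.map_apply measurable_snd ht, Measure.restrict_apply (measurable_snd ht)]
      congr 1
      ext p
      simp [and_comm]
    rw [hc _ ht, hc _ ht]
    congr 1
    refine ext_of_pi_bounded fun A R hA hR => ?_
    rw [← hc _ (MeasurableSet.univ_pi hA), ← hc _ (MeasurableSet.univ_pi hA)]
    have hm : MeasurableSet (s ×ˢ Set.univ.pi A) :=
      hs.prod (MeasurableSet.univ_pi hA)
    rw [Measure.map_apply hS hm, Measure.map_apply hS hm]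
    set A' : Fin (n + 1) → Set ℝ := Fin.cons (s ∩ Set.Icc 0 1) A with hA'
    have hA'm : ∀ j, MeasurableSet (A' j) :=
      Fin.cases (hs.inter measurableSet_Icc) fun j => hA j
    have hA'R : ∀ j, A' j ⊆ Set.Icc (-(max R 1)) (max R 1) := by
      refine Fin.cases ?_ fun j => ?_
      · refine Set.inter_subset_right.trans (Set.Icc_subset_Icc ?_ (le_max_right _ _))
        have := le_max_right R 1
        linarith
      · refine (hR j).trans (Set.Icc_subset_Icc ?_ (le_max_left _ _))
        have := le_max_left R 1
        linarith
    have h' := h (fun j => (A' j).indicator 1) fun j => isTestFunction_indicator (hA'm j) (hA'R j)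
    simp_rw [shiftedProd_indicator] at h'
    have hE : MeasurableSet
        {p : ℝ × (Fin n → ℝ) | p.1 ∈ A' 0 ∧ ∀ j : Fin n, p.1 + p.2 j ∈ A' j.succ} := by
      have h1 : {p : ℝ × (Fin n → ℝ) | p.1 ∈ A' 0 ∧ ∀ j : Fin n, p.1 + p.2 j ∈ A' j.succ} =
          Prod.fst ⁻¹' A' 0 ∩ ⋂ j : Fin n, (fun p : ℝ × (Fin n → ℝ) => p.1 + p.2 j) ⁻¹' A' j.succ := by
        ext p; simp
      rw [h1]
      refine (measurable_fst (hA'm 0)).inter (MeasurableSet.iInter fun j => ?_)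
      have h2 : Measurable fun p : ℝ × (Fin n → ℝ) => p.1 + p.2 j := by fun_prop
      exact h2 (hA'm j.succ)
    rw [integral_indicator_one hE, integral_indicator_one hE] at h'
    have hpre : ∀ (μ : Measure (Fin n → ℝ)) [IsFiniteMeasure μ],
        (I.prod μ) ((fun p : ℝ × (Fin n → ℝ) => (p.1, fun j => p.1 + p.2 j)) ⁻¹'
          (s ×ˢ Set.univ.pi A)) = ((volume : Measure ℝ).prod μ)
        {p : ℝ × (Fin n → ℝ) | p.1 ∈ A' 0 ∧ ∀ j : Fin n, p.1 + p.2 j ∈ A' j.succ} := by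
      intro μ _
      have h1 : I.prod μ = ((volume : Measure ℝ).prod μ).restrict (Set.Icc 0 1 ×ˢ Set.univ) := by
        rw [hI, ← Measure.prod_restrict, Measure.restrict_univ]
      rw [h1, Measure.restrict_apply (hS hm)]
      congr 1
      ext p
      simp only [hA', Set.mem_inter_iff, Set.mem_preimage, Set.mem_prod, Set.mem_pi, Set.mem_univ,
        true_imp_iff, and_true, Set.mem_ofPred_eq, Fin.cons_zero, Fin.cons_succ]
      tauto
    have hfin : ∀ (μ : Measure (Fin n → ℝ)) [IsFiniteMeasure μ], ((volume : Measure ℝ).prod μ)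
        {p : ℝ × (Fin n → ℝ) | p.1 ∈ A' 0 ∧ ∀ j : Fin n, p.1 + p.2 j ∈ A' j.succ} ≠ ∞ := by
      intro μ _
      rw [← hpre]
      exact measure_ne_top _ _
    rw [hpre, hpre]
    exact (measureReal_eq_measureReal_iff (hfin μ) (hfin μ')).1 h'
  have hback : ∀ (μ : Measure (Fin n → ℝ)) [IsFiniteMeasure μ],
      ((I.prod μ).map (fun p => (p.1, fun j => p.1 + p.2 j))).map
        (fun p : ℝ × (Fin n → ℝ) => fun j => p.2 j - p.1) = μ := by
    intro μ _
    rw [Measure.map_map hD hS]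
    have : (fun p : ℝ × (Fin n → ℝ) => fun j => p.2 j - p.1) ∘
        (fun p => (p.1, fun j => p.1 + p.2 j)) = Prod.snd := by
      ext p j; simp
    rw [this, ← Measure.snd, Measure.snd_prod]
  rw [← hback μ, ← hback μ', key]

/-- A finite signed measure is determined by its pairings. -/
theorem eq_of_reducedPairing_eq {n : ℕ} {M M' : SignedMeasure (Fin n → ℝ)}
    (h : ∀ f : Fin (n + 1) → ℝ → ℝ, (∀ j, IsTestFunction (f j)) →
      reducedPairing M f = reducedPairing M' f) : M = M' := by
  set p := M.toJordanDecomposition.posPart with hp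
  set q := M.toJordanDecomposition.negPart with hq
  set p' := M'.toJordanDecomposition.posPart with hp'
  set q' := M'.toJordanDecomposition.negPart with hq'
  have hM : M = p.toSignedMeasure - q.toSignedMeasure :=
    M.toSignedMeasure_toJordanDecomposition.symm
  have hM' : M' = p'.toSignedMeasure - q'.toSignedMeasure :=
    M'.toSignedMeasure_toJordanDecomposition.symm
  -- Moving the negative parts across reduces the claim to positive finite measures.
  have key : p + q' = p' + q := by
    refine eq_of_integral_shiftedProd_eq fun f hf => ?_
    have h1 := h f hf
    rw [hM, hM', reducedPairing_toSignedMeasure_sub hf, reducedPairing_toSignedMeasure_sub hf] at h1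
    rw [Measure.prod_add, Measure.prod_add, integral_add_measure, integral_add_measure]
    · linarith
    all_goals exact integrable_shiftedProd hf _
  have key' : p.toSignedMeasure + q'.toSignedMeasure = p'.toSignedMeasure + q.toSignedMeasure := by
    rw [← Measure.toSignedMeasure_add, ← Measure.toSignedMeasure_add]
    exact Measure.toSignedMeasure_congr key
  rw [hM, hM', sub_eq_sub_iff_add_eq_add, key']

section
variable {Ω : Type*} [MeasurableSpace Ω] {P : Measure Ω} {N : Ω → Measure ℝ} {n : ℕ}
  {M M' : SignedMeasure (Fin n → ℝ)}

theorem IsReducedCompleteCumulant.unique (h : IsReducedCompleteCumulant P N M)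
    (h' : IsReducedCompleteCumulant P N M') : M = M' :=
  eq_of_reducedPairing_eq fun f hf => (h f hf).2.unique (h' f hf).2

theorem IsReducedFactorialCumulant.unique (h : IsReducedFactorialCumulant P N M)
    (h' : IsReducedFactorialCumulant P N M') : M = M' :=
  eq_of_reducedPairing_eq fun f hf => (h f hf).2.unique (h' f hf).2

end
end
end BranchingCluster

namespace BranchingCluster
noncomputable section
open scoped ENNReal NNReal

/-! ### Differentiation of the cumulant generating functionals -/

theorem one_le_size (e : Marks) : 1 ≤ size e := by
  classical
  rw [size_eq_progeny, progeny]
  refine le_trans ?_ (ENNReal.le_tsum ([] : List ℕ))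
  simp [IsBorn]

theorem shot_eq_sum {e : Marks} (he : size e ≠ ∞) : ∃ s : Finset (List ℕ),
    (∀ v, v ∈ s ↔ IsBorn (fun v => (e v).1) v) ∧
    ∀ u f, shot f (u, e) = ∑ v ∈ s, f (position (fun v => (e v).2) v + u) := by
  obtain ⟨s, hs, hs'⟩ := exists_finset_placed_eq he
  refine ⟨s, hs, fun u f => ?_⟩
  rw [shot, hs', integral_finsetSum_measure fun v _ => integrable_dirac (by simp)]
  simp

/-- For a finite cluster `shot` is a finite sum, so no domination is needed at this level. -/
theorem hasDerivAt_shot {p : ℝ × Marks} (hp : size p.2 ≠ ∞) {φ : ℝ → ℝ → ℝ} {φ' : ℝ → ℝ} {r : ℝ}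
    (h : ∀ x, HasDerivAt (fun r => φ r x) (φ' x) r) :
    HasDerivAt (fun r => shot (φ r) p) (shot φ' p) r := by
  obtain ⟨s, -, hs⟩ := shot_eq_sum hp
  have hs' : ∀ f, shot f p = _ := hs p.1
  simp_rw [hs']
  exact HasDerivAt.fun_sum fun v _ => h _

theorem shot_const_mul (a : ℝ) (f : ℝ → ℝ) (p : ℝ × Marks) :
    shot (fun x => a * f x) p = a * shot f p := integral_const_mul _ _

theorem IsWindowed.mul {R B B' : ℝ} {f g : ℝ → ℝ} (hB' : 0 ≤ B') (hf : IsWindowed R B f)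
    (hg : ∀ x, |g x| ≤ B') : IsWindowed R (B' * B) fun x => g x * f x := fun x => by
  rw [abs_mul]
  refine (mul_le_mul (hg x) (hf x) (abs_nonneg _) hB').trans (le_of_eq ?_)
  by_cases hx : x ∈ Set.Icc (-R) R
  · rw [Set.indicator_of_mem hx, Set.indicator_of_mem hx]
  · rw [Set.indicator_of_notMem hx, Set.indicator_of_notMem hx, mul_zero]

theorem IsWindowed.mono {R B B' : ℝ} {f : ℝ → ℝ} (hf : IsWindowed R B f) (h : B ≤ B') :
    IsWindowed R B' f := fun x => (hf x).trans (Set.indicator_le_indicator h)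

theorem IsWindowed.add_mul {R B β r : ℝ} {q f : ℝ → ℝ} (hq : IsWindowed R β q)
    (hf : IsWindowed R B f) : IsWindowed R (β + |r| * B) fun x => q x + r * f x := fun x => by
  refine (abs_add_le _ _).trans ?_
  rw [abs_mul]
  refine (add_le_add (hq x) (mul_le_mul_of_nonneg_left (hf x) (abs_nonneg r))).trans (le_of_eq ?_)
  by_cases hx : x ∈ Set.Icc (-R) R
  · simp only [Set.indicator_of_mem hx]
  · simp only [Set.indicator_of_notMem hx, mul_zero, add_zero]

/-- `ψ 0` is a function near the origin with iterated derivatives `ψ 1`, `ψ 2`, `ψ 3`. -/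
structure IsGenerator (ψ : ℕ → ℝ → ℝ) (C : ℝ) : Prop where
  measurable : ∀ k, Measurable (ψ k)
  one_le : 1 ≤ C
  abs_le_two_mul : ∀ y, |y| < 1 / 2 → |ψ 0 y| ≤ 2 * |y|
  abs_le : ∀ k < 3, ∀ y, |y| < 1 / 2 → |ψ (k + 1) y| ≤ C
  hasDerivAt : ∀ k < 3, ∀ y, |y| < 1 / 2 → HasDerivAt (ψ k) (ψ (k + 1) y) y

section
variable {ψ : ℕ → ℝ → ℝ} {C : ℝ} (hψ : IsGenerator ψ C)
include hψ

theorem IsGenerator.isWindowed_zero {R β : ℝ} {q : ℝ → ℝ} (hβ0 : 0 ≤ β) (hβ : β < 1 / 2)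
    (hq : IsWindowed R β q) : IsWindowed R (2 * β) fun x => ψ 0 (q x) := fun x => by
  have h1 := hq.abs_le hβ0 x
  refine (hψ.abs_le_two_mul _ (h1.trans_lt hβ)).trans ?_
  have h2 := mul_le_mul_of_nonneg_left (hq x) (zero_le_two (α := ℝ))
  refine h2.trans (le_of_eq ?_)
  by_cases hx : x ∈ Set.Icc (-R) R
  · simp only [Set.indicator_of_mem hx]
  · simp only [Set.indicator_of_notMem hx, mul_zero]

theorem IsGenerator.isWindowed_succ {R β B : ℝ} {q f : ℝ → ℝ} {k : ℕ} (hk : k < 3) (hβ0 : 0 ≤ β)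
    (hβ : β < 1 / 2) (hq : IsWindowed R β q) (hf : IsWindowed R B f) :
    IsWindowed R (C * B) fun x => ψ (k + 1) (q x) * f x :=
  hf.mul (zero_le_one.trans hψ.one_le) fun x =>
    hψ.abs_le k hk _ ((hq.abs_le hβ0 x).trans_lt hβ)

end

/-- The dominating functions of the integrands. -/
def majorant (R b : ℝ) (p : ℝ × Marks) : ℝ :=
  window R p * ((size p.2).toReal ^ 2 * Real.exp (b * (size p.2).toReal))

section
variable {c : ℝ≥0∞} {r : ℝ≥0} {d : Measure ℝ} [IsProbabilityMeasure d] {θ : ℝ}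
  (hc : c ≠ ∞) (hexp : Integrable (fun e => Real.exp (θ * (size e).toReal)) (marksLaw r d))
  (hfin : ∀ᵐ e ∂(marksLaw r d), size e < ∞)
include hc hexp hfin

theorem integrable_of_abs_le_majorant {W : ℝ × Marks → ℝ} (hW : Measurable W) {R b A : ℝ}
    (hb : b < θ) (h : ∀ p : ℝ × Marks, size p.2 ≠ ∞ → |W p| ≤ A * majorant R b p) :
    Integrable W (placedLaw c r d) := by
  refine ((integrable_window_mul_exp hc hexp hfin R 2 hb).const_mul A).mono'
    hW.aestronglyMeasurable ?_
  filter_upwards [ae_placedLaw (c := c) hfin] with p hp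
  exact h p hp.ne

theorem hasDerivAt_integral_of_abs_le_majorant {W W' : ℝ → ℝ × Marks → ℝ} {ε R b A : ℝ}
    (hε : 0 < ε) (hb : b < θ) (hW : ∀ t, Measurable (W t)) (hW' : Measurable (W' 0))
    (h0 : Integrable (W 0) (placedLaw c r d))
    (hd : ∀ p : ℝ × Marks, size p.2 ≠ ∞ → ∀ t, |t| < ε → HasDerivAt (fun t => W t p) (W' t p) t)
    (h : ∀ p : ℝ × Marks, size p.2 ≠ ∞ → ∀ t, |t| < ε → |W' t p| ≤ A * majorant R b p) :
    HasDerivAt (fun t => ∫ p, W t p ∂(placedLaw c r d)) (∫ p, W' 0 p ∂(placedLaw c r d)) 0 := by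
  have hs : Metric.ball (0 : ℝ) ε ∈ 𝓝 (0 : ℝ) := Metric.ball_mem_nhds _ hε
  have hmem : ∀ t ∈ Metric.ball (0 : ℝ) ε, |t| < ε := fun t ht => by
    simpa [Real.dist_eq] using ht
  refine (hasDerivAt_integral_of_dominated_loc_of_deriv_le (F := W) (F' := W')
    (bound := fun p => A * majorant R b p) hs
    (Eventually.of_forall fun t => (hW t).aestronglyMeasurable) h0 hW'.aestronglyMeasurable
    ?_ ((integrable_window_mul_exp hc hexp hfin R 2 hb).const_mul A) ?_).2
  · filter_upwards [ae_placedLaw (c := c) hfin] with p hp t ht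
    exact h p hp.ne t (hmem t ht)
  · filter_upwards [ae_placedLaw (c := c) hfin] with p hp t ht
    exact hd p hp.ne t (hmem t ht)

end

/-- Derivatives up to order three are products of at most three shots: one is bounded by `window R`,
the others by the size. This explains the square of the size in `majorant`, which serves all three
orders. -/
theorem abs_mul_exp_le {R b B a X : ℝ} {p : ℝ × Marks} (hp : size p.2 ≠ ∞) {f : ℝ → ℝ}
    (hB : 0 ≤ B) (hf : IsWindowed R b f) (hb : 0 ≤ b) (hX : |X| ≤ B * (window R p * a))
    (ha : a ≤ (size p.2).toReal ^ 2) : |Real.exp (shot f p) * X| ≤ B * majorant R b p := by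
  have h1 := (le_abs_self _).trans (hf.abs_shot_le_size hb hp)
  have h2 := window_nonneg R p
  rw [abs_mul, abs_of_pos (Real.exp_pos _)]
  calc Real.exp (shot f p) * |X|
      ≤ Real.exp (b * (size p.2).toReal) * (B * (window R p * (size p.2).toReal ^ 2)) := by
        refine mul_le_mul (Real.exp_le_exp.2 h1) (hX.trans ?_) (abs_nonneg _) (Real.exp_pos _).le
        gcongr
    _ = B * majorant R b p := by rw [majorant]; ring

section
variable (ψ : ℕ → ℝ → ℝ) (q f g h : ℝ → ℝ) (p : ℝ × Marks)

/-- The integral of `ψ_k (q) f` with respect to a placed cluster. -/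
def dshot (k : ℕ) : ℝ := shot (fun x => ψ k (q x) * f x) p

/-- The first derivative of the exponential functional, without its exponential factor. -/
def bellOne : ℝ := dshot ψ q f p 1

/-- The second derivative of the exponential functional, without its exponential factor. -/
def bellTwo : ℝ := dshot ψ q f p 1 * dshot ψ q g p 1 + dshot ψ q (fun x => f x * g x) p 2

/-- The third derivative of the exponential functional, without its exponential factor. -/
def bellThree : ℝ :=
  dshot ψ q f p 1 * bellTwo ψ q g h p +
    (dshot ψ q (fun x => f x * g x) p 2 * dshot ψ q h p 1 +
      dshot ψ q g p 1 * dshot ψ q (fun x => f x * h x) p 2 +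
      dshot ψ q (fun x => f x * (g x * h x)) p 3)

end

section
variable {ψ : ℕ → ℝ → ℝ} {C : ℝ} (hψ : IsGenerator ψ C)
include hψ

theorem measurable_dshot {q f : ℝ → ℝ} (hq : Measurable q) (hf : Measurable f) (k : ℕ) :
    Measurable fun p => dshot ψ q f p k :=
  measurable_shot (((hψ.measurable k).comp hq).mul hf)

theorem measurable_exp_shot {q : ℝ → ℝ} (hq : Measurable q) :
    Measurable fun p => Real.exp (shot (fun x => ψ 0 (q x)) p) :=
  (measurable_shot ((hψ.measurable 0).comp hq)).exp

variable {R β B : ℝ} {q f g h : ℝ → ℝ} (hβ0 : 0 ≤ β) (hβ : β < 1 / 2) (hq : IsWindowed R β q)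
include hβ0 hβ hq

theorem abs_dshot_le {k : ℕ} (hk : k < 3) (hf : IsWindowed R B f) {p : ℝ × Marks}
    (hp : size p.2 ≠ ∞) : |dshot ψ q f p (k + 1)| ≤ C * B * window R p :=
  abs_shot_le (hψ.isWindowed_succ hk hβ0 hβ hq hf) hp

theorem abs_dshot_le_size (hB : 0 ≤ B) {k : ℕ} (hk : k < 3) (hf : IsWindowed R B f)
    {p : ℝ × Marks} (hp : size p.2 ≠ ∞) :
    |dshot ψ q f p (k + 1)| ≤ C * B * (size p.2).toReal :=
  (hψ.isWindowed_succ hk hβ0 hβ hq hf).abs_shot_le_size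
    (mul_nonneg (zero_le_one.trans hψ.one_le) hB) hp

omit hβ0 hβ hq in
theorem hasDerivAt_dshot {k : ℕ} (hk : k < 3) {p : ℝ × Marks} (hp : size p.2 ≠ ∞) {r : ℝ}
    (hr : ∀ x, |q x + r * f x| < 1 / 2) :
    HasDerivAt (fun r => dshot ψ (fun x => q x + r * f x) g p k)
      (dshot ψ (fun x => q x + r * f x) (fun x => f x * g x) p (k + 1)) r := by
  refine hasDerivAt_shot hp fun x => ?_
  have h1 : HasDerivAt (fun r => q x + r * f x) (f x) r := by
    simpa using ((hasDerivAt_id r).mul_const (f x)).const_add (q x)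
  have h2 := ((hψ.hasDerivAt k hk _ (hr x)).comp r h1).mul_const (g x)
  rw [mul_assoc] at h2
  exact h2

omit hβ0 hβ hq in
theorem hasDerivAt_exp_shot {p : ℝ × Marks} (hp : size p.2 ≠ ∞) {r : ℝ}
    (hr : ∀ x, |q x + r * f x| < 1 / 2) :
    HasDerivAt (fun r => Real.exp (shot (fun x => ψ 0 (q x + r * f x)) p))
      (Real.exp (shot (fun x => ψ 0 (q x + r * f x)) p) *
        dshot ψ (fun x => q x + r * f x) f p 1) r := by
  refine (hasDerivAt_shot hp fun x => ?_).exp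
  have h1 : HasDerivAt (fun r => q x + r * f x) (f x) r := by
    simpa using ((hasDerivAt_id r).mul_const (f x)).const_add (q x)
  exact (hψ.hasDerivAt 0 (by norm_num) _ (hr x)).comp r h1

end

end
end BranchingCluster

/-! ### Bounds on the derivatives and differentiation under the integral -/

namespace BranchingCluster
noncomputable section
open scoped ENNReal NNReal

theorem one_le_toReal_size {p : ℝ × Marks} (hp : size p.2 ≠ ∞) : 1 ≤ (size p.2).toReal := by
  simpa using ENNReal.toReal_mono hp (one_le_size p.2)

theorem IsWindowed.mul_windowed {R B B' : ℝ} {f g : ℝ → ℝ} (hB' : 0 ≤ B') (hg : IsWindowed R B' g)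
    (hf : IsWindowed R B f) : IsWindowed R (B' * B) fun x => g x * f x :=
  hf.mul hB' fun x => hg.abs_le hB' x

section
variable {ψ : ℕ → ℝ → ℝ} {C : ℝ} (hψ : IsGenerator ψ C) {R β B : ℝ} {q f g h : ℝ → ℝ}
include hψ

section
variable (hβ0 : 0 ≤ β) (hβ : β < 1 / 2) (hq : IsWindowed R β q) (hB : 0 ≤ B)
  (hf : IsWindowed R B f) (hg : IsWindowed R B g) (hh : IsWindowed R B h)
include hβ0 hβ hq hf

theorem abs_bellOne_le {p : ℝ × Marks} (hp : size p.2 ≠ ∞) :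
    |bellOne ψ q f p| ≤ C * B * (window R p * 1) := by
  rw [mul_one]
  exact abs_dshot_le hψ hβ0 hβ hq (by norm_num) hf hp

include hB hg

/-- The factor `2` counts the set partitions of two test functions, one for each term of `bellTwo`;
`1 ≤ C` and `1 ≤ size` bring both terms to a common bound. -/
theorem abs_bellTwo_le {p : ℝ × Marks} (hp : size p.2 ≠ ∞) :
    |bellTwo ψ q f g p| ≤ 2 * (C * B) ^ 2 * (window R p * (size p.2).toReal) := by
  have hC := hψ.one_le
  have hw := window_nonneg R p
  have hz := one_le_toReal_size hp
  have h1 := abs_dshot_le hψ hβ0 hβ hq (k := 0) (by norm_num) hf hp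
  have h2 := abs_dshot_le_size hψ hβ0 hβ hq hB (k := 0) (by norm_num) hg hp
  have h3 := abs_dshot_le hψ hβ0 hβ hq (k := 1) (by norm_num) (hf.mul_windowed hB hg) hp
  have h4 : |dshot ψ q f p 1 * dshot ψ q g p 1| ≤
      C * B * window R p * (C * B * (size p.2).toReal) := by
    rw [abs_mul]
    exact mul_le_mul h1 h2 (abs_nonneg _) (by positivity)
  have h5 : C * (B * B) * window R p ≤ (C * B) ^ 2 * (window R p * (size p.2).toReal) := by
    have : C * (B * B) ≤ (C * B) ^ 2 := by nlinarith [mul_nonneg hB hB]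
    exact mul_le_mul this (le_mul_of_one_le_right hw hz) hw (by positivity)
  refine (abs_add_le _ _).trans ((add_le_add h4 (h3.trans h5)).trans (le_of_eq ?_))
  ring

include hh

/-- The factor `5` counts the set partitions of three test functions, by Faà di Bruno; in each term
one shot is bounded by the window and the remaining ones by the size. -/
theorem abs_bellThree_le {p : ℝ × Marks} (hp : size p.2 ≠ ∞) :
    |bellThree ψ q f g h p| ≤ 5 * (C * B) ^ 3 * (window R p * (size p.2).toReal ^ 2) := by
  have hC := hψ.one_le
  have hw := window_nonneg R p
  have hz := one_le_toReal_size hp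
  have hwz := window_le_size (R := R) hp
  have hff := hf.mul_windowed hB hg
  have hfh := hf.mul_windowed hB hh
  have hCB : 0 ≤ C * B := by positivity
  have hBB : 0 ≤ B * B := by positivity
  set w := window R p
  set z := (size p.2).toReal
  have h1 : |dshot ψ q f p 1| ≤ C * B * z :=
    abs_dshot_le_size hψ hβ0 hβ hq hB (k := 0) (by norm_num) hf hp
  have h2 := abs_bellTwo_le hψ hβ0 hβ hq hB hg hh hp
  have h3 : |dshot ψ q (fun x => f x * g x) p 2| ≤ C * (B * B) * w :=
    abs_dshot_le hψ hβ0 hβ hq (k := 1) (by norm_num) hff hp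
  have h4 : |dshot ψ q h p 1| ≤ C * B * z :=
    abs_dshot_le_size hψ hβ0 hβ hq hB (k := 0) (by norm_num) hh hp
  have h5 : |dshot ψ q g p 1| ≤ C * B * z :=
    abs_dshot_le_size hψ hβ0 hβ hq hB (k := 0) (by norm_num) hg hp
  have h6 : |dshot ψ q (fun x => f x * h x) p 2| ≤ C * (B * B) * w :=
    abs_dshot_le hψ hβ0 hβ hq (k := 1) (by norm_num) hfh hp
  have h7 : |dshot ψ q (fun x => f x * (g x * h x)) p 3| ≤ C * (B * (B * B)) * w :=
    abs_dshot_le hψ hβ0 hβ hq (k := 2) (by norm_num)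
      (hf.mul_windowed hB (hg.mul_windowed hB hh)) hp
  have hz2 : z ≤ z ^ 2 := by nlinarith
  have hC2 : C * (B * B) ≤ (C * B) ^ 2 := by nlinarith
  have hC3 : C * (B * (B * B)) ≤ (C * B) ^ 3 := by
    have h : C ≤ C ^ 3 := by nlinarith [mul_nonneg (sub_nonneg.2 hC) (sub_nonneg.2 hC)]
    calc C * (B * (B * B)) = C * B ^ 3 := by ring
      _ ≤ C ^ 3 * B ^ 3 := by gcongr
      _ = _ := by ring
  have k1 : |dshot ψ q f p 1 * bellTwo ψ q g h p| ≤ 2 * (C * B) ^ 3 * (w * z ^ 2) := by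
    rw [abs_mul]
    refine (mul_le_mul h1 h2 (abs_nonneg _) (by positivity)).trans (le_of_eq (by ring))
  have k2 : |dshot ψ q (fun x => f x * g x) p 2 * dshot ψ q h p 1| ≤
      (C * B) ^ 3 * (w * z ^ 2) := by
    rw [abs_mul]
    refine (mul_le_mul h3 h4 (abs_nonneg _) (by positivity)).trans ?_
    calc C * (B * B) * w * (C * B * z) = C * (B * B) * (C * B) * (w * z) := by ring
      _ ≤ (C * B) ^ 2 * (C * B) * (w * z ^ 2) := by gcongr
      _ = _ := by ring
  have k3 : |dshot ψ q g p 1 * dshot ψ q (fun x => f x * h x) p 2| ≤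
      (C * B) ^ 3 * (w * z ^ 2) := by
    rw [abs_mul]
    refine (mul_le_mul h5 h6 (abs_nonneg _) (by positivity)).trans ?_
    calc C * B * z * (C * (B * B) * w) = C * (B * B) * (C * B) * (w * z) := by ring
      _ ≤ (C * B) ^ 2 * (C * B) * (w * z ^ 2) := by gcongr
      _ = _ := by ring
  have k4 : |dshot ψ q (fun x => f x * (g x * h x)) p 3| ≤ (C * B) ^ 3 * (w * z ^ 2) := by
    refine h7.trans (mul_le_mul hC3 (le_mul_of_one_le_right hw ?_) hw (by positivity))
    nlinarith
  refine (abs_add_le _ _).trans ((add_le_add k1 ((abs_add_le _ _).trans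
    (add_le_add ((abs_add_le _ _).trans (add_le_add k2 k3)) k4))).trans (le_of_eq ?_))
  ring

end

section
variable {c : ℝ≥0∞} {r : ℝ≥0} {d : Measure ℝ} [IsProbabilityMeasure d] {θ : ℝ} {β' : ℝ}
  (hc : c ≠ ∞) (hexp : Integrable (fun e => Real.exp (θ * (size e).toReal)) (marksLaw r d))
  (hfin : ∀ᵐ e ∂(marksLaw r d), size e < ∞)
  (hβ0 : 0 ≤ β) (hβ : β < β') (hβ' : β' < 1 / 2) (hβθ : 2 * β' < θ) (hB : 0 ≤ B)
  (hqm : Measurable q) (hfm : Measurable f) (hgm : Measurable g) (hhm : Measurable h)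
  (hq : IsWindowed R β q) (hf : IsWindowed R B f) (hg : IsWindowed R B g) (hh : IsWindowed R B h)
include hβ hB hq hf

omit hψ hβ in
theorem isWindowed_add_mul {t : ℝ} (ht : |t| < (β' - β) / (B + 1)) :
    IsWindowed R β' fun x => q x + t * f x := by
  refine (hq.add_mul hf).mono ?_
  rw [lt_div_iff₀ (by positivity)] at ht
  nlinarith [abs_nonneg t]

include hc hexp hfin hβ0 hβ' hβθ hqm hfm

/-- Domination is required for `t` near `0`, not only at `0`: the gap `β' - β` leaves room for `t *
f`. A generator at most doubles its argument, whence the condition `2 * β' < θ`. -/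
theorem hasDerivAt_integral_exp_shot :
    HasDerivAt (fun t => ∫ p, (Real.exp (shot (fun x => ψ 0 (q x + t * f x)) p) - 1)
        ∂(placedLaw c r d))
      (∫ p, Real.exp (shot (fun x => ψ 0 (q x)) p) * bellOne ψ q f p ∂(placedLaw c r d)) 0 := by
  have hβ'0 : 0 ≤ β' := hβ0.trans hβ.le
  have hε : 0 < (β' - β) / (B + 1) := div_pos (sub_pos.2 hβ) (by positivity)
  have hw := fun {t} ht => isWindowed_add_mul (β' := β') (t := t) hB hq hf ht
  have hm : ∀ t : ℝ, Measurable fun x => q x + t * f x := fun t => hqm.add (hfm.const_mul t)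
  have key := hasDerivAt_integral_of_abs_le_majorant hc hexp hfin (R := R) (b := 2 * β')
    (A := C * B) hε hβθ
    (W := fun t p => Real.exp (shot (fun x => ψ 0 (q x + t * f x)) p) - 1)
    (W' := fun t p => Real.exp (shot (fun x => ψ 0 (q x + t * f x)) p) *
      bellOne ψ (fun x => q x + t * f x) f p)
    (fun t => (measurable_exp_shot hψ (hm t)).sub_const 1)
    ((measurable_exp_shot hψ (hm 0)).mul (measurable_dshot hψ (hm 0) hfm 1)) ?_ ?_ ?_
  · simpa using key
  · have h0 := hψ.isWindowed_zero hβ'0 hβ' (hw (t := 0) (by simpa using hε))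
    refine (integrable_exp_abs_shot_sub_one hc hexp hfin ((hψ.measurable 0).comp (hm 0)) h0
      (by positivity) hβθ).mono'
      ((measurable_exp_shot hψ (hm 0)).sub_const 1).aestronglyMeasurable
      (ae_of_all _ fun p => abs_exp_sub_one_le_of_abs_le le_rfl)
  · intro p hp t ht
    exact (hasDerivAt_exp_shot hψ hp fun x => ((hw ht).abs_le hβ'0 x).trans_lt hβ').sub_const 1
  · intro p hp t ht
    have hz := one_le_toReal_size hp
    exact abs_mul_exp_le hp (by have := hψ.one_le; positivity)
      (hψ.isWindowed_zero hβ'0 hβ' (hw ht)) (by positivity)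
      (abs_bellOne_le hψ hβ'0 hβ' (hw ht) hf hp) (by nlinarith)

include hgm hg

theorem hasDerivAt_integral_bellOne :
    HasDerivAt (fun t => ∫ p, Real.exp (shot (fun x => ψ 0 (q x + t * f x)) p) *
        bellOne ψ (fun x => q x + t * f x) g p ∂(placedLaw c r d))
      (∫ p, Real.exp (shot (fun x => ψ 0 (q x)) p) * bellTwo ψ q f g p ∂(placedLaw c r d)) 0 := by
  have hβ'0 : 0 ≤ β' := hβ0.trans hβ.le
  have hε : 0 < (β' - β) / (B + 1) := div_pos (sub_pos.2 hβ) (by positivity)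
  have hw := fun {t} ht => isWindowed_add_mul (β' := β') (t := t) hB hq hf ht
  have hm : ∀ t : ℝ, Measurable fun x => q x + t * f x := fun t => hqm.add (hfm.const_mul t)
  have hC := hψ.one_le
  have hmW : ∀ t, Measurable fun p => Real.exp (shot (fun x => ψ 0 (q x + t * f x)) p) *
      bellOne ψ (fun x => q x + t * f x) g p := fun t =>
    (measurable_exp_shot hψ (hm t)).mul (measurable_dshot hψ (hm t) hgm 1)
  have key := hasDerivAt_integral_of_abs_le_majorant hc hexp hfin (R := R) (b := 2 * β')
    (A := 2 * (C * B) ^ 2) hε hβθ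
    (W := fun t p => Real.exp (shot (fun x => ψ 0 (q x + t * f x)) p) *
      bellOne ψ (fun x => q x + t * f x) g p)
    (W' := fun t p => Real.exp (shot (fun x => ψ 0 (q x + t * f x)) p) *
      bellTwo ψ (fun x => q x + t * f x) f g p) hmW
    ((measurable_exp_shot hψ (hm 0)).mul (((measurable_dshot hψ (hm 0) hfm 1).mul
      (measurable_dshot hψ (hm 0) hgm 1)).add (measurable_dshot hψ (hm 0) (hfm.mul hgm) 2))) ?_ ?_ ?_
  · simpa using key
  · refine integrable_of_abs_le_majorant hc hexp hfin (hmW 0) (R := R) (A := C * B) hβθ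
      fun p hp => ?_
    have hz := one_le_toReal_size hp
    have h0 := hw (t := 0) (by simpa using hε)
    exact abs_mul_exp_le hp (by positivity) (hψ.isWindowed_zero hβ'0 hβ' h0) (by positivity)
      (abs_bellOne_le hψ hβ'0 hβ' h0 hg hp) (by nlinarith)
  · intro p hp t ht
    have hlt : ∀ x, |q x + t * f x| < 1 / 2 := fun x => ((hw ht).abs_le hβ'0 x).trans_lt hβ'
    refine ((hasDerivAt_exp_shot hψ hp hlt).mul
      (hasDerivAt_dshot hψ (k := 1) (by norm_num) hp hlt)).congr_deriv ?_
    simp only [bellTwo]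
    ring
  · intro p hp t ht
    have hz := one_le_toReal_size hp
    exact abs_mul_exp_le hp (by positivity)
      (hψ.isWindowed_zero hβ'0 hβ' (hw ht)) (by positivity)
      (abs_bellTwo_le hψ hβ'0 hβ' (hw ht) hB hf hg hp) (by nlinarith)

include hhm hh

theorem hasDerivAt_integral_bellTwo :
    HasDerivAt (fun t => ∫ p, Real.exp (shot (fun x => ψ 0 (q x + t * f x)) p) *
        bellTwo ψ (fun x => q x + t * f x) g h p ∂(placedLaw c r d))
      (∫ p, Real.exp (shot (fun x => ψ 0 (q x)) p) * bellThree ψ q f g h p ∂(placedLaw c r d))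
      0 := by
  have hβ'0 : 0 ≤ β' := hβ0.trans hβ.le
  have hε : 0 < (β' - β) / (B + 1) := div_pos (sub_pos.2 hβ) (by positivity)
  have hw := fun {t} ht => isWindowed_add_mul (β' := β') (t := t) hB hq hf ht
  have hm : ∀ t : ℝ, Measurable fun x => q x + t * f x := fun t => hqm.add (hfm.const_mul t)
  have hC := hψ.one_le
  have hm2 : ∀ t, Measurable fun p => bellTwo ψ (fun x => q x + t * f x) g h p := fun t =>
    ((measurable_dshot hψ (hm t) hgm 1).mul
      (measurable_dshot hψ (hm t) hhm 1)).add (measurable_dshot hψ (hm t) (hgm.mul hhm) 2)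
  have hm3 : Measurable fun p => bellThree ψ (fun x => q x + 0 * f x) f g h p :=
    ((measurable_dshot hψ (hm 0) hfm 1).mul (hm2 0)).add
      ((((measurable_dshot hψ (hm 0) (hfm.mul hgm) 2).mul (measurable_dshot hψ (hm 0) hhm 1)).add
      ((measurable_dshot hψ (hm 0) hgm 1).mul (measurable_dshot hψ (hm 0) (hfm.mul hhm) 2))).add
      (measurable_dshot hψ (hm 0) (hfm.mul (hgm.mul hhm)) 3))
  have key := hasDerivAt_integral_of_abs_le_majorant hc hexp hfin (R := R) (b := 2 * β')
    (A := 5 * (C * B) ^ 3) hε hβθ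
    (W := fun t p => Real.exp (shot (fun x => ψ 0 (q x + t * f x)) p) *
      bellTwo ψ (fun x => q x + t * f x) g h p)
    (W' := fun t p => Real.exp (shot (fun x => ψ 0 (q x + t * f x)) p) *
      bellThree ψ (fun x => q x + t * f x) f g h p)
    (fun t => (measurable_exp_shot hψ (hm t)).mul (hm2 t))
    ((measurable_exp_shot hψ (hm 0)).mul hm3) ?_ ?_ ?_
  · simpa using key
  · refine integrable_of_abs_le_majorant hc hexp hfin
      ((measurable_exp_shot hψ (hm 0)).mul (hm2 0)) (R := R) (A := 2 * (C * B) ^ 2) hβθ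
      fun p hp => ?_
    have hz := one_le_toReal_size hp
    have h0 := hw (t := 0) (by simpa using hε)
    exact abs_mul_exp_le hp (by positivity) (hψ.isWindowed_zero hβ'0 hβ' h0) (by positivity)
      (abs_bellTwo_le hψ hβ'0 hβ' h0 hB hg hh hp) (by nlinarith)
  · intro p hp t ht
    have hlt : ∀ x, |q x + t * f x| < 1 / 2 := fun x => ((hw ht).abs_le hβ'0 x).trans_lt hβ'
    have h1 := ((hasDerivAt_dshot hψ (g := g) (k := 1) (by norm_num) hp hlt).mul
      (hasDerivAt_dshot hψ (g := h) (k := 1) (by norm_num) hp hlt)).add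
      (hasDerivAt_dshot hψ (g := fun x => g x * h x) (k := 2) (by norm_num) hp hlt)
    refine ((hasDerivAt_exp_shot hψ hp hlt).mul h1).congr_deriv ?_
    simp only [bellThree, bellTwo, Pi.add_apply, Pi.mul_apply]
    ring
  · intro p hp t ht
    exact abs_mul_exp_le hp (by positivity)
      (hψ.isWindowed_zero hβ'0 hβ' (hw ht)) (by positivity)
      (abs_bellThree_le hψ hβ'0 hβ' (hw ht) hB hf hg hh hp) le_rfl

end
end
end
end BranchingCluster

/-! ### Mixed derivatives at the origin and the two generating functionals -/

namespace BranchingCluster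
noncomputable section
open scoped ENNReal NNReal

theorem isWindowed_sum {n : ℕ} {R B : ℝ} {f : Fin n → ℝ → ℝ} (hf : ∀ j, IsWindowed R B (f j))
    (s : Fin n → ℝ) : IsWindowed R ((∑ j, |s j|) * B) fun x => ∑ j, s j * f j x := fun x => by
  refine (Finset.abs_sum_le_sum_abs _ _).trans ?_
  have h : ∀ j, |s j * f j x| ≤ |s j| * (Set.Icc (-R) R).indicator (fun _ => B) x := fun j => by
    rw [abs_mul]
    exact mul_le_mul_of_nonneg_left (hf j x) (abs_nonneg _)
  refine (Finset.sum_le_sum fun j _ => h j).trans (le_of_eq ?_)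
  rw [← Finset.sum_mul]
  by_cases hx : x ∈ Set.Icc (-R) R
  · simp only [Set.indicator_of_mem hx]
  · simp only [Set.indicator_of_notMem hx, mul_zero]

theorem eventually_isWindowed_sum {n : ℕ} {R B : ℝ} {f : Fin n → ℝ → ℝ}
    (hf : ∀ j, IsWindowed R B (f j)) {β : ℝ} (hβ : 0 < β) :
    ∀ᶠ s in 𝓝 (0 : Fin n → ℝ), IsWindowed R β fun x => ∑ j, s j * f j x := by
  have h : Tendsto (fun s : Fin n → ℝ => (∑ j, |s j|) * B) (𝓝 0) (𝓝 0) := by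
    have : Continuous fun s : Fin n → ℝ => (∑ j, |s j|) * B := by fun_prop
    simpa using this.tendsto 0
  filter_upwards [h.eventually (gt_mem_nhds hβ)] with s hs
  exact (isWindowed_sum hf s).mono hs.le

theorem sum_snoc_mul {n : ℕ} (f : Fin (n + 1) → ℝ → ℝ) (s : Fin n → ℝ) (t x : ℝ) :
    ∑ j, Fin.snoc (α := fun _ => ℝ) s t j * f j x =
      (∑ j : Fin n, s j * f j.castSucc x) + t * f (Fin.last n) x := by
  rw [Fin.sum_univ_castSucc]
  simp

theorem measurable_sum_mul {n : ℕ} {f : Fin n → ℝ → ℝ} (hf : ∀ j, Measurable (f j))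
    (s : Fin n → ℝ) : Measurable fun x => ∑ j, s j * f j x :=
  Finset.measurable_sum _ fun j _ => (hf j).const_mul (s j)

section
variable {ψ : ℕ → ℝ → ℝ} {C : ℝ} (hψ : IsGenerator ψ C) {R B : ℝ}
  {c : ℝ≥0∞} {r : ℝ≥0} {d : Measure ℝ} [IsProbabilityMeasure d] {θ : ℝ}
  (hc : c ≠ ∞) (hexp : Integrable (fun e => Real.exp (θ * (size e).toReal)) (marksLaw r d))
  (hfin : ∀ᵐ e ∂(marksLaw r d), size e < ∞) (hθ : 0 < θ) (hB : 0 ≤ B)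
include hψ hc hexp hfin hθ hB

/-- `HasMixedPartial` peels off the last variable first. The outer derivative is needed for all
small values of the remaining variable; at the last stage no variables are left and the base
function is `0`. -/
theorem hasMixedPartial_two {f : Fin 2 → ℝ → ℝ} (hfm : ∀ j, Measurable (f j))
    (hf : ∀ j, IsWindowed R B (f j)) :
    HasMixedPartial 2 (fun s => ∫ p, (Real.exp (shot (fun x => ψ 0 (∑ j, s j * f j x)) p) - 1)
        ∂(placedLaw c r d))
      (∫ p, Real.exp (shot (fun _ => ψ 0 0) p) * bellTwo ψ (fun _ => 0) (f 0) (f 1) p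
        ∂(placedLaw c r d)) := by
  -- The value `1 / 3` stays inside the domain `|y| < 1 / 2` of the generator, and `θ / 3` ensures
  -- `2 * β' < θ`.
  set β' := min (1 / 3) (θ / 3)
  have hβ' : β' < 1 / 2 := (min_le_left _ _).trans_lt (by norm_num)
  have hβθ : 2 * β' < θ := by have := min_le_right (1 / 3) (θ / 3); linarith
  have hβ'0 : 0 < β' := lt_min (by norm_num) (by positivity)
  refine ⟨fun s => ∫ p, Real.exp (shot (fun x => ψ 0 (∑ j, s j * f j.castSucc x)) p) *
    bellOne ψ (fun x => ∑ j, s j * f j.castSucc x) (f 1) p ∂(placedLaw c r d), ?_,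
    fun _ => _, Eventually.of_forall fun s => ?_, rfl⟩
  · filter_upwards [eventually_isWindowed_sum (fun j : Fin 1 => hf j.castSucc) (half_pos hβ'0)]
      with s hs
    simp_rw [sum_snoc_mul]
    exact hasDerivAt_integral_exp_shot hψ hc hexp hfin (by positivity) (half_lt_self hβ'0) hβ' hβθ
      hB (measurable_sum_mul (fun j => hfm _) s) (hfm 1) hs (hf 1)
  · simp_rw [sum_snoc_mul (fun j : Fin 1 => f j.castSucc)]
    simp only [Finset.univ_eq_empty, Finset.sum_empty]
    exact hasDerivAt_integral_bellOne hψ hc hexp hfin le_rfl hβ'0 hβ' hβθ hB measurable_const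
      (hfm 0) (hfm 1) (fun x => by
        rw [abs_zero]; exact Set.indicator_nonneg (fun _ _ => le_rfl) x) (hf 0) (hf 1)

theorem hasMixedPartial_three {f : Fin 3 → ℝ → ℝ} (hfm : ∀ j, Measurable (f j))
    (hf : ∀ j, IsWindowed R B (f j)) :
    HasMixedPartial 3 (fun s => ∫ p, (Real.exp (shot (fun x => ψ 0 (∑ j, s j * f j x)) p) - 1)
        ∂(placedLaw c r d))
      (∫ p, Real.exp (shot (fun _ => ψ 0 0) p) * bellThree ψ (fun _ => 0) (f 0) (f 1) (f 2) p
        ∂(placedLaw c r d)) := by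
  set β' := min (1 / 3) (θ / 3)
  have hβ' : β' < 1 / 2 := (min_le_left _ _).trans_lt (by norm_num)
  have hβθ : 2 * β' < θ := by have := min_le_right (1 / 3) (θ / 3); linarith
  have hβ'0 : 0 < β' := lt_min (by norm_num) (by positivity)
  refine ⟨fun s => ∫ p, Real.exp (shot (fun x => ψ 0 (∑ j, s j * f j.castSucc x)) p) *
    bellOne ψ (fun x => ∑ j, s j * f j.castSucc x) (f 2) p ∂(placedLaw c r d), ?_,
    fun s => ∫ p, Real.exp (shot (fun x => ψ 0 (∑ j, s j * f j.castSucc.castSucc x)) p) *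
    bellTwo ψ (fun x => ∑ j, s j * f j.castSucc.castSucc x) (f 1) (f 2) p ∂(placedLaw c r d), ?_,
    fun _ => _, Eventually.of_forall fun s => ?_, rfl⟩
  · filter_upwards [eventually_isWindowed_sum (fun j : Fin 2 => hf j.castSucc) (half_pos hβ'0)]
      with s hs
    simp_rw [sum_snoc_mul]
    exact hasDerivAt_integral_exp_shot hψ hc hexp hfin (by positivity) (half_lt_self hβ'0) hβ' hβθ
      hB (measurable_sum_mul (fun j => hfm _) s) (hfm 2) hs (hf 2)
  · filter_upwards [eventually_isWindowed_sum (fun j : Fin 1 => hf j.castSucc.castSucc)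
      (half_pos hβ'0)] with s hs
    simp_rw [sum_snoc_mul (fun j : Fin 2 => f j.castSucc)]
    exact hasDerivAt_integral_bellOne hψ hc hexp hfin (by positivity) (half_lt_self hβ'0) hβ' hβθ
      hB (measurable_sum_mul (fun j => hfm _) s) (hfm 1) (hfm 2) hs (hf 1) (hf 2)
  · simp_rw [sum_snoc_mul (fun j : Fin 1 => f j.castSucc.castSucc)]
    simp only [Finset.univ_eq_empty, Finset.sum_empty]
    exact hasDerivAt_integral_bellTwo hψ hc hexp hfin le_rfl hβ'0 hβ' hβθ hB measurable_const
      (hfm 0) (hfm 1) (hfm 2) (fun x => by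
        rw [abs_zero]; exact Set.indicator_nonneg (fun _ _ => le_rfl) x) (hf 0) (hf 1) (hf 2)

end

/-! ### The two generators -/

/-- The derivatives of the identity. -/
def idGen : ℕ → ℝ → ℝ
  | 0 => id
  | 1 => fun _ => 1
  | _ + 2 => fun _ => 0

/-- The derivatives of `log (1 + y)`. -/
def logGen : ℕ → ℝ → ℝ
  | 0 => fun y => Real.log (1 + y)
  | k + 1 => fun y => (-1) ^ k * k.factorial * ((1 + y) ^ (k + 1))⁻¹

theorem isGenerator_idGen : IsGenerator idGen 1 where
  measurable k := by
    match k with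
    | 0 => exact measurable_id
    | 1 => exact measurable_const
    | k + 2 => exact measurable_const
  one_le := le_rfl
  abs_le_two_mul y _ := by
    simp only [idGen, id]
    linarith [abs_nonneg y]
  abs_le k _ y _ := by
    match k with
    | 0 => simp [idGen]
    | k + 1 => simp [idGen]
  hasDerivAt k _ y _ := by
    match k with
    | 0 => exact hasDerivAt_id y
    | 1 => exact hasDerivAt_const y 1
    | k + 2 => exact hasDerivAt_const y 0

/-- For `|y| < 1 / 2` one has `1 + y ≥ 1 / 2`, so the derivative of order `k + 1` is at most `k! * 2
^ (k + 1)`; the largest value, at `k = 2`, is `16`. -/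
theorem isGenerator_logGen : IsGenerator logGen 16 where
  measurable k := by
    match k with
    | 0 => exact (measurable_const.add measurable_id).log
    | k + 1 => exact (((measurable_const.add measurable_id).pow_const _).inv).const_mul _
  one_le := by norm_num
  abs_le_two_mul y hy := by
    simp only [logGen]
    have hy' := abs_lt.1 hy
    rw [abs_le]
    constructor
    · have h1 := Real.one_sub_inv_le_log_of_pos (show 0 < 1 + y by linarith)
      refine le_trans ?_ h1
      have h2 : 1 - (1 + y)⁻¹ = y / (1 + y) := by
        have : (1 + y) ≠ 0 := by linarith
        field_simp; ring
      rw [h2, le_div_iff₀ (by linarith)]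
      rcases abs_cases y with ⟨h, _⟩ | ⟨h, _⟩ <;> rw [h] <;> nlinarith
    · have h1 := Real.log_le_sub_one_of_pos (show 0 < 1 + y by linarith)
      linarith [le_abs_self y, abs_nonneg y]
  abs_le k hk y hy := by
    have hy' := abs_lt.1 hy
    have h1 : (1 : ℝ) / 2 ≤ 1 + y := by linarith
    have h2 : ((1 + y) ^ (k + 1))⁻¹ ≤ 2 ^ (k + 1) := by
      rw [← inv_pow]
      refine pow_le_pow_left₀ (by positivity) ?_ _
      rw [inv_le_comm₀ (by linarith) (by norm_num)]
      linarith
    have h3 : 0 < ((1 + y) ^ (k + 1))⁻¹ := by positivity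
    simp only [logGen]
    rw [abs_mul, abs_mul, abs_pow, abs_neg, abs_one, one_pow, one_mul, abs_of_pos h3, Nat.abs_cast]
    interval_cases k <;> norm_num [Nat.factorial] at h2 ⊢ <;> linarith
  hasDerivAt k _ y hy := by
    have hy' := abs_lt.1 hy
    have hne : 1 + y ≠ 0 := by linarith
    have h1 : HasDerivAt (fun y : ℝ => 1 + y) 1 y := (hasDerivAt_id y).const_add 1
    match k with
    | 0 =>
      refine (h1.log hne).congr_deriv ?_
      simp [logGen]
    | k + 1 =>
      refine (((h1.pow (k + 1)).inv (pow_ne_zero _ hne)).const_mul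
        ((-1) ^ k * (k.factorial : ℝ))).congr_deriv ?_
      simp only [logGen, Nat.factorial_succ]
      push_cast
      simp only [Pi.pow_apply]
      field_simp
      ring

/-! ### The functionals of the cluster process -/

/-- The product `∏ᶠ` is `1` by default when infinitely many factors differ from `1`. The finite set
`F` carrying `μ` in the window excludes this; the bound on `q` keeps the bases positive, so the real
powers are exponentials of logarithms. -/
theorem atomProd_eq_exp {μ : Measure ℝ} {R β : ℝ} {q : ℝ → ℝ} {F : Finset ℝ}
    (hF : μ (Set.Icc (-R) R \ F) = 0) (hμ : μ (Set.Icc (-R) R) < ∞) (hβ0 : 0 ≤ β) (hβ : β < 1 / 2)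
    (hqm : Measurable q) (hq : IsWindowed R β q) :
    atomProd μ q = Real.exp (∫ x, logGen 0 (q x) ∂μ) := by
  classical
  set F' := F.filter (· ∈ Set.Icc (-R) R) with hF'
  have hout : ∀ x ∉ Set.Icc (-R) R, q x = 0 := fun x hx => hq.eq_zero hx
  have hsub : Function.mulSupport (fun x => (1 + q x) ^ (μ {x}).toReal) ⊆ F' := by
    intro x hx
    by_contra hxF
    apply hx
    simp only
    by_cases hxI : x ∈ Set.Icc (-R) R
    · have hxF' : x ∉ F := fun h => hxF (by simp [hF', h, hxI.1, hxI.2])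
      have : μ {x} = 0 := measure_mono_null (by
        rintro _ rfl; exact ⟨hxI, hxF'⟩) hF
      rw [this]; simp
    · rw [hout x hxI]; simp
  rw [atomProd, finprod_eq_prod_of_mulSupport_subset _ hsub]
  have h1 : ∫ x, logGen 0 (q x) ∂μ = ∫ x in (F' : Set ℝ), logGen 0 (q x) ∂μ := by
    refine (setIntegral_eq_integral_of_ae_compl_eq_zero ?_).symm
    rw [ae_iff]
    refine measure_mono_null (fun x hx => ?_) hF
    obtain ⟨h2, h3⟩ := Classical.not_imp.1 hx
    have hxI : x ∈ Set.Icc (-R) R := by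
      by_contra h; exact h3 (by simp [logGen, hout x h])
    exact ⟨hxI, fun h => h2 (by simp [hF', hxI.1, hxI.2] at h ⊢; exact h)⟩
  have hi : Integrable (fun x => logGen 0 (q x)) μ := integrable_of_isWindowed hμ ((isGenerator_logGen.measurable 0).comp hqm)
    (isGenerator_logGen.isWindowed_zero hβ0 hβ hq)
  rw [h1, setIntegral_finset _ hi.integrableOn, Real.exp_sum]
  refine Finset.prod_congr rfl fun x hx => ?_
  have h2 := abs_lt.1 ((hq.abs_le hβ0 x).trans_lt hβ)
  rw [Real.rpow_def_of_pos (by linarith), measureReal_def, smul_eq_mul, mul_comm]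
  rfl

/-- Each cluster that meets the window contributes mass at least `1` to it, so only finitely many
do, and each of them has finitely many individuals. -/
theorem exists_finset_superposition {Ω : Type*} {U : ℕ → Ω → ℝ} {e : ℕ → Ω → Marks} {ω : Ω} {R : ℝ}
    (hs : ∀ j, size (e j ω) < ∞) (hN : superposition U e ω (Set.Icc (-R) R) < ∞) :
    ∃ F : Finset ℝ, superposition U e ω (Set.Icc (-R) R \ F) = 0 := by
  classical
  choose s _ hs' using fun j => exists_finset_placed_eq (hs j).ne
  set x : ℕ → List ℕ → ℝ := fun j v => position (fun v => (e j ω v).2) v + U j ω with hx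
  have hone : ∀ j, ∀ v ∈ s j, x j v ∈ Set.Icc (-R) R → 1 ≤ placed (U j ω, e j ω) (Set.Icc (-R) R) := by
    intro j v hv hv'
    rw [hs', Measure.finsetSum_apply]
    refine le_trans ?_ (Finset.single_le_sum (fun _ _ => zero_le) hv)
    rw [Measure.dirac_apply_of_mem hv']
  rw [superposition, Measure.sum_apply _ measurableSet_Icc] at hN
  have hfin := ENNReal.finite_const_le_of_tsum_ne_top hN.ne one_ne_zero
  refine ⟨hfin.toFinset.biUnion fun j => (s j).image (x j), ?_⟩
  rw [superposition, Measure.sum_apply _ (measurableSet_Icc.diff (Finset.measurableSet _)),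
    ENNReal.tsum_eq_zero]
  intro j
  rw [hs', Measure.finsetSum_apply]
  refine Finset.sum_eq_zero fun v hv => ?_
  rw [Measure.dirac_apply, Set.indicator_of_notMem]
  rintro ⟨h1, h2⟩
  refine h2 ?_
  rw [Finset.mem_coe, Finset.mem_biUnion]
  exact ⟨j, hfin.mem_toFinset.2 (hone j v hv h1), Finset.mem_image_of_mem _ hv⟩

section
variable {Ω : Type*} [MeasurableSpace Ω] {P : Measure Ω} [IsProbabilityMeasure P]
  {U : ℕ → Ω → ℝ} {e : ℕ → Ω → Marks} {c : ℝ≥0∞} {r : ℝ≥0} {d : Measure ℝ}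
  [IsProbabilityMeasure d] {θ : ℝ}
  (hη : IsPoissonProcess P (fun ω => Measure.sum fun j => Measure.dirac (U j ω))
    (c • (volume : Measure ℝ)))
  (hM : IsMarked P U e (marksLaw r d)) (hc : c ≠ ∞)
  (hexp : Integrable (fun e => Real.exp (θ * (size e).toReal)) (marksLaw r d))
  (hfin : ∀ᵐ e ∂(marksLaw r d), size e < ∞) (hθ : 0 < θ)
include hη hM hc hexp hfin hθ

/-- Both generating functionals are exponential functionals of `ψ 0 (q)`: `idGen` gives the complete
one and `logGen` the factorial one. Taking the logarithm linearises the formula into an integral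
over `placedLaw`. -/
theorem eventually_integral_exp_superposition {ψ : ℕ → ℝ → ℝ} {C : ℝ} (hψ : IsGenerator ψ C)
    {n : ℕ} {f : Fin n → ℝ → ℝ} {R B : ℝ} (hfm : ∀ j, Measurable (f j))
    (hf : ∀ j, IsWindowed R B (f j)) :
    ∀ᶠ s in 𝓝 (0 : Fin n → ℝ),
      Integrable (fun ω => Real.exp (∫ x, ψ 0 (∑ j, s j * f j x) ∂(superposition U e ω))) P ∧
      Real.log (∫ ω, Real.exp (∫ x, ψ 0 (∑ j, s j * f j x) ∂(superposition U e ω)) ∂P) =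
        ∫ p, (Real.exp (shot (fun x => ψ 0 (∑ j, s j * f j x)) p) - 1) ∂(placedLaw c r d) := by
  set β := min (1 / 3) (θ / 3)
  have hβ : β < 1 / 2 := (min_le_left _ _).trans_lt (by norm_num)
  have hβθ : 2 * β < θ := by have := min_le_right (1 / 3) (θ / 3); linarith
  have hβ0 : 0 < β := lt_min (by norm_num) (by positivity)
  filter_upwards [eventually_isWindowed_sum hf hβ0] with s hs
  have h := integral_exp_superposition hη hM hc hexp hfin hθ
    ((hψ.measurable 0).comp (measurable_sum_mul hfm s)) (hψ.isWindowed_zero hβ0.le hβ hs)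
    (by positivity) hβθ
  refine ⟨h.1, ?_⟩
  have h2 := congrArg Real.log h.2
  rw [Real.log_exp] at h2
  exact h2

theorem eventually_atomProd_superposition {n : ℕ} {f : Fin n → ℝ → ℝ} {R B : ℝ}
    (hfm : ∀ j, Measurable (f j)) (hf : ∀ j, IsWindowed R B (f j)) :
    ∀ᶠ s in 𝓝 (0 : Fin n → ℝ), ∀ᵐ ω ∂P,
      atomProd (superposition U e ω) (fun x => ∑ j, s j * f j x) =
        Real.exp (∫ x, logGen 0 (∑ j, s j * f j x) ∂(superposition U e ω)) := by
  filter_upwards [eventually_isWindowed_sum hf (by norm_num : (0 : ℝ) < 1 / 3)] with s hs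
  filter_upwards [hM.ae_size_lt_top hfin, ae_superposition_Icc_lt_top hη hM hc hexp hfin hθ R]
    with ω h1 h2
  obtain ⟨F, hF⟩ := exists_finset_superposition h1 h2
  exact atomProd_eq_exp hF h2 (by norm_num) (by norm_num) (measurable_sum_mul hfm s) hs

theorem eventually_compCGF {n : ℕ} {f : Fin n → ℝ → ℝ} {R B : ℝ}
    (hfm : ∀ j, Measurable (f j)) (hf : ∀ j, IsWindowed R B (f j)) :
    ∀ᶠ s in 𝓝 (0 : Fin n → ℝ),
      Integrable (fun ω => Real.exp (∫ x, ∑ j, s j * f j x ∂(superposition U e ω))) P ∧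
      compCGF P (superposition U e) (fun x => ∑ j, s j * f j x) =
        ∫ p, (Real.exp (shot (fun x => idGen 0 (∑ j, s j * f j x)) p) - 1) ∂(placedLaw c r d) :=
  eventually_integral_exp_superposition hη hM hc hexp hfin hθ isGenerator_idGen hfm hf

theorem eventually_facCGF {n : ℕ} {f : Fin n → ℝ → ℝ} {R B : ℝ}
    (hfm : ∀ j, Measurable (f j)) (hf : ∀ j, IsWindowed R B (f j)) :
    ∀ᶠ s in 𝓝 (0 : Fin n → ℝ),
      Integrable (fun ω => atomProd (superposition U e ω) fun x => ∑ j, s j * f j x) P ∧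
      facCGF P (superposition U e) (fun x => ∑ j, s j * f j x) =
        ∫ p, (Real.exp (shot (fun x => logGen 0 (∑ j, s j * f j x)) p) - 1)
          ∂(placedLaw c r d) := by
  filter_upwards [eventually_integral_exp_superposition hη hM hc hexp hfin hθ isGenerator_logGen
    hfm hf, eventually_atomProd_superposition hη hM hc hexp hfin hθ hfm hf] with s h1 h2
  exact ⟨h1.1.congr (h2.mono fun ω h => h.symm), by rw [facCGF, integral_congr_ae h2, h1.2]⟩

end
end
end BranchingCluster

namespace BranchingCluster
noncomputable section
open scoped ENNReal NNReal

/-! ### The mean progeny -/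

/-- The root plus the means of its subtrees. The equation holds in `ℝ≥0∞` and is also satisfied by
an infinite mean. -/
theorem lintegral_progeny_eq (ξ : Measure ℕ) [IsProbabilityMeasure ξ] :
    ∫⁻ K, progeny K ∂(treeLaw ξ) = 1 + (∑' k : ℕ, ξ {k} * k) * ∫⁻ K, progeny K ∂(treeLaw ξ) := by
  have hm : ∀ i : ℕ, Measurable fun L : ℕ → List ℕ → ℕ => progeny (L i) :=
    fun i => measurable_progeny.comp (measurable_pi_apply i)
  have h1 : ∀ i : ℕ, ∫⁻ L : ℕ → List ℕ → ℕ, progeny (L i)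
      ∂(Measure.infinitePi fun _ : ℕ => treeLaw ξ) = ∫⁻ K, progeny K ∂(treeLaw ξ) := by
    intro i
    rw [← lintegral_map measurable_progeny (measurable_pi_apply i), Measure.infinitePi_map_eval]
  conv_lhs => rw [lintegral_congr progeny_eq_one_add]
  rw [lintegral_treeLaw_eq_tsum ξ
    (F := fun k (L : ℕ → List ℕ → ℕ) => 1 + ∑ i ∈ Finset.range k, progeny (L i))
    fun k => measurable_const.add (Finset.measurable_sum _ fun i _ => hm i)]
  have h2 : ∀ k : ℕ, ∫⁻ L : ℕ → List ℕ → ℕ, 1 + ∑ i ∈ Finset.range k, progeny (L i)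
      ∂(Measure.infinitePi fun _ : ℕ => treeLaw ξ) =
        1 + k * ∫⁻ K, progeny K ∂(treeLaw ξ) := fun k => by
    rw [lintegral_add_left measurable_const, lintegral_finsetSum _ fun i _ => hm i]
    simp [h1]
  simp_rw [h2, mul_add, mul_one]
  rw [ENNReal.tsum_add, ← ENNReal.tsum_mul_right]
  congr 1
  · have := measure_univ (μ := ξ)
    rw [← lintegral_one, lintegral_countable'] at this
    simpa using this
  · exact tsum_congr fun k => by ring

theorem tsum_poissonMeasure_mul_self (r : ℝ≥0) : ∑' k : ℕ, poissonMeasure r {k} * k = r := by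
  rw [tsum_eq_zero_add' ENNReal.summable]
  have h : ∀ k : ℕ, poissonMeasure r {k + 1} * ((k + 1 : ℕ) : ℝ≥0∞) =
      r * poissonMeasure r {k} := fun k => by
    rw [poissonMeasure_singleton, poissonMeasure_singleton, ← ENNReal.ofReal_natCast,
      ← ENNReal.ofReal_mul (by positivity), ← ENNReal.ofReal_coe_nnreal,
      ← ENNReal.ofReal_mul (by positivity)]
    congr 1
    rw [Nat.factorial_succ]
    push_cast
    field_simp
    ring
  simp_rw [h]
  rw [ENNReal.tsum_mul_left]
  have := measure_univ (μ := poissonMeasure r)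
  rw [← lintegral_one, lintegral_countable'] at this
  simp only [one_mul] at this
  simp [this]

theorem lintegral_size_eq {r : ℝ≥0} (hr : r < 1) (d : Measure ℝ) [IsProbabilityMeasure d] :
    ∫⁻ e, size e ∂(marksLaw r d) = ENNReal.ofReal (1 - r)⁻¹ := by
  set E := ∫⁻ e, size e ∂(marksLaw r d) with hE
  have h1 : E = ∫⁻ K, progeny K ∂(treeLaw (poissonMeasure r)) := by
    rw [hE, ← map_offspring_marksLaw r d, lintegral_map measurable_progeny measurable_offspring]
    simp_rw [size_eq_progeny]
  have h2 := lintegral_progeny_eq (poissonMeasure r)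
  rw [← h1, tsum_poissonMeasure_mul_self] at h2
  have hfin := ae_size_lt_top hr d
  obtain ⟨θ, hθ, hexp⟩ := exists_integrable_exp_size hr d
  -- Finiteness comes from the exponential moment and must precede solving the linear equation for
  -- the mean.
  have h3 : E ≠ ∞ := by
    have h4 := (integrable_pow_mul_exp hexp 1 hθ).2
    rw [hasFiniteIntegral_iff_ofReal (ae_of_all _ fun e => by positivity)] at h4
    refine (lt_of_eq_of_lt (lintegral_congr_ae ?_) h4).ne
    filter_upwards [hfin] with e he
    simp [ENNReal.ofReal_toReal he.ne]
  have hr' : (r : ℝ) < 1 := by exact_mod_cast hr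
  have h5 : E.toReal = 1 + r * E.toReal := by
    conv_lhs => rw [h2]
    rw [ENNReal.toReal_add ENNReal.one_ne_top (ENNReal.mul_ne_top ENNReal.coe_ne_top h3)]
    simp
  rw [← ENNReal.ofReal_toReal h3]
  congr 1
  exact eq_inv_of_mul_eq_one_left (by linarith)

/-! ### The measures of families of individuals of a cluster -/

/-- The marks for which the individuals `v 0`, …, `v n` are born. -/
def bornSet {n : ℕ} (v : Fin n → List ℕ) : Set Marks :=
  {e | ∀ j, IsBorn (fun w => (e w).1) (v j)}

theorem measurableSet_bornSet {n : ℕ} (v : Fin n → List ℕ) : MeasurableSet (bornSet v) := by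
  rw [bornSet, Set.ofPred_forall]
  exact MeasurableSet.iInter fun j => measurableSet_isBorn_marks (v j)

/-- The positions of `v 1`, …, `v n` relative to `v 0`. -/
def relPos {n : ℕ} (v : Fin (n + 1) → List ℕ) (e : Marks) : Fin n → ℝ := fun j =>
  position (fun w => (e w).2) (v j.succ) - position (fun w => (e w).2) (v 0)

theorem measurable_relPos {n : ℕ} (v : Fin (n + 1) → List ℕ) : Measurable (relPos v) :=
  measurable_pi_lambda _ fun _ => (measurable_position _).sub (measurable_position _)

/-- The mean measure of the relative positions in families of `n + 1` individuals of a cluster,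
per unit of length. -/
def familyMeasure (c : ℝ≥0∞) (r : ℝ≥0) (d : Measure ℝ) (n : ℕ) : Measure (Fin n → ℝ) :=
  Measure.sum fun v : Fin (n + 1) → List ℕ =>
    ((c • marksLaw r d).restrict (bornSet v)).map (relPos v)

/-- A product of sums over individuals expanded over tuples. The general semiring allows its use in
`ℝ≥0∞` to count tuples and in `ℝ` to expand products of shots. -/
theorem hasSum_bornSet_indicator {n : ℕ} {e : Marks} {s : Finset (List ℕ)}
    (hs : ∀ v, v ∈ s ↔ IsBorn (fun v => (e v).1) v) {M : Type*} [CommSemiring M]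
    [TopologicalSpace M] (F : Fin n → List ℕ → M) :
    HasSum (fun v : Fin n → List ℕ => (bornSet v).indicator (fun _ => ∏ j, F j (v j)) e)
      (∏ j, ∑ w ∈ s, F j w) := by
  classical
  rw [Finset.prod_univ_sum]
  have h : ∀ v : Fin n → List ℕ, v ∈ Fintype.piFinset (fun _ => s) ↔ e ∈ bornSet v := fun v => by
    simp [Fintype.mem_piFinset, hs, bornSet]
  have h1 := hasSum_sum_of_ne_finset_zero (L := .unconditional _) (s := Fintype.piFinset (fun _ : Fin n => s))
    (f := fun v : Fin n → List ℕ => (bornSet v).indicator (fun _ => ∏ j, F j (v j)) e)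
    fun v hv => Set.indicator_of_notMem (fun h' => hv ((h v).2 h')) _
  convert! h1 using 1
  refine Finset.sum_congr rfl fun v hv => ?_
  rw [Set.indicator_of_mem ((h v).1 hv)]

theorem tsum_bornSet {n : ℕ} {e : Marks} (he : size e ≠ ∞) :
    ∑' v : Fin n → List ℕ, (bornSet v).indicator 1 e = size e ^ n := by
  obtain ⟨s, hs, hs'⟩ := exists_finset_placed_eq he
  have h1 : size e = ∑ w ∈ s, 1 := by
    rw [← placed_univ (0, e), hs', Measure.finsetSum_apply]
    simp
  have h2 := (hasSum_bornSet_indicator (n := n) hs (M := ℝ≥0∞) fun _ _ => 1).tsum_eq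
  simp only [Finset.prod_const, Finset.card_univ, Fintype.card_fin, one_pow] at h2
  rw [h1, ← h2]
  rfl

section
variable {c : ℝ≥0∞} {r : ℝ≥0} {d : Measure ℝ} [IsProbabilityMeasure d]

omit [IsProbabilityMeasure d] in
theorem familyMeasure_univ (hfin : ∀ᵐ e ∂(marksLaw r d), size e < ∞) (n : ℕ) :
    familyMeasure c r d n Set.univ = c * ∫⁻ e, size e ^ (n + 1) ∂(marksLaw r d) := by
  rw [familyMeasure, Measure.sum_apply _ MeasurableSet.univ]
  have h : ∀ v : Fin (n + 1) → List ℕ,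
      ((c • marksLaw r d).restrict (bornSet v)).map (relPos v) Set.univ =
        c * ∫⁻ e, (bornSet v).indicator 1 e ∂(marksLaw r d) := fun v => by
    rw [Measure.map_apply (measurable_relPos v) MeasurableSet.univ, Set.preimage_univ,
      Measure.restrict_apply_univ, Measure.smul_apply, smul_eq_mul,
      lintegral_indicator_one (measurableSet_bornSet v)]
  simp_rw [h]
  rw [ENNReal.tsum_mul_left, ← lintegral_tsum fun v =>
    (measurable_one.indicator (measurableSet_bornSet v)).aemeasurable]
  congr 1
  refine lintegral_congr_ae ?_
  filter_upwards [hfin] with e he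
  exact tsum_bornSet he.ne

omit [IsProbabilityMeasure d] in
theorem isFiniteMeasure_familyMeasure (hc : c ≠ ∞) {θ : ℝ} (hθ : 0 < θ)
    (hexp : Integrable (fun e => Real.exp (θ * (size e).toReal)) (marksLaw r d))
    (hfin : ∀ᵐ e ∂(marksLaw r d), size e < ∞) (n : ℕ) :
    IsFiniteMeasure (familyMeasure c r d n) := by
  refine ⟨?_⟩
  rw [familyMeasure_univ hfin]
  refine ENNReal.mul_lt_top hc.lt_top ?_
  have h4 := (integrable_pow_mul_exp hexp (n + 1) hθ).2
  rw [hasFiniteIntegral_iff_ofReal (ae_of_all _ fun e => by positivity)] at h4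
  refine lt_of_eq_of_lt (lintegral_congr_ae ?_) h4
  filter_upwards [hfin] with e he
  simp [ENNReal.ofReal_toReal he.ne, ENNReal.ofReal_pow]

/-- Seen from its first member, a family is placed uniformly. -/
theorem prod_map_relPos (hc : c ≠ ∞) {n : ℕ} (v : Fin (n + 1) → List ℕ) :
    (volume : Measure ℝ).prod (((c • marksLaw r d).restrict (bornSet v)).map (relPos v)) =
      ((placedLaw c r d).restrict (Set.univ ×ˢ bornSet v)).map
        (fun p => (p.1 + position (fun w => (p.2 w).2) (v 0), relPos v p.2)) := by
  have hpos := measurable_position (v 0)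
  have : IsFiniteMeasure (c • marksLaw r d) := ⟨by simpa using hc.lt_top⟩
  have hsh : Measurable fun p : ℝ × Marks =>
      (p.1 + position (fun w => (p.2 w).2) (v 0), p.2) :=
    (measurable_fst.add (hpos.comp measurable_snd)).prodMk measurable_snd
  have h1 : (placedLaw c r d).restrict (Set.univ ×ˢ bornSet v) =
      (volume : Measure ℝ).prod ((c • marksLaw r d).restrict (bornSet v)) := by
    rw [placedLaw, Measure.prod_smul_left, ← Measure.prod_smul_right, ← Measure.prod_restrict,
      Measure.restrict_univ]
  -- The shift by the position of `v 0` depends on the marks only, so on each fibre it is a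
  -- translation and preserves Lebesgue measure.
  have h2 : ((volume : Measure ℝ).prod ((c • marksLaw r d).restrict (bornSet v))).map
      (fun p => (p.1 + position (fun w => (p.2 w).2) (v 0), p.2)) =
      (volume : Measure ℝ).prod ((c • marksLaw r d).restrict (bornSet v)) := by
    ext S hS
    rw [Measure.map_apply hsh hS, Measure.prod_apply_symm (hsh hS), Measure.prod_apply_symm hS]
    refine lintegral_congr fun e => ?_
    exact measure_preimage_add_right (volume : Measure ℝ) (position (fun w => (e w).2) (v 0))
      ((fun x => (x, e)) ⁻¹' S)
  have h3 := Measure.map_prod_map (volume : Measure ℝ)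
    ((c • marksLaw r d).restrict (bornSet v)) measurable_id (measurable_relPos v)
  rw [Measure.map_id] at h3
  rw [h3, h1]
  conv_lhs => rw [← h2]
  rw [Measure.map_map (measurable_id.prodMap (measurable_relPos v)) hsh]
  rfl

/-- Reflecting the marks negates relative positions, leaves the birth events unchanged and preserves
the law. The reality of all the transforms comes down to this. -/
theorem map_neg_familyMeasure (hd : d.map (fun x => -x) = d) (n : ℕ) :
    (familyMeasure c r d n).map (fun τ => -τ) = familyMeasure c r d n := by
  rw [familyMeasure, Measure.map_sum measurable_neg.aemeasurable]
  congr 1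
  ext1 v
  rw [Measure.map_map measurable_neg (measurable_relPos v)]
  have h1 : (fun τ : Fin n → ℝ => -τ) ∘ relPos v = relPos v ∘ negMarks := by
    ext e j
    simp only [Function.comp_apply, Pi.neg_apply, relPos, negMarks, position_neg]
    ring
  have h2 : negMarks ⁻¹' bornSet v = bornSet v := rfl
  rw [h1, ← Measure.map_map (measurable_relPos v) measurable_negMarks]
  congr 1
  rw [← h2, ← Measure.restrict_map measurable_negMarks (measurableSet_bornSet v), Measure.map_smul,
    map_negMarks r hd, h2]

end

section
variable {c : ℝ≥0∞} {r : ℝ≥0} {d : Measure ℝ} [IsProbabilityMeasure d] {θ : ℝ}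
  (hc : c ≠ ∞) (hexp : Integrable (fun e => Real.exp (θ * (size e).toReal)) (marksLaw r d))
  (hfin : ∀ᵐ e ∂(marksLaw r d), size e < ∞) (hθ : 0 < θ)
include hc hexp hfin hθ

theorem integrable_prod_shot {n : ℕ} {f : Fin (n + 1) → ℝ → ℝ} {R B : ℝ}
    (hB : 0 ≤ B) (hfm : ∀ j, Measurable (f j)) (hf : ∀ j, IsWindowed R B (f j)) :
    Integrable (fun p => ∏ j, shot (f j) p) (placedLaw c r d) := by
  refine ((integrable_window_mul_exp hc hexp hfin R n hθ).const_mul (B ^ (n + 1))).mono'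
    (Finset.measurable_prod _ fun j _ => measurable_shot (hfm j)).aestronglyMeasurable ?_
  filter_upwards [ae_placedLaw (c := c) hfin] with p hp
  rw [Real.norm_eq_abs, Fin.prod_univ_succ, abs_mul, Finset.abs_prod]
  have h1 := abs_shot_le (hf 0) hp.ne
  have h2 : ∏ j : Fin n, |shot (f j.succ) p| ≤ ∏ _j : Fin n, B * (size p.2).toReal :=
    Finset.prod_le_prod (fun _ _ => abs_nonneg _) fun j _ => (hf j.succ).abs_shot_le_size hB hp.ne
  refine (mul_le_mul h1 h2 (Finset.prod_nonneg fun _ _ => abs_nonneg _)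
    (mul_nonneg hB (window_nonneg R p))).trans (le_of_eq ?_)
  simp [mul_pow]
  ring

/-- The moment measures of the placed clusters, in terms of the measures of families. -/
theorem integral_shiftedProd_familyMeasure {n : ℕ} {f : Fin (n + 1) → ℝ → ℝ}
    (hf : ∀ j, IsTestFunction (f j)) :
    ∫ p, shiftedProd f p ∂((volume : Measure ℝ).prod (familyMeasure c r d n)) =
      ∫ p, ∏ j, shot (f j) p ∂(placedLaw c r d) := by
  have : IsFiniteMeasure (familyMeasure c r d n) :=
    isFiniteMeasure_familyMeasure hc hθ hexp hfin n
  have : IsFiniteMeasure (c • marksLaw r d) := ⟨by simpa using hc.lt_top⟩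
  have hint := integrable_shiftedProd hf (familyMeasure c r d n)
  have hm := measurable_shiftedProd hf
  set G : (Fin (n + 1) → List ℕ) → ℝ × Marks → ℝ := fun v p =>
    ∏ j, f j (position (fun w => (p.2 w).2) (v j) + p.1) with hG
  have hGm : ∀ v, Measurable (G v) := fun v => Finset.measurable_prod _ fun j _ =>
    (hf j).measurable.comp (((measurable_position (v j)).comp measurable_snd).add measurable_fst)
  have hS : ∀ v : Fin (n + 1) → List ℕ, MeasurableSet ((Set.univ : Set ℝ) ×ˢ bornSet v) :=
    fun v => MeasurableSet.univ.prod (measurableSet_bornSet v)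
  have hφ : ∀ v : Fin (n + 1) → List ℕ, Measurable fun p : ℝ × Marks =>
      (p.1 + position (fun w => (p.2 w).2) (v 0), relPos v p.2) := fun v =>
    (measurable_fst.add ((measurable_position (v 0)).comp measurable_snd)).prodMk
      ((measurable_relPos v).comp measurable_snd)
  have hGs : ∀ v p, shiftedProd f (p.1 + position (fun w => (p.2 w).2) (v 0), relPos v p.2) =
      G v p := fun v p => by
    simp only [shiftedProd, hG, relPos, Fin.prod_univ_succ]
    congr 1
    · rw [add_comm p.1]
    · refine Finset.prod_congr rfl fun j _ => ?_
      congr 1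
      ring
  have hprod : (volume : Measure ℝ).prod (familyMeasure c r d n) =
      Measure.sum fun v : Fin (n + 1) → List ℕ =>
        ((placedLaw c r d).restrict (Set.univ ×ˢ bornSet v)).map
        (fun p => (p.1 + position (fun w => (p.2 w).2) (v 0), relPos v p.2)) := by
    rw [familyMeasure, Measure.prod_sum_right]
    congr 1
    ext1 v
    exact prod_map_relPos hc v
  rw [hprod] at hint ⊢
  rw [integral_sum_measure hint]
  have h1 : ∀ v : Fin (n + 1) → List ℕ, ∫ p, shiftedProd f p
      ∂(((placedLaw c r d).restrict (Set.univ ×ˢ bornSet v)).map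
        (fun p => (p.1 + position (fun w => (p.2 w).2) (v 0), relPos v p.2))) =
      ∫ p, (Set.univ ×ˢ bornSet v).indicator (G v) p ∂(placedLaw c r d) := fun v => by
    rw [integral_map (hφ v).aemeasurable hm.aestronglyMeasurable, integral_indicator (hS v)]
    simp_rw [hGs]
  -- Absolute summability over tuples, read off from integrability of the shifted product against
  -- the sum measure; it permits exchanging the sum and the integral.
  have h2 : ∑' v : Fin (n + 1) → List ℕ, ∫⁻ p, ‖(Set.univ ×ˢ bornSet v).indicator (G v) p‖ₑ
      ∂(placedLaw c r d) ≠ ∞ := by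
    have h3 := hint.2
    rw [HasFiniteIntegral, lintegral_sum_measure] at h3
    refine (lt_of_eq_of_lt (tsum_congr fun v => ?_) h3).ne
    rw [lintegral_map hm.enorm (hφ v)]
    simp_rw [hGs]
    rw [← lintegral_indicator (hS v)]
    refine lintegral_congr fun p => ?_
    by_cases hp : p ∈ (Set.univ : Set ℝ) ×ˢ bornSet v
    · rw [Set.indicator_of_mem hp, Set.indicator_of_mem hp]
    · rw [Set.indicator_of_notMem hp, Set.indicator_of_notMem hp, enorm_zero]
  simp_rw [h1]
  rw [← integral_tsum (fun v => ((hGm v).indicator (hS v)).aestronglyMeasurable) h2]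
  refine integral_congr_ae ?_
  filter_upwards [ae_placedLaw (c := c) hfin] with p hp
  obtain ⟨s, hs, hs'⟩ := shot_eq_sum hp.ne
  have h4 := (hasSum_bornSet_indicator hs
    fun (j : Fin (n + 1)) w => f j (position (fun v => (p.2 v).2) w + p.1)).tsum_eq
  have h5 : ∀ j, shot (f j) p = _ := fun j => hs' p.1 (f j)
  simp_rw [h5]
  rw [← h4]
  refine tsum_congr fun v => ?_
  by_cases hv : p.2 ∈ bornSet v
  · rw [Set.indicator_of_mem (by simpa using hv), Set.indicator_of_mem hv]
  · rw [Set.indicator_of_notMem (by simpa using hv), Set.indicator_of_notMem hv]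

end
end
end BranchingCluster

namespace BranchingCluster
noncomputable section
open scoped ENNReal NNReal

/-! ### The reduced cumulant measures of the cluster process -/

theorem IsTestFunction.mul {f g : ℝ → ℝ} (hf : IsTestFunction f) (hg : IsTestFunction g) :
    IsTestFunction fun x => f x * g x where
  measurable := hf.measurable.mul hg.measurable
  bounded := by
    obtain ⟨B, hB⟩ := hf.bounded
    obtain ⟨B', hB'⟩ := hg.bounded
    refine ⟨B * B', fun x => ?_⟩
    rw [abs_mul]
    exact mul_le_mul (hB x) (hB' x) (abs_nonneg _) ((abs_nonneg _).trans (hB 0))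
  compact := hf.compact.mul_right

theorem exists_isWindowed_family {n : ℕ} {f : Fin n → ℝ → ℝ} (hf : ∀ j, IsTestFunction (f j)) :
    ∃ R B : ℝ, 0 ≤ B ∧ ∀ j, IsWindowed R B (f j) := by
  choose R B hB hw using fun j => (hf j).exists_isWindowed
  refine ⟨∑ j, |R j|, ∑ j, B j, Finset.sum_nonneg fun j _ => hB j, fun j x => ?_⟩
  have h1 : R j ≤ ∑ j, |R j| := (le_abs_self _).trans
    (Finset.single_le_sum (f := fun j => |R j|) (fun _ _ => abs_nonneg _) (Finset.mem_univ j))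
  have h2 : B j ≤ ∑ j, B j := Finset.single_le_sum (fun j _ => hB j) (Finset.mem_univ j)
  refine ((hw j).mono h2 x).trans (Set.indicator_le_indicator_of_subset
    (Set.Icc_subset_Icc (by linarith) h1) (fun _ => Finset.sum_nonneg fun j _ => hB j) x)

theorem integral_shiftedProd_map {m n : ℕ} {D : (Fin m → ℝ) → Fin n → ℝ} (hD : Measurable D)
    {f : Fin (n + 1) → ℝ → ℝ} (hf : ∀ j, IsTestFunction (f j)) {g : Fin (m + 1) → ℝ → ℝ}
    (h : ∀ t τ, shiftedProd f (t, D τ) = shiftedProd g (t, τ)) (μ : Measure (Fin m → ℝ))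
    [IsFiniteMeasure μ] :
    ∫ p, shiftedProd f p ∂((volume : Measure ℝ).prod (μ.map D)) =
      ∫ p, shiftedProd g p ∂((volume : Measure ℝ).prod μ) := by
  have h1 := Measure.map_prod_map (volume : Measure ℝ) μ measurable_id hD
  rw [Measure.map_id] at h1
  rw [h1, integral_map (measurable_id.prodMap hD).aemeasurable
    (measurable_shiftedProd hf).aestronglyMeasurable]
  exact integral_congr_ae (ae_of_all _ fun p => h p.1 p.2)

theorem dshot_zero (ψ : ℕ → ℝ → ℝ) (f : ℝ → ℝ) (p : ℝ × Marks) (k : ℕ) :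
    dshot ψ (fun _ => 0) f p k = ψ k 0 * shot f p := shot_const_mul _ _ _

theorem exp_shot_zero {ψ : ℕ → ℝ → ℝ} (h : ψ 0 0 = 0) (p : ℝ × Marks) :
    Real.exp (shot (fun _ => ψ 0 0) p) = 1 := by
  simp [h, shot]

/-- The image on the diagonal at the origin of the measure of single individuals. -/
def originMeasure (c : ℝ≥0∞) (r : ℝ≥0) (d : Measure ℝ) (n : ℕ) : Measure (Fin n → ℝ) :=
  (familyMeasure c r d 0).map fun _ => 0

/-- The images of `μ` on the three pair diagonals. -/
def pairDiagonals (μ : Measure (Fin 1 → ℝ)) : Measure (Fin 2 → ℝ) :=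
  μ.map (fun τ => ![τ 0, 0]) + μ.map (fun τ => ![0, τ 0]) + μ.map (fun τ => ![τ 0, τ 0])

theorem measurable_diag_fst : Measurable fun τ : Fin 1 → ℝ => ![τ 0, 0] := by fun_prop

theorem measurable_diag_snd : Measurable fun τ : Fin 1 → ℝ => ![0, τ 0] := by fun_prop

theorem measurable_diag_both : Measurable fun τ : Fin 1 → ℝ => ![τ 0, τ 0] := by fun_prop

instance (μ : Measure (Fin 1 → ℝ)) [IsFiniteMeasure μ] : IsFiniteMeasure (pairDiagonals μ) := by
  unfold pairDiagonals; infer_instance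

section
variable {c : ℝ≥0∞} {r : ℝ≥0} {d : Measure ℝ} [hF : ∀ n, IsFiniteMeasure (familyMeasure c r d n)]

instance (n : ℕ) : IsFiniteMeasure (originMeasure c r d n) := by
  unfold originMeasure; infer_instance

variable (c r d) in
/-- The reduced complete cumulant measure of order three. -/
def completeThree : SignedMeasure (Fin 2 → ℝ) := (familyMeasure c r d 2).toSignedMeasure

variable (c r d) in
/-- The reduced factorial cumulant measure of order two. -/
def factorialTwo : SignedMeasure (Fin 1 → ℝ) :=
  (familyMeasure c r d 1).toSignedMeasure - (originMeasure c r d 1).toSignedMeasure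

variable (c r d) in
/-- The reduced factorial cumulant measure of order three. -/
def factorialThree : SignedMeasure (Fin 2 → ℝ) :=
  (familyMeasure c r d 2 + (originMeasure c r d 2 + originMeasure c r d 2)).toSignedMeasure -
    (pairDiagonals (familyMeasure c r d 1)).toSignedMeasure

end

section
variable {Ω : Type*} [MeasurableSpace Ω] {P : Measure Ω} [IsProbabilityMeasure P]
  {U : ℕ → Ω → ℝ} {e : ℕ → Ω → Marks} {c : ℝ≥0∞} {r : ℝ≥0} {d : Measure ℝ}
  [IsProbabilityMeasure d] {θ : ℝ}
  (hη : IsPoissonProcess P (fun ω => Measure.sum fun j => Measure.dirac (U j ω))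
    (c • (volume : Measure ℝ)))
  (hM : IsMarked P U e (marksLaw r d)) (hc : c ≠ ∞)
  (hexp : Integrable (fun e => Real.exp (θ * (size e).toReal)) (marksLaw r d))
  (hfin : ∀ᵐ e ∂(marksLaw r d), size e < ∞) (hθ : 0 < θ)
include hc hexp hfin hθ

theorem integrable_shot_three {f g h : ℝ → ℝ} (hf : IsTestFunction f) (hg : IsTestFunction g)
    (hh : IsTestFunction h) :
    Integrable (fun p => shot f p * shot g p * shot h p) (placedLaw c r d) := by
  have ht : ∀ j : Fin 3, IsTestFunction (![f, g, h] j) := by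
    intro j; fin_cases j <;> assumption
  obtain ⟨R, B, hB, hw⟩ := exists_isWindowed_family ht
  simpa [Fin.prod_univ_three] using
    integrable_prod_shot (c := c) hc hexp hfin hθ hB (fun j => (ht j).measurable) hw

theorem integrable_shot_two {f g : ℝ → ℝ} (hf : IsTestFunction f) (hg : IsTestFunction g) :
    Integrable (fun p => shot f p * shot g p) (placedLaw c r d) := by
  have ht : ∀ j : Fin 2, IsTestFunction (![f, g] j) := by
    intro j; fin_cases j <;> assumption
  obtain ⟨R, B, hB, hw⟩ := exists_isWindowed_family ht
  simpa [Fin.prod_univ_two] using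
    integrable_prod_shot (c := c) hc hexp hfin hθ hB (fun j => (ht j).measurable) hw

theorem integrable_shot {f : ℝ → ℝ} (hf : IsTestFunction f) :
    Integrable (fun p => shot f p) (placedLaw c r d) := by
  have ht : ∀ j : Fin 1, IsTestFunction (![f] j) := by
    intro j; fin_cases j; assumption
  obtain ⟨R, B, hB, hw⟩ := exists_isWindowed_family ht
  simpa using
    integrable_prod_shot (c := c) hc hexp hfin hθ hB (fun j => (ht j).measurable) hw

theorem integral_pair {f g : ℝ → ℝ} (hf : IsTestFunction f) (hg : IsTestFunction g) :
    ∫ p, shiftedProd ![f, g] p ∂((volume : Measure ℝ).prod (familyMeasure c r d 1)) =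
      ∫ p, shot f p * shot g p ∂(placedLaw c r d) := by
  have ht : ∀ j : Fin 2, IsTestFunction (![f, g] j) := by
    intro j; fin_cases j <;> assumption
  rw [integral_shiftedProd_familyMeasure hc hexp hfin hθ ht]
  simp [Fin.prod_univ_two]

theorem integral_single {f : ℝ → ℝ} (hf : IsTestFunction f) :
    ∫ p, shiftedProd ![f] p ∂((volume : Measure ℝ).prod (familyMeasure c r d 0)) =
      ∫ p, shot f p ∂(placedLaw c r d) := by
  have ht : ∀ j : Fin 1, IsTestFunction (![f] j) := by
    intro j; fin_cases j; assumption
  rw [integral_shiftedProd_familyMeasure hc hexp hfin hθ ht]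
  simp

variable [hF : ∀ n, IsFiniteMeasure (familyMeasure c r d n)]

theorem reducedPairing_completeThree {f : Fin 3 → ℝ → ℝ} (hf : ∀ j, IsTestFunction (f j)) :
    reducedPairing (completeThree c r d) f =
      ∫ p, shot (f 0) p * shot (f 1) p * shot (f 2) p ∂(placedLaw c r d) := by
  have h : completeThree c r d = (familyMeasure c r d 2).toSignedMeasure -
      (0 : Measure (Fin 2 → ℝ)).toSignedMeasure := by
    rw [completeThree, Measure.toSignedMeasure_zero, sub_zero]
  rw [h, reducedPairing_toSignedMeasure_sub hf,
    integral_shiftedProd_familyMeasure hc hexp hfin hθ hf]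
  simp [Fin.prod_univ_three]

theorem reducedPairing_factorialTwo {f : Fin 2 → ℝ → ℝ} (hf : ∀ j, IsTestFunction (f j)) :
    reducedPairing (factorialTwo c r d) f =
      ∫ p, (shot (f 0) p * shot (f 1) p - shot (fun x => f 0 x * f 1 x) p)
        ∂(placedLaw c r d) := by
  have h01 := (hf 0).mul (hf 1)
  rw [factorialTwo, reducedPairing_toSignedMeasure_sub hf,
    integral_shiftedProd_familyMeasure hc hexp hfin hθ hf, originMeasure,
    integral_shiftedProd_map measurable_const hf (g := ![fun x => f 0 x * f 1 x])
      (fun t τ => by simp [shiftedProd]), integral_single hc hexp hfin hθ h01,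
    integral_sub (integrable_shot_two hc hexp hfin hθ (hf 0) (hf 1))
      (integrable_shot hc hexp hfin hθ h01)]
  simp [Fin.prod_univ_two]

/-- The weights `1`, `-1`, `2` attached to partitions into three, two and one blocks are products of
the derivatives of `log (1 + y)` at `0`. Pushing a family measure onto a diagonal multiplies the
test functions of the members that are identified. -/
theorem reducedPairing_factorialThree {f : Fin 3 → ℝ → ℝ} (hf : ∀ j, IsTestFunction (f j)) :
    reducedPairing (factorialThree c r d) f =
      ∫ p, (shot (f 0) p * shot (f 1) p * shot (f 2) p -
        (shot (fun x => f 0 x * f 2 x) p * shot (f 1) p +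
          shot (fun x => f 0 x * f 1 x) p * shot (f 2) p +
          shot (f 0) p * shot (fun x => f 1 x * f 2 x) p) +
        2 * shot (fun x => f 0 x * (f 1 x * f 2 x)) p) ∂(placedLaw c r d) := by
  have h01 := (hf 0).mul (hf 1)
  have h02 := (hf 0).mul (hf 2)
  have h12 := (hf 1).mul (hf 2)
  have h012 := (hf 0).mul h12
  have i0 := integrable_shot_three (c := c) hc hexp hfin hθ (hf 0) (hf 1) (hf 2)
  have i1 := integrable_shot_two (c := c) hc hexp hfin hθ h02 (hf 1)
  have i2 := integrable_shot_two (c := c) hc hexp hfin hθ h01 (hf 2)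
  have i3 := integrable_shot_two (c := c) hc hexp hfin hθ (hf 0) h12
  have i4 := integrable_shot (c := c) hc hexp hfin hθ h012
  have i12 : Integrable (fun p => shot (fun x => f 0 x * f 2 x) p * shot (f 1) p +
    shot (fun x => f 0 x * f 1 x) p * shot (f 2) p) (placedLaw c r d) := i1.add i2
  have i123 : Integrable (fun p => shot (fun x => f 0 x * f 2 x) p * shot (f 1) p +
    shot (fun x => f 0 x * f 1 x) p * shot (f 2) p +
    shot (f 0) p * shot (fun x => f 1 x * f 2 x) p) (placedLaw c r d) := i12.add i3
  have i0123 : Integrable (fun p => shot (f 0) p * shot (f 1) p * shot (f 2) p -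
    (shot (fun x => f 0 x * f 2 x) p * shot (f 1) p +
    shot (fun x => f 0 x * f 1 x) p * shot (f 2) p +
    shot (f 0) p * shot (fun x => f 1 x * f 2 x) p)) (placedLaw c r d) := i0.sub i123
  have hO : ∫ p, shiftedProd f p ∂((volume : Measure ℝ).prod (originMeasure c r d 2)) =
      ∫ p, shot (fun x => f 0 x * (f 1 x * f 2 x)) p ∂(placedLaw c r d) := by
    rw [originMeasure, integral_shiftedProd_map measurable_const hf
      (g := ![fun x => f 0 x * (f 1 x * f 2 x)]) (fun t τ => by
        simp [shiftedProd, Fin.prod_univ_two]), integral_single hc hexp hfin hθ h012]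
  have hA : ∫ p, shiftedProd f p ∂((volume : Measure ℝ).prod (familyMeasure c r d 2)) =
      ∫ p, shot (f 0) p * shot (f 1) p * shot (f 2) p ∂(placedLaw c r d) := by
    rw [integral_shiftedProd_familyMeasure hc hexp hfin hθ hf]
    simp [Fin.prod_univ_three]
  have hI := fun (μ : Measure (Fin 2 → ℝ)) (_ : IsFiniteMeasure μ) => integrable_shiftedProd hf μ
  rw [factorialThree, reducedPairing_toSignedMeasure_sub hf, pairDiagonals,
    Measure.prod_add, Measure.prod_add, Measure.prod_add, Measure.prod_add,
    integral_add_measure (hI _ inferInstance) (by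
      rw [← Measure.prod_add]; exact hI _ inferInstance),
    integral_add_measure (hI _ inferInstance) (hI _ inferInstance),
    integral_add_measure (by rw [← Measure.prod_add]; exact hI _ inferInstance)
      (hI _ inferInstance),
    integral_add_measure (hI _ inferInstance) (hI _ inferInstance), hO, hA,
    integral_shiftedProd_map measurable_diag_fst hf (g := ![fun x => f 0 x * f 2 x, f 1])
      (fun t τ => by simp [shiftedProd, Fin.prod_univ_two]; ring),
    integral_shiftedProd_map measurable_diag_snd hf (g := ![fun x => f 0 x * f 1 x, f 2])
      (fun t τ => by simp [shiftedProd, Fin.prod_univ_two]; ring),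
    integral_shiftedProd_map measurable_diag_both hf (g := ![f 0, fun x => f 1 x * f 2 x])
      (fun t τ => by simp [shiftedProd, Fin.prod_univ_two]),
    integral_pair hc hexp hfin hθ h02 (hf 1), integral_pair hc hexp hfin hθ h01 (hf 2),
    integral_pair hc hexp hfin hθ (hf 0) h12,
    integral_add i0123 (i4.const_mul 2), integral_sub i0 i123, integral_add i12 i3,
    integral_add i1 i2, integral_const_mul]
  ring

include hη hM

/-- For the identity generator the second and third derivatives vanish, so only the product of three
shots survives in `bellThree`. -/
theorem isReducedCompleteCumulant_completeThree :
    IsReducedCompleteCumulant P (superposition U e) (completeThree c r d) := by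
  intro f hf
  obtain ⟨R, B, hB, hw⟩ := exists_isWindowed_family hf
  have hfm := fun j => (hf j).measurable
  have h1 := eventually_compCGF hη hM hc hexp hfin hθ hfm hw
  refine ⟨h1.mono fun s hs => hs.1, ?_⟩
  have h2 := (hasMixedPartial_three isGenerator_idGen hc hexp hfin hθ hB hfm hw).congr
    (h1.mono fun s hs => hs.2.symm)
  convert! h2 using 1
  rw [reducedPairing_completeThree hc hexp hfin hθ hf]
  refine integral_congr_ae (ae_of_all _ fun p => ?_)
  simp only [exp_shot_zero (ψ := idGen) rfl]
  simp only [bellThree, bellTwo, dshot_zero, idGen]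
  ring

theorem isReducedFactorialCumulant_factorialThree :
    IsReducedFactorialCumulant P (superposition U e) (factorialThree c r d) := by
  intro f hf
  obtain ⟨R, B, hB, hw⟩ := exists_isWindowed_family hf
  have hfm := fun j => (hf j).measurable
  have h1 := eventually_facCGF hη hM hc hexp hfin hθ hfm hw
  refine ⟨h1.mono fun s hs => hs.1, ?_⟩
  have h2 := (hasMixedPartial_three isGenerator_logGen hc hexp hfin hθ hB hfm hw).congr
    (h1.mono fun s hs => hs.2.symm)
  convert! h2 using 1
  rw [reducedPairing_factorialThree hc hexp hfin hθ hf]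
  refine integral_congr_ae (ae_of_all _ fun p => ?_)
  simp only [exp_shot_zero (ψ := logGen) (by simp [logGen])]
  simp only [bellThree, bellTwo, dshot_zero, logGen]
  norm_num [Nat.factorial]
  ring

theorem isReducedFactorialCumulant_factorialTwo :
    IsReducedFactorialCumulant P (superposition U e) (factorialTwo c r d) := by
  intro f hf
  obtain ⟨R, B, hB, hw⟩ := exists_isWindowed_family hf
  have hfm := fun j => (hf j).measurable
  have h1 := eventually_facCGF hη hM hc hexp hfin hθ hfm hw
  refine ⟨h1.mono fun s hs => hs.1, ?_⟩
  have h2 := (hasMixedPartial_two isGenerator_logGen hc hexp hfin hθ hB hfm hw).congr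
    (h1.mono fun s hs => hs.2.symm)
  convert! h2 using 1
  rw [reducedPairing_factorialTwo hc hexp hfin hθ hf]
  refine integral_congr_ae (ae_of_all _ fun p => ?_)
  simp only [exp_shot_zero (ψ := logGen) (by simp [logGen])]
  simp only [bellTwo, dshot_zero, logGen]
  norm_num [Nat.factorial]
  ring

end
end
end BranchingCluster

namespace BranchingCluster
noncomputable section
open scoped ENNReal NNReal

/-! ### Transforms of symmetric measures -/

theorem measurable_wave {q : ℕ} (w : Fin q → ℝ) : Measurable (wave w) := by
  unfold wave; fun_prop

theorem norm_wave {q : ℕ} (w τ : Fin q → ℝ) : ‖wave w τ‖ = 1 := by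
  have h : wave w τ = Complex.exp (((-∑ j, w j * τ j : ℝ) : ℂ) * Complex.I) := by
    rw [wave]; congr 1; push_cast; ring
  rw [h, Complex.norm_exp_ofReal_mul_I]

theorem wave_neg {q : ℕ} (w τ : Fin q → ℝ) :
    wave w (-τ) = (starRingEnd ℂ) (wave w τ) := by
  rw [wave, wave, ← Complex.exp_conj]
  congr 1
  simp

theorem integrable_wave {q : ℕ} (w : Fin q → ℝ) (μ : Measure (Fin q → ℝ)) [IsFiniteMeasure μ] :
    Integrable (wave w) μ :=
  (integrable_const (1 : ℝ)).mono' (measurable_wave w).aestronglyMeasurable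
    (ae_of_all _ fun τ => (norm_wave w τ).le)

theorem fourierStieltjes_toSignedMeasure_sub {q : ℕ} (w : Fin q → ℝ) (μ μ' : Measure (Fin q → ℝ))
    [IsFiniteMeasure μ] [IsFiniteMeasure μ'] :
    fourierStieltjes (μ.toSignedMeasure - μ'.toSignedMeasure) w =
      ∫ τ, wave w τ ∂μ - ∫ τ, wave w τ ∂μ' := by
  rw [fourierStieltjes, VectorMeasure.integral_sub_vectorMeasure,
    VectorMeasure.integral_toSignedMeasure, VectorMeasure.integral_toSignedMeasure]
  · rw [VectorMeasure.Integrable, Measure.variation_toSignedMeasure]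
    exact integrable_wave w μ
  · rw [VectorMeasure.Integrable, Measure.variation_toSignedMeasure]
    exact integrable_wave w μ'

/-- Negation conjugates the wave, so the transform of an even measure equals its own conjugate. -/
theorem im_integral_wave {q : ℕ} (w : Fin q → ℝ) {μ : Measure (Fin q → ℝ)}
    (h : μ.map (fun τ => -τ) = μ) : (∫ τ, wave w τ ∂μ).im = 0 := by
  rw [← Complex.conj_eq_iff_im, ← integral_conj]
  conv_rhs => rw [← h]
  rw [integral_map measurable_neg.aemeasurable (measurable_wave w).aestronglyMeasurable]
  simp_rw [wave_neg]

theorem im_fourierStieltjes_toSignedMeasure_sub {q : ℕ} (w : Fin q → ℝ)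
    {μ μ' : Measure (Fin q → ℝ)} [IsFiniteMeasure μ] [IsFiniteMeasure μ']
    (h : μ.map (fun τ => -τ) = μ) (h' : μ'.map (fun τ => -τ) = μ') :
    (fourierStieltjes (μ.toSignedMeasure - μ'.toSignedMeasure) w).im = 0 := by
  rw [fourierStieltjes_toSignedMeasure_sub, Complex.sub_im, im_integral_wave w h,
    im_integral_wave w h', sub_zero]

theorem fourierStieltjes_withDensityᵥ {q : ℕ} {f : (Fin q → ℝ) → ℝ} (hf : Integrable f)
    (w : Fin q → ℝ) :
    fourierStieltjes ((volume : Measure (Fin q → ℝ)).withDensityᵥ f) w =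
      ∫ τ, wave w τ * (f τ : ℂ) := by
  have := isFiniteMeasure_withDensity_ofReal hf.2
  have := isFiniteMeasure_withDensity_ofReal hf.neg.2
  have key : ∀ {g : (Fin q → ℝ) → ℝ}, Integrable g →
      (∫ τ, wave w τ ∂((volume : Measure (Fin q → ℝ)).withDensity fun τ => ENNReal.ofReal (g τ)) =
        ∫ τ, (ENNReal.ofReal (g τ)).toReal • wave w τ) ∧
      Integrable (fun τ => (ENNReal.ofReal (g τ)).toReal • wave w τ) := fun {g} hg => by
    have := isFiniteMeasure_withDensity_ofReal hg.2
    have hm := hg.aemeasurable.ennreal_ofReal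
    have ht : ∀ᵐ τ : Fin q → ℝ, ENNReal.ofReal (g τ) < ∞ := ae_of_all _ fun _ => ENNReal.ofReal_lt_top
    exact ⟨integral_withDensity_eq_integral_toReal_smul₀ hm ht _,
      (integrable_withDensity_iff_integrable_smul₀' hm ht).1 (integrable_wave w _)⟩
  have hs := withDensityᵥ_eq_withDensity_pos_part_sub_withDensity_neg_part hf
  rw [hs]
  refine (fourierStieltjes_toSignedMeasure_sub w _ _).trans ?_
  rw [(key hf).1, (key hf.fun_neg).1, ← integral_sub (key hf).2 (key hf.fun_neg).2]
  refine integral_congr_ae (ae_of_all _ fun τ => ?_)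
  beta_reduce
  rw [← sub_smul, Complex.real_smul, mul_comm]
  congr 2
  rcases le_total 0 (f τ) with h | h
  · rw [ENNReal.toReal_ofReal h, ENNReal.ofReal_of_nonpos (by linarith)]; simp
  · rw [ENNReal.ofReal_of_nonpos h, ENNReal.toReal_ofReal (by linarith)]; simp

/-! ### The diagonal part -/

theorem map_neg_pairDiagonals {μ : Measure (Fin 1 → ℝ)} (h : μ.map (fun τ => -τ) = μ) :
    (pairDiagonals μ).map (fun τ => -τ) = pairDiagonals μ := by
  have key : ∀ {g : (Fin 1 → ℝ) → Fin 2 → ℝ}, Measurable g → (∀ τ, g (-τ) = -g τ) →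
      (μ.map g).map (fun τ => -τ) = μ.map g := fun {g} hg hneg => by
    conv_rhs => rw [← h]
    rw [Measure.map_map measurable_neg hg, Measure.map_map hg measurable_neg]
    congr 1
    ext1 τ
    exact (hneg τ).symm
  rw [pairDiagonals, Measure.map_add _ _ measurable_neg, Measure.map_add _ _ measurable_neg,
    key measurable_diag_fst fun τ => by simp, key measurable_diag_snd fun τ => by simp,
    key measurable_diag_both fun τ => by simp]

/-- The union of the three pair diagonals. -/
def diagonals : Set (Fin 2 → ℝ) := {τ | τ 0 = 0 ∨ τ 1 = 0 ∨ τ 0 = τ 1}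

theorem measurableSet_diagonals : MeasurableSet diagonals := by
  unfold diagonals
  exact (measurableSet_eq_fun (measurable_pi_apply 0) measurable_const).union
    ((measurableSet_eq_fun (measurable_pi_apply 1) measurable_const).union
      (measurableSet_eq_fun (measurable_pi_apply 0) (measurable_pi_apply 1)))

/-- The three diagonals are kernels of nonzero linear forms, hence proper subspaces. -/
theorem volume_diagonals : (volume : Measure (Fin 2 → ℝ)) diagonals = 0 := by
  have key : ∀ L : (Fin 2 → ℝ) →ₗ[ℝ] ℝ, L ≠ 0 → (volume : Measure (Fin 2 → ℝ)) {τ | L τ = 0} = 0 :=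
    fun L hL => Measure.addHaar_submodule volume (LinearMap.ker L)
      fun h => hL (LinearMap.ker_eq_top.1 h)
  have h0 := key (LinearMap.proj 0) fun h => by simpa using LinearMap.congr_fun h ![1, 0]
  have h1 := key (LinearMap.proj 1) fun h => by simpa using LinearMap.congr_fun h ![0, 1]
  have h2 := key ((LinearMap.proj 0 : (Fin 2 → ℝ) →ₗ[ℝ] ℝ) - LinearMap.proj 1) fun h => by
    simpa using LinearMap.congr_fun h ![1, 0]
  refine measure_mono_null ?_ (measure_union_null h0 (measure_union_null h1 h2))
  rintro τ (h | h | h)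
  · exact Or.inl h
  · exact Or.inr (Or.inl h)
  · exact Or.inr (Or.inr (by simpa [sub_eq_zero] using h))

theorem pairDiagonals_compl_diagonals (μ : Measure (Fin 1 → ℝ)) :
    pairDiagonals μ diagonalsᶜ = 0 := by
  have key : ∀ {g : (Fin 1 → ℝ) → Fin 2 → ℝ}, Measurable g → (∀ τ, g τ ∈ diagonals) →
      μ.map g diagonalsᶜ = 0 := fun {g} hg hmem => by
    rw [Measure.map_apply hg measurableSet_diagonals.compl]
    simp [Set.preimage, hmem]
  rw [pairDiagonals, Measure.add_apply, Measure.add_apply,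
    key measurable_diag_fst fun τ => by simp [diagonals],
    key measurable_diag_snd fun τ => by simp [diagonals],
    key measurable_diag_both fun τ => by simp [diagonals], add_zero, add_zero]

theorem mutuallySingular_toSignedMeasure_sub {α : Type*} [MeasurableSpace α] {μ μ' ρ : Measure α}
    [IsFiniteMeasure μ] [IsFiniteMeasure μ'] {S : Set α} (hS : MeasurableSet S)
    (h : μ Sᶜ = 0) (h' : μ' Sᶜ = 0) (hρ : ρ S = 0) :
    (μ.toSignedMeasure - μ'.toSignedMeasure).MutuallySingular ρ.toENNRealVectorMeasure := by
  refine ⟨Sᶜ, hS.compl, fun t ht => ?_, fun t ht => ?_⟩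
  · by_cases hm : MeasurableSet t
    · rw [Measure.toSignedMeasure_sub_apply hm, measureReal_def, measureReal_def,
        measure_mono_null ht h, measure_mono_null ht h', sub_self]
    · exact VectorMeasure.not_measurable _ hm
  · rw [compl_compl] at ht
    by_cases hm : MeasurableSet t
    · rw [Measure.toENNRealVectorMeasure_apply_measurable hm, measure_mono_null ht hρ]
    · exact VectorMeasure.not_measurable _ hm

theorem map_toSignedMeasure {α β : Type*} [MeasurableSpace α] [MeasurableSpace β] {μ : Measure α}
    [IsFiniteMeasure μ] {g : α → β} (hg : Measurable g) :
    μ.toSignedMeasure.map g = (μ.map g).toSignedMeasure := by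
  ext S hS
  rw [VectorMeasure.map_apply _ hg hS, Measure.toSignedMeasure_apply_measurable (hg hS),
    Measure.toSignedMeasure_apply_measurable hS, map_measureReal_apply hg hS]

section
variable {c : ℝ≥0∞} {r : ℝ≥0} {d : Measure ℝ} [hF : ∀ n, IsFiniteMeasure (familyMeasure c r d n)]

omit hF in
theorem originMeasure_eq (n : ℕ) : originMeasure c r d n =
    familyMeasure c r d 0 Set.univ • Measure.dirac 0 := by
  rw [originMeasure, Measure.map_const]

omit hF in
theorem map_neg_originMeasure (n : ℕ) :
    (originMeasure c r d n).map (fun τ => -τ) = originMeasure c r d n := by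
  rw [originMeasure, Measure.map_map measurable_neg measurable_const]
  congr 1
  ext
  simp

omit hF in
theorem map_originMeasure {g : (Fin 1 → ℝ) → Fin 2 → ℝ} (hg : Measurable g) (h : g 0 = 0) :
    (originMeasure c r d 1).map g = originMeasure c r d 2 := by
  rw [originMeasure, originMeasure, Measure.map_map hg measurable_const]
  congr 1
  ext1 τ
  exact h

omit hF in
theorem originMeasure_compl_diagonals : originMeasure c r d 2 diagonalsᶜ = 0 := by
  rw [originMeasure, Measure.map_apply measurable_const measurableSet_diagonals.compl]
  simp [diagonals]

theorem toSignedMeasure_originMeasure {lam : ℝ} (h : (familyMeasure c r d 0).real Set.univ = lam) :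
    (originMeasure c r d 2).toSignedMeasure =
      lam • (Measure.dirac (0 : Fin 2 → ℝ)).toSignedMeasure := by
  ext S hS
  rw [Measure.toSignedMeasure_apply_measurable hS, _root_.smul_apply,
    Measure.toSignedMeasure_apply_measurable hS, originMeasure_eq, measureReal_ennreal_smul_apply,
    ← h, smul_eq_mul, measureReal_def (familyMeasure c r d 0)]

/-- Each of the three images of `factorialTwo` removes one origin mass and the term in `lam`
restores one, so two are removed in total. These are the two that `factorialThree` adds, whence the
cancellation in `completeThree_eq`. -/
theorem diagonalPart_factorialTwo {lam : ℝ} (h : (familyMeasure c r d 0).real Set.univ = lam) :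
    diagonalPart lam (factorialTwo c r d) =
      (pairDiagonals (familyMeasure c r d 1)).toSignedMeasure -
        (originMeasure c r d 2 + originMeasure c r d 2).toSignedMeasure := by
  have key : ∀ {g : (Fin 1 → ℝ) → Fin 2 → ℝ}, Measurable g → g 0 = 0 →
      (factorialTwo c r d).map g = ((familyMeasure c r d 1).map g).toSignedMeasure -
        (originMeasure c r d 2).toSignedMeasure := fun {g} hg h0 => by
    rw [← Measure.toSignedMeasure_congr (map_originMeasure hg h0), eq_sub_iff_add_eq,
      ← map_toSignedMeasure hg, ← map_toSignedMeasure hg, ← VectorMeasure.map_add, factorialTwo,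
      sub_add_cancel]
  rw [diagonalPart, key measurable_diag_fst (by simp), key measurable_diag_snd (by simp),
    key measurable_diag_both (by simp), ← toSignedMeasure_originMeasure h]
  simp only [pairDiagonals, Measure.toSignedMeasure_add]
  abel

theorem completeThree_eq {lam : ℝ} (h : (familyMeasure c r d 0).real Set.univ = lam) :
    completeThree c r d = factorialThree c r d + diagonalPart lam (factorialTwo c r d) := by
  rw [diagonalPart_factorialTwo h, completeThree, factorialThree]
  simp only [Measure.toSignedMeasure_add]
  abel

theorem mutuallySingular_diagonalPart {lam : ℝ}
    (h : (familyMeasure c r d 0).real Set.univ = lam) :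
    (diagonalPart lam (factorialTwo c r d)).MutuallySingular
      (volume : Measure (Fin 2 → ℝ)).toENNRealVectorMeasure := by
  rw [diagonalPart_factorialTwo h]
  exact mutuallySingular_toSignedMeasure_sub measurableSet_diagonals
    (pairDiagonals_compl_diagonals _) (by simp [originMeasure_compl_diagonals]) volume_diagonals

variable [IsProbabilityMeasure d] (hd : d.map (fun x => -x) = d)
include hd

theorem im_fourierStieltjes_diagonalPart {lam : ℝ}
    (h : (familyMeasure c r d 0).real Set.univ = lam) (w : Fin 2 → ℝ) :
    (fourierStieltjes (diagonalPart lam (factorialTwo c r d)) w).im = 0 := by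
  rw [diagonalPart_factorialTwo h]
  refine im_fourierStieltjes_toSignedMeasure_sub w
    (map_neg_pairDiagonals (map_neg_familyMeasure hd 1)) ?_
  rw [Measure.map_add _ _ measurable_neg, map_neg_originMeasure]

theorem im_fourierStieltjes_factorialThree (w : Fin 2 → ℝ) :
    (fourierStieltjes (factorialThree c r d) w).im = 0 := by
  refine im_fourierStieltjes_toSignedMeasure_sub w ?_
    (map_neg_pairDiagonals (map_neg_familyMeasure hd 1))
  rw [Measure.map_add _ _ measurable_neg, Measure.map_add _ _ measurable_neg,
    map_neg_originMeasure, map_neg_familyMeasure hd 2]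

theorem im_fourierStieltjes_completeThree (w : Fin 2 → ℝ) :
    (fourierStieltjes (completeThree c r d) w).im = 0 := by
  rw [completeThree, fourierStieltjes, VectorMeasure.integral_toSignedMeasure]
  exact im_integral_wave w (map_neg_familyMeasure hd 2)

end

section
variable {c : ℝ≥0∞} {r : ℝ≥0} {d : Measure ℝ} [IsProbabilityMeasure d]

theorem familyMeasure_zero_real_univ (hr : r < 1)
    (hfin : ∀ᵐ e ∂(marksLaw r d), size e < ∞) :
    (familyMeasure c r d 0).real Set.univ = c.toReal / (1 - r) := by
  have hr' : (r : ℝ) < 1 := by exact_mod_cast hr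
  rw [measureReal_def, familyMeasure_univ hfin]
  simp only [zero_add, pow_one]
  rw [lintegral_size_eq hr, ENNReal.toReal_mul,
    ENNReal.toReal_ofReal (inv_nonneg.2 (by linarith)), div_eq_mul_inv]

end
end
end BranchingCluster

namespace BranchingCluster
noncomputable section
open scoped ENNReal NNReal

/-! ### The branching model as a marked Poisson process -/

section
variable {Ω : Type*} [MeasurableSpace Ω] {P : Measure Ω}
  {m ν : ℝ} {h : ℝ → ℝ} {U : ℕ → Ω → ℝ} {K : ℕ → List ℕ → Ω → ℕ} {D : ℕ → List ℕ → Ω → ℝ}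

/-- The marks of the family tree of the `j`-th immigrant. -/
def marksOf (K : ℕ → List ℕ → Ω → ℕ) (D : ℕ → List ℕ → Ω → ℝ) (j : ℕ) (ω : Ω) : Marks :=
  fun v => (K j v ω, D j v ω)

omit [MeasurableSpace Ω] in
theorem process_eq_superposition : process U K D = superposition U (marksOf K D) := rfl

omit [MeasurableSpace Ω] in
theorem rootedCluster_eq_clusterOf (j : ℕ) :
    rootedCluster K D j = fun ω => clusterOf (marksOf K D j ω) := rfl

omit [MeasurableSpace Ω] in
theorem rootedCluster_univ (j : ℕ) (ω : Ω) :
    rootedCluster K D j ω Set.univ = size (marksOf K D j ω) := rfl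

/-- The marks form one independent family indexed by immigrant and label; currying it gives an
i.i.d. sequence of marked trees. -/
theorem IsBranchingModel.isMarked (model : IsBranchingModel P m ν h U K D)
    [IsProbabilityMeasure ((volume : Measure ℝ).withDensity fun x => ENNReal.ofReal (h x))] :
    IsMarked P U (marksOf K D) (marksLaw m.toNNReal
      ((volume : Measure ℝ).withDensity fun x => ENNReal.ofReal (h x))) where
  measurable_points := model.measurable_U
  measurable_marks j := measurable_pi_lambda _ fun v =>
    (model.measurable_K j v).prodMk (model.measurable_D j v)
  law_marks := by
    have hm : Measurable fun ω (p : ℕ × List ℕ) => (K p.1 p.2 ω, D p.1 p.2 ω) :=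
      measurable_pi_lambda _ fun p => (model.measurable_K p.1 p.2).prodMk (model.measurable_D p.1 p.2)
    have h1 := model.indep_marks.map_fun_eq_infinitePi_map₀ hm.aemeasurable
    simp_rw [model.law_marks] at h1
    have h2 := Measure.infinitePi_map_curry (ι := ℕ) (κ := List ℕ) fun _ _ =>
      (poissonMeasure m.toNNReal).prod
        ((volume : Measure ℝ).withDensity fun x => ENNReal.ofReal (h x))
    rw [← h1, Measure.map_map (MeasurableEquiv.measurable _) hm] at h2
    exact h2
  indep := model.indep_immigrants.comp measurable_id
    (MeasurableEquiv.curry ℕ (List ℕ) (ℕ × ℝ)).measurable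

theorem map_neg_withDensity_ofReal (h_meas : Measurable h) (h_even : ∀ᵐ x, h (-x) = h x) :
    ((volume : Measure ℝ).withDensity fun x => ENNReal.ofReal (h x)).map (fun x => -x) =
      (volume : Measure ℝ).withDensity fun x => ENNReal.ofReal (h x) := by
  ext S hS
  rw [Measure.map_apply measurable_neg hS, withDensity_apply _ (measurable_neg hS),
    withDensity_apply _ hS, ← (Measure.measurePreserving_neg (volume : Measure ℝ)).setLIntegral_comp_preimage
      hS h_meas.ennreal_ofReal]
  refine lintegral_congr_ae (ae_restrict_of_ae ?_)
  filter_upwards [h_even] with x hx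
  rw [hx]

theorem isProbabilityMeasure_withDensity_ofReal (h_mass : ∫⁻ x, ENNReal.ofReal (h x) = 1) :
    IsProbabilityMeasure ((volume : Measure ℝ).withDensity fun x => ENNReal.ofReal (h x)) :=
  ⟨by rw [withDensity_apply _ MeasurableSet.univ, Measure.restrict_univ, h_mass]⟩

end

section
variable {r : ℝ≥0} {d : Measure ℝ}

theorem identDistrib_clusterOf_reflect [IsProbabilityMeasure d] {Ω : Type*} [MeasurableSpace Ω] {P : Measure Ω}
    {e : Ω → Marks} (he : Measurable e) (hlaw : P.map e = marksLaw r d)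
    (hd : d.map (fun x => -x) = d) :
    IdentDistrib (fun ω => clusterOf (e ω)) (fun ω => reflect (clusterOf (e ω))) P P where
  aemeasurable_fst := (measurable_clusterOf.comp he).aemeasurable
  aemeasurable_snd := (measurable_reflect.comp (measurable_clusterOf.comp he)).aemeasurable
  map_eq := by
    have h2 : (fun ω => reflect (clusterOf (e ω))) = fun ω => clusterOf (negMarks (e ω)) := by
      ext1 ω; rw [clusterOf_negMarks]
    have h3 := Measure.map_map (μ := P) measurable_clusterOf he
    have h4 := Measure.map_map (μ := P) measurable_clusterOf (measurable_negMarks.comp he)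
    have h5 := Measure.map_map (μ := P) measurable_negMarks he
    rw [hlaw, map_negMarks r hd] at h5
    rw [hlaw] at h3
    rw [← h5] at h4
    rw [h2]
    exact h3.symm.trans h4

theorem lintegral_size_pow_three_lt_top {θ : ℝ} (hθ : 0 < θ)
    (hexp : Integrable (fun e => Real.exp (θ * (size e).toReal)) (marksLaw r d))
    (hfin : ∀ᵐ e ∂(marksLaw r d), size e < ∞) : ∫⁻ e, size e ^ 3 ∂(marksLaw r d) < ∞ := by
  have h4 := (integrable_pow_mul_exp hexp 3 hθ).2
  rw [hasFiniteIntegral_iff_ofReal (ae_of_all _ fun e => by positivity)] at h4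
  refine lt_of_eq_of_lt (lintegral_congr_ae ?_) h4
  filter_upwards [hfin] with e he
  simp [ENNReal.ofReal_toReal he.ne, ENNReal.ofReal_pow]

theorem integrable_exp_size_of_le {θ δ : ℝ} (hδ : δ ≤ θ)
    (hexp : Integrable (fun e => Real.exp (θ * (size e).toReal)) (marksLaw r d)) :
    Integrable (fun e => Real.exp (δ * (size e).toReal)) (marksLaw r d) :=
  hexp.mono' (measurable_size.ennreal_toReal.const_mul δ).exp.aestronglyMeasurable
    (ae_of_all _ fun e => by
      rw [Real.norm_eq_abs, abs_of_pos (Real.exp_pos _)]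
      exact Real.exp_le_exp.2 (mul_le_mul_of_nonneg_right hδ ENNReal.toReal_nonneg))

end
end
end BranchingCluster

/-! ### Assembly of the theorem -/

theorem mainTheorem8 {Ω : Type*} [MeasurableSpace Ω] (P : Measure Ω) [IsProbabilityMeasure P]
    (m ν : ℝ) (hm0 : 0 < m) (hm1 : m < 1) (hν : 0 < ν)
    (h : ℝ → ℝ) (h_meas : Measurable h) (h_nonneg : ∀ᵐ x, 0 ≤ h x)
    (h_mass : ∫⁻ x, ENNReal.ofReal (h x) = 1) (h_even : ∀ᵐ x, h (-x) = h x)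
    (U : ℕ → Ω → ℝ) (K : ℕ → List ℕ → Ω → ℕ) (D : ℕ → List ℕ → Ω → ℝ)
    (model : BranchingCluster.IsBranchingModel P m ν h U K D) :
    -- the cluster law is symmetric
    (∀ j, IdentDistrib (BranchingCluster.rootedCluster K D j)
      (fun ω => BranchingCluster.reflect (BranchingCluster.rootedCluster K D j ω)) P P) ∧
    -- the total progeny is a.s. finite and has the Borel law, finite exponential moments in a
    -- neighbourhood of the origin, and a finite third moment
    (∀ j, (∀ᵐ ω ∂P, BranchingCluster.rootedCluster K D j ω Set.univ < ⊤) ∧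
      (∀ n : ℕ, 1 ≤ n → P {ω | BranchingCluster.rootedCluster K D j ω Set.univ = n} =
        ENNReal.ofReal (Real.exp (-(m * n)) * (m * n) ^ (n - 1) / n.factorial)) ∧
      (∃ ε : ℝ, 0 < ε ∧ ∀ θ : ℝ, |θ| < ε → Integrable (fun ω =>
        Real.exp (θ * (BranchingCluster.rootedCluster K D j ω Set.univ).toReal)) P) ∧
      ∫⁻ ω, (BranchingCluster.rootedCluster K D j ω Set.univ) ^ 3 ∂P < ⊤) ∧
    -- the process is reversible
    BranchingCluster.IsReversible P (BranchingCluster.process U K D) ∧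
    -- the reduced cumulants exist as finite signed measures
    (∃ γ₃ : SignedMeasure (Fin 2 → ℝ),
      BranchingCluster.IsReducedCompleteCumulant P (BranchingCluster.process U K D) γ₃) ∧
    (∃ κ₃ : SignedMeasure (Fin 2 → ℝ),
      BranchingCluster.IsReducedFactorialCumulant P (BranchingCluster.process U K D) κ₃) ∧
    (∃ κ₂ : SignedMeasure (Fin 1 → ℝ),
      BranchingCluster.IsReducedFactorialCumulant P (BranchingCluster.process U K D) κ₂) ∧
    -- the complete third-order transform is real
    (∀ γ₃ : SignedMeasure (Fin 2 → ℝ),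
      BranchingCluster.IsReducedCompleteCumulant P (BranchingCluster.process U K D) γ₃ →
      ∀ w, (BranchingCluster.fourierStieltjes γ₃ w).im = 0) ∧
    -- the factorial third-order transform is real, and so is the bispectrum if there is a density
    (∀ κ₃ : SignedMeasure (Fin 2 → ℝ),
      BranchingCluster.IsReducedFactorialCumulant P (BranchingCluster.process U K D) κ₃ →
      (∀ w, (BranchingCluster.fourierStieltjes κ₃ w).im = 0) ∧
      ∀ c : (Fin 2 → ℝ) → ℝ, Integrable c → κ₃ = (volume : Measure (Fin 2 → ℝ)).withDensityᵥ c →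
        ∀ w, (∫ τ, BranchingCluster.wave w τ * (c τ : ℂ)).im = 0) ∧
    -- the complete cumulant is the factorial one plus singular diagonal components, whose
    -- transform is real
    (∀ (γ₃ κ₃ : SignedMeasure (Fin 2 → ℝ)) (κ₂ : SignedMeasure (Fin 1 → ℝ)),
      BranchingCluster.IsReducedCompleteCumulant P (BranchingCluster.process U K D) γ₃ →
      BranchingCluster.IsReducedFactorialCumulant P (BranchingCluster.process U K D) κ₃ →
      BranchingCluster.IsReducedFactorialCumulant P (BranchingCluster.process U K D) κ₂ →
      γ₃ = κ₃ + BranchingCluster.diagonalPart (ν / (1 - m)) κ₂ ∧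
      (BranchingCluster.diagonalPart (ν / (1 - m)) κ₂).MutuallySingular
        (volume : Measure (Fin 2 → ℝ)).toENNRealVectorMeasure ∧
      ∀ w, (BranchingCluster.fourierStieltjes
        (BranchingCluster.diagonalPart (ν / (1 - m)) κ₂) w).im = 0) := by
  have hr : m.toNNReal < 1 := by rwa [Real.toNNReal_lt_one]
  have hrm : (m.toNNReal : ℝ) = m := Real.coe_toNNReal m hm0.le
  have := BranchingCluster.isProbabilityMeasure_withDensity_ofReal h_mass
  have hd := BranchingCluster.map_neg_withDensity_ofReal h_meas h_even
  have hM := model.isMarked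
  have hη := model.immigrants
  set d := (volume : Measure ℝ).withDensity fun x => ENNReal.ofReal (h x)
  have hfin := BranchingCluster.ae_size_lt_top hr d
  obtain ⟨θ, hθ, hexp⟩ := BranchingCluster.exists_integrable_exp_size hr d
  have hc : ENNReal.ofReal ν ≠ ⊤ := ENNReal.ofReal_ne_top
  have hF : ∀ n, IsFiniteMeasure
      (BranchingCluster.familyMeasure (ENNReal.ofReal ν) m.toNNReal d n) :=
    BranchingCluster.isFiniteMeasure_familyMeasure hc hθ hexp hfin
  have hlam := BranchingCluster.familyMeasure_zero_real_univ (c := ENNReal.ofReal ν) hr hfin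
  rw [ENNReal.toReal_ofReal hν.le, hrm] at hlam
  rw [BranchingCluster.process_eq_superposition]
  simp only [BranchingCluster.rootedCluster_univ]
  simp only [BranchingCluster.rootedCluster_eq_clusterOf]
  have hγ₃ : BranchingCluster.IsReducedCompleteCumulant P
      (BranchingCluster.superposition U (BranchingCluster.marksOf K D)) _ :=
    BranchingCluster.isReducedCompleteCumulant_completeThree hη hM hc hexp hfin hθ
  have hκ₃ : BranchingCluster.IsReducedFactorialCumulant P
      (BranchingCluster.superposition U (BranchingCluster.marksOf K D)) _ :=
    BranchingCluster.isReducedFactorialCumulant_factorialThree hη hM hc hexp hfin hθ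
  have hκ₂ : BranchingCluster.IsReducedFactorialCumulant P
      (BranchingCluster.superposition U (BranchingCluster.marksOf K D)) _ :=
    BranchingCluster.isReducedFactorialCumulant_factorialTwo hη hM hc hexp hfin hθ
  refine ⟨fun j => BranchingCluster.identDistrib_clusterOf_reflect (hM.measurable_marks j)
    (hM.map_marks j) hd, fun j => ?_, BranchingCluster.isReversible_superposition hη hM hc hexp
    hfin hθ hd, ⟨_, hγ₃⟩, ⟨_, hκ₃⟩, ⟨_, hκ₂⟩, fun γ₃ h₃ w => ?_, fun κ₃ h₃ => ?_,
    fun γ₃ κ₃ κ₂ hγ hκ hκ' => ?_⟩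
  · have he := hM.measurable_marks j
    have hlaw := hM.map_marks j
    have hms := BranchingCluster.measurable_size
    refine ⟨?_, fun n hn => ?_, ⟨θ, hθ, fun δ hδ => ?_⟩, ?_⟩
    · rw [← hlaw] at hfin
      exact ae_of_ae_map he.aemeasurable hfin
    · have h1 := BranchingCluster.measure_size_eq m.toNNReal d hn
      have h2 : MeasurableSet {e | BranchingCluster.size e = n} :=
        hms (measurableSet_singleton _)
      rw [← hlaw, Measure.map_apply he h2, hrm] at h1
      exact h1
    -- Negative exponents need no separate argument: the size is nonnegative, so `δ ≤ θ` suffices.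
    · have h1 := BranchingCluster.integrable_exp_size_of_le ((le_abs_self δ).trans hδ.le) hexp
      rw [← hlaw] at h1
      exact h1.comp_measurable he
    · have h1 := BranchingCluster.lintegral_size_pow_three_lt_top hθ hexp hfin
      rw [← hlaw, lintegral_map (hms.pow_const 3) he] at h1
      exact h1
  -- By uniqueness, an arbitrary reduced cumulant is the explicit one built from the family
  -- measures.
  · rw [h₃.unique hγ₃]
    exact BranchingCluster.im_fourierStieltjes_completeThree hd w
  · obtain rfl := h₃.unique hκ₃
    have h1 := BranchingCluster.im_fourierStieltjes_factorialThree
      (c := ENNReal.ofReal ν) (r := m.toNNReal) hd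
    refine ⟨h1, fun c hci hdens w => ?_⟩
    rw [← BranchingCluster.fourierStieltjes_withDensityᵥ hci, ← hdens]
    exact h1 w
  · rw [hγ.unique hγ₃, hκ.unique hκ₃, hκ'.unique hκ₂]
    exact ⟨BranchingCluster.completeThree_eq hlam,
      BranchingCluster.mutuallySingular_diagonalPart hlam,
      BranchingCluster.im_fourierStieltjes_diagonalPart hd hlam⟩
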